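/- **Proposition 4.1 (Strong stability).** Let $p\in[1,\infty)$ and let $a:[0,1]\to\mathbb R$ be a non-negative continuous function satisfying $(\mathbf{H_1})$: there are $a_0>0$ and a nondegenerate interval $[c,d]\subset[0,1]$ with $c=0$ or $d=1$ such that $a\ge a_0$ on $[c,d]$. Let $X_p=W^{1,p}_0(0,1)\times L^p(0,1)$ with the norm $$\|(u,v)\|_{X_p}=\Big(\frac1p\int_0^1\big(|u'+v|^p+|u'-v|^p\big)\,dx\Big)^{1/p}.$$ For $(z_0,z_1)\in X_p$, a weak solution of $$z_{tt}-z_{xx}+a(x)z_t=0 \ \text{ on } \mathbb R_+\times(0,1),\qquad z(t,0)=z(t,1)=0,\qquad z(0,\cdot)=z_0,\quad z_t(0,\cdot)=z_1$$ is a function $z\in L^\infty(\mathbb R_+,W^{1,p}_0(0,1))\cap W^{1,\infty}(\mathbb R_+,L^p(0,1))$ which satisfies, for every $t\ge0$ and almost every $x\in(0,1)$, d'Alembert's formula $$z(t,x)=\tfrac12\big[\tilde z_0(x+t)+\tilde z_0(x-t)\big]+\tfrac12\int_{x-t}^{x+t}\tilde z_1(s)\,ds+\tfrac12\int_0^t\int_{x-(t-s)}^{x+(t-s)}\tilde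 g(s,\tau)\,d\tau\,ds,\qquad \tilde g(s,\tau)=-\tilde a(\tau)\,\tilde z_t(s,\tau),$$ where $\tilde z_0$, $\tilde z_1$ and $\tilde z_t(s,\cdot)$ are the $2$-periodic extensions to $\mathbb R$ of the odd extensions to $[-1,1]$ of $z_0$, $z_1$ and $z_t(s,\cdot)$, and $\tilde a$ is the $2$-periodic extension of the even extension of $a$. Then, for every $(z_0,z_1)\in X_p$, every weak solution $z$ starting at $(z_0,z_1)$ tends to zero in $X_p$ as $t\to\infty$: for every $t\ge0$ one has $z(t,\cdot)\in W^{1,p}_0(0,1)$, the derivative $z_t(t,\cdot)\in L^p(0,1)$ of $t\mapsto z(t,\cdot)\in L^p(0,1)$ exists at $t$ (from the right if $t=0$), and $$\lim_{t\to\infty}\big\|(z(t,\cdot),z_t(t,\cdot))\big\|_{X_p}=0.$$ -/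

import Mathlib

open MeasureTheory Set Filter Topology
open scoped ENNReal NNReal ContDiff

noncomputable section

namespace DampedWave

/-- Lebesgue measure on the interval `(0,1)`. -/
def μ01 : Measure ℝ := volume.restrict (Ioo 0 1)

/-- Lebesgue measure on the time half-line `(0,∞)`. -/
def μTime : Measure ℝ := volume.restrict (Ioi 0)

/-- The `L^p(0,1)` norm, with values in `[0,∞]`. -/
def lpNorm01 (p : ℝ) (f : ℝ → ℝ) : ℝ≥0∞ := eLpNorm f (ENNReal.ofReal p) μ01

/-- `f ∈ L^p(0,1)`. -/
def MemLp01 (p : ℝ) (f : ℝ → ℝ) : Prop := MemLp f (ENNReal.ofReal p) μ01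

/-- `φ ∈ C_c^∞(U)`. -/
structure IsTestFunction (U : Set ℝ) (φ : ℝ → ℝ) : Prop where
  smooth : ContDiff ℝ ∞ φ
  compact_support : HasCompactSupport φ
  support_subset : tsupport φ ⊆ U

/-- `g` is the weak derivative of `u` on `(0,1)`. -/
def IsWeakDeriv (u g : ℝ → ℝ) : Prop :=
  ∀ φ : ℝ → ℝ, IsTestFunction (Ioo 0 1) φ →
    ∫ x, u x * deriv φ x ∂μ01 = - ∫ x, g x * φ x ∂μ01

/-- `u ∈ W^{1,p}_0(0,1)` with weak derivative `g`: both functions are in `L^p(0,1)`, `g = u'`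
weakly, and `u` is a limit of functions of `C_c^∞(0,1)` in the norm of `W^{1,p}(0,1)`. -/
structure HasDerivW0 (p : ℝ) (u g : ℝ → ℝ) : Prop where
  memLp : MemLp01 p u
  memLp_deriv : MemLp01 p g
  isWeakDeriv : IsWeakDeriv u g
  approx : ∃ φ : ℕ → ℝ → ℝ, (∀ n, IsTestFunction (Ioo 0 1) (φ n)) ∧
    Tendsto (fun n => lpNorm01 p (fun x => φ n x - u x)) atTop (𝓝 0) ∧
    Tendsto (fun n => lpNorm01 p (fun x => deriv (φ n) x - g x)) atTop (𝓝 0)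

/-- `u ∈ W^{1,p}_0(0,1)`. -/
def MemW0 (p : ℝ) (u : ℝ → ℝ) : Prop := ∃ g, HasDerivW0 p u g

/-- The norm of `X_p = W^{1,p}_0(0,1) × L^p(0,1)` at `(u,v)`, as a function of `u'` and `v`. -/
def XpNorm (p : ℝ) (u' v : ℝ → ℝ) : ℝ :=
  (1 / p * ∫ x, (|u' x + v x| ^ p + |u' x - v x| ^ p) ∂μ01) ^ (1 / p)

/-- The damping hypothesis: `a : [0,1] → ℝ` is continuous, non-negative, and bounded below by a
positive constant on a nondegenerate interval `[c,d] ⊆ [0,1]` with `c = 0` or `d = 1`.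
Only the values of `a` on `[0,1]` matter. -/
structure DampingHypothesis (a : ℝ → ℝ) : Prop where
  continuousOn : ContinuousOn a (Icc 0 1)
  nonneg : ∀ x ∈ Icc (0 : ℝ) 1, 0 ≤ a x
  localized : ∃ a₀ c d : ℝ, 0 < a₀ ∧ c < d ∧ Icc c d ⊆ Icc 0 1 ∧ (c = 0 ∨ d = 1) ∧
    ∀ x ∈ Icc c d, a₀ ≤ a x

/-- The `2`-periodic extension to `ℝ` of the restriction of `f` to `[-1,1)`. -/
def periodize (f : ℝ → ℝ) (x : ℝ) : ℝ := f (toIcoMod (two_pos : (0 : ℝ) < 2) (-1) x)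

/-- The `2`-periodic extension to `ℝ` of the odd extension of `u : [0,1] → ℝ` to `[-1,1]`. -/
def oddExt (u : ℝ → ℝ) : ℝ → ℝ := periodize fun x => if x < 0 then - u (-x) else u x

/-- The `2`-periodic extension to `ℝ` of the even extension of `u : [0,1] → ℝ` to `[-1,1]`. -/
def evenExt (u : ℝ → ℝ) : ℝ → ℝ := periodize fun x => u |x|

/-- `f ∈ L^∞(ℝ₊, L^p(0,1))`, for a function `f t x` of time and space: joint measurability and an
essential bound on `t ↦ ‖f t‖_{L^p}`. -/
def MemLinftyLp (p : ℝ) (f : ℝ → ℝ → ℝ) : Prop :=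
  AEStronglyMeasurable (Function.uncurry f) (μTime.prod μ01) ∧
    ∃ C : ℝ≥0, ∀ᵐ t ∂μTime, lpNorm01 p (f t) ≤ C

/-- `z ∈ L^∞(ℝ₊, W^{1,p}_0(0,1))`. -/
def MemLinftyW0 (p : ℝ) (z : ℝ → ℝ → ℝ) : Prop :=
  ∃ zx : ℝ → ℝ → ℝ, MemLinftyLp p z ∧ MemLinftyLp p zx ∧ ∀ᵐ t ∂μTime, HasDerivW0 p (z t) (zx t)

/-- `w` is the weak time derivative of `z` on `(0,∞)`, as functions of time with values in
`L^p(0,1)`: `∫ ψ' z dt = - ∫ ψ w dt` in `L^p(0,1)` for all `ψ ∈ C_c^∞(0,∞)`. -/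
def IsWeakTimeDeriv (z w : ℝ → ℝ → ℝ) : Prop :=
  ∀ ψ : ℝ → ℝ, IsTestFunction (Ioi 0) ψ →
    ∀ᵐ x ∂μ01, ∫ t, deriv ψ t * z t x ∂μTime = - ∫ t, ψ t * w t x ∂μTime

/-- `z ∈ W^{1,∞}(ℝ₊, L^p(0,1))` with weak time derivative `w`. -/
def HasTimeDerivW1infty (p : ℝ) (z w : ℝ → ℝ → ℝ) : Prop :=
  MemLinftyLp p z ∧ MemLinftyLp p w ∧ IsWeakTimeDeriv z w

/-- d'Alembert's formula on `(0,1)` with Dirichlet conditions, for the initial data `z₀, z₁`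
extended oddly and periodically, and a source `g` already extended to all of space. -/
def dAlembert (z₀ z₁ : ℝ → ℝ) (g : ℝ → ℝ → ℝ) (t x : ℝ) : ℝ :=
  1 / 2 * (oddExt z₀ (x + t) + oddExt z₀ (x - t))
    + 1 / 2 * (∫ s in (x - t)..(x + t), oddExt z₁ s)
    + 1 / 2 * ∫ s in (0 : ℝ)..t, ∫ τ in (x - (t - s))..(x + (t - s)), g s τ

/-- `z` (a function `z t x` of time `t ≥ 0` and of `x ∈ (0,1)`) is a weak solution of
`z_tt - z_xx + a(x) z_t = 0`, `z(t,0) = z(t,1) = 0`, `z(0) = z₀`, `z_t(0) = z₁`: it belongs to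
`L^∞(ℝ₊, W^{1,p}_0(0,1)) ∩ W^{1,∞}(ℝ₊, L^p(0,1))` and is given by d'Alembert's formula with the
source `- a z_t`. For each `t` the function `z t` matters only up to almost everywhere equality. -/
def IsWeakSolution (p : ℝ) (a z₀ z₁ : ℝ → ℝ) (z : ℝ → ℝ → ℝ) : Prop :=
  MemLinftyW0 p z ∧
    ∃ w : ℝ → ℝ → ℝ, HasTimeDerivW1infty p z w ∧
      ∀ t : ℝ, 0 ≤ t → ∀ᵐ x ∂μ01,
        z t x = dAlembert z₀ z₁ (fun s τ => - (evenExt a τ * oddExt (w s) τ)) t x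

/-- The map `s ↦ z s` from `[0,∞)` to `L^p(0,1)` is differentiable at `t` (from the right if
`t = 0`), with derivative `v ∈ L^p(0,1)`. -/
def HasTimeDerivAt (p : ℝ) (z : ℝ → ℝ → ℝ) (v : ℝ → ℝ) (t : ℝ) : Prop :=
  MemLp01 p v ∧
    Tendsto (fun s => lpNorm01 p (fun x => (z s x - z t x) / (s - t) - v x))
      (𝓝[Ici 0 \ {t}] t) (𝓝 0)

end DampedWave

end

namespace DampedWave

/-! Extend `z` oddly and `2`-periodically. On the circle ℝ/2ℤ the single function ρ = z_x + z_t
carries the whole state: z_x and z_t are its even and odd parts. The wave equation becomes the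
damped transport equation ∂ₜρ - ∂ₓρ = -α(ρ - ρ∘neg)/2, with α the even extension of `a`, and the X_p
norm is a constant times the L^p norm of ρ on the circle (`XpNorm_evenTrace_oddTrace`). The
Dirichlet conditions make ρ mean-zero. It remains to show that mean-zero solutions ρ tend to zero in
L^p.

For continuous data, every functional ∫Φ(ρ) with Φ convex is nonincreasing
(`IsClassicalSol.convex_le`): symmetrizing under reflection gives its derivative a sign. Hence the
flow contracts every L^p, p ≥ 1. In L² there is more. Over one period of the undamped flow the
dissipation is ∫ α(y) ‖f(· + 2y) - f‖² dy. Near an endpoint of [0,1] the translation 2y is small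
modulo 2, finitely many small translations compose to any translation, and the mean over all
translations of ‖f(· + h) - f‖² is 2‖f‖² when f has mean zero. This is `exists_observability`.
Duhamel's formula transfers it to the damped flow (`IsClassicalSol.sq_window`), so the L² norm
decays geometrically (`exists_sq_decay`). Together with the maximum principle this yields decay in
every L^p for continuous data (`exists_eLpNorm_decay`), and density with contraction extends it to
L^p data (`IsMildSol.tendsto_eLpNorm`).

A given weak solution must still be shown to follow this flow. By Fubini, d'Alembert's formula says
z = ½∫_{-x}^{x} ρ, which is also a primitive in time of the odd part of ρ. Uniqueness of weak
derivatives (`ae_eq_of_isWeakTimeDeriv`) identifies that odd part with the z_t occurring in the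
source, so the equation for ρ closes (`IsWeakSolution.exists_isMildSol`). Grönwall in L¹ makes ρ a
limit of classical solutions, and lower semicontinuity of the L^p norm carries the contraction over
to it (`IsMildSol.eLpNorm_sub_le`). -/

instance factTwoPos : Fact ((0 : ℝ) < 2) := ⟨two_pos⟩

/-! ### Classical solutions of the damped transport equation -/

/-- The circle `ℝ / 2ℤ`. -/
abbrev Circ : Type := AddCircle (2 : ℝ)

/-- A continuous solution on `[0,T]` of the damped transport equation on the circle
`∂ₜρ - ∂ₓρ = - α (ρ - ρ ∘ neg) / 2`, written along the characteristics: `V t y = ρ t (y - t)`. -/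
structure IsClassicalSol (α : C(Circ, ℝ)) (T : ℝ) (f : C(Circ, ℝ)) (V : ℝ → Circ → ℝ) : Prop where
  cont : Continuous (Function.uncurry V)
  init : ∀ y, V 0 y = f y
  deriv : ∀ t ∈ Icc 0 T, ∀ y, HasDerivWithinAt (fun s => V s y)
    (-(α (y - t) * ((V t y - V t ((t : Circ) + t - y)) / 2))) (Icc 0 T) t

/-- Truncation of a real number to `[-M, M]`. -/
noncomputable def clip (M x : ℝ) : ℝ := max (-M) (min M x)

theorem clip_of_abs_le {M x : ℝ} (h : |x| ≤ M) : clip M x = x := by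
  rw [abs_le] at h; simp [clip, h.1, h.2]

theorem abs_clip_le {M : ℝ} (hM : 0 ≤ M) (x : ℝ) : |clip M x| ≤ M := by
  rw [abs_le]; unfold clip
  exact ⟨le_max_left _ _, max_le (by linarith) (min_le_left _ _)⟩

theorem abs_clip_sub_clip_le (M x y : ℝ) : |clip M x - clip M y| ≤ |x - y| := by
  unfold clip
  refine (abs_max_sub_max_le_max _ _ _ _).trans ?_
  simp only [sub_self, abs_zero]
  refine max_le (abs_nonneg _) ?_
  refine (abs_min_sub_min_le_max _ _ _ _).trans ?_
  simp

theorem continuous_clip (M : ℝ) : Continuous (clip M) := by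
  unfold clip; fun_prop

theorem continuous_coe_circ : Continuous ((↑) : ℝ → Circ) := AddCircle.continuous_mk' 2

/-- The vector field of the damped transport equation with truncated unknown. -/
noncomputable def clippedField (α : C(Circ, ℝ)) (M : ℝ) (t : ℝ) (u : C(Circ, ℝ)) : C(Circ, ℝ) where
  toFun y := -(α (y - t) * ((clip M (u y) - clip M (u ((t : Circ) + t - y))) / 2))
  continuous_toFun := by
    have := continuous_clip M
    fun_prop

theorem norm_clippedField_sub_le (α : C(Circ, ℝ)) (M t : ℝ) (u v : C(Circ, ℝ)) :
    ‖clippedField α M t u - clippedField α M t v‖ ≤ ‖α‖ * ‖u - v‖ := by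
  rw [ContinuousMap.norm_le _ (by positivity)]
  intro y
  have h1 : ∀ x, |clip M (u x) - clip M (v x)| ≤ ‖u - v‖ := fun x =>
    (abs_clip_sub_clip_le _ _ _).trans (by simpa using (u - v).norm_coe_le_norm x)
  have h2 := α.norm_coe_le_norm (y - t)
  have e : (clippedField α M t u - clippedField α M t v) y = α (y - t) *
      (-((clip M (u y) - clip M (v y)) -
        (clip M (u ((t : Circ) + t - y)) - clip M (v ((t : Circ) + t - y)))) / 2) := by
    simp only [clippedField, ContinuousMap.sub_apply, ContinuousMap.coe_mk]; ring
  rw [e, norm_mul]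
  gcongr
  rw [Real.norm_eq_abs]
  have a := abs_le.1 (h1 y)
  have b := abs_le.1 (h1 ((t : Circ) + t - y))
  rw [abs_le]; constructor <;> linarith [a.1, a.2, b.1, b.2]

theorem norm_clippedField_le (α : C(Circ, ℝ)) {M : ℝ} (hM : 0 ≤ M) (t : ℝ) (u : C(Circ, ℝ)) :
    ‖clippedField α M t u‖ ≤ ‖α‖ * M := by
  rw [ContinuousMap.norm_le _ (by positivity)]
  intro y
  have h2 := α.norm_coe_le_norm (y - t)
  simp only [clippedField, ContinuousMap.coe_mk, norm_neg, norm_mul]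
  gcongr
  rw [Real.norm_eq_abs]
  have a := abs_le.1 (abs_clip_le hM (u y))
  have b := abs_le.1 (abs_clip_le hM (u ((t : Circ) + t - y)))
  rw [abs_le]; constructor <;> linarith [a.1, a.2, b.1, b.2]

theorem continuous_clippedField (α : C(Circ, ℝ)) (M : ℝ) (u : C(Circ, ℝ)) :
    Continuous (fun t => clippedField α M t u) := by
  apply ContinuousMap.continuous_of_continuous_uncurry
  have := continuous_clip M
  have h2 := continuous_coe_circ
  change Continuous (fun q : ℝ × Circ => -(α (q.2 - (q.1 : Circ)) *
    ((clip M (u q.2) - clip M (u ((q.1 : Circ) + q.1 - q.2))) / 2)))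
  have h3 : Continuous (fun q : ℝ × Circ => (q.1 : Circ)) := h2.comp continuous_fst
  fun_prop

/-- A function whose derivative is nonpositive as long as it is at least `M` stays below `M`. -/
theorem le_of_deriv_nonpos_above {φ φ' : ℝ → ℝ} {T M : ℝ}
    (hd : ∀ t ∈ Icc 0 T, HasDerivWithinAt φ (φ' t) (Icc 0 T) t) (h0 : φ 0 ≤ M)
    (hφ : ∀ t ∈ Icc 0 T, M ≤ φ t → φ' t ≤ 0) : ∀ t ∈ Icc 0 T, φ t ≤ M := by
  intro t ht
  -- A barrier of positive slope makes the derivative comparison strict at a contact point; ε is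
  -- then sent to zero.
  have key : ∀ ε : ℝ, 0 < ε → φ t ≤ M + ε * (1 + t) := by
    intro ε hε
    refine image_le_of_deriv_right_lt_deriv_boundary (f := φ) (f' := φ') (a := 0) (b := T)
      (B := fun s => M + ε * (1 + s)) (B' := fun _ => ε)
      (fun s hs => (hd s hs).continuousWithinAt) ?_ ?_ ?_ ?_ ht
    · intro s hs
      exact (hd s (Ico_subset_Icc_self hs)).mono_of_mem_nhdsWithin
        (mem_of_superset (Icc_mem_nhdsGE hs.2) (Icc_subset_Icc_left hs.1))
    · simp; linarith
    · intro s
      have := (((hasDerivAt_id s).const_add 1).const_mul ε).const_add M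
      simpa using this
    · intro s hs he
      have hs1 := hs.1
      have : φ' s ≤ 0 := hφ s (Ico_subset_Icc_self hs) (by rw [he]; nlinarith)
      linarith
  have h1 : Tendsto (fun ε : ℝ => M + ε * (1 + t)) (𝓝[>] 0) (𝓝 (M + 0 * (1 + t))) :=
    (Continuous.tendsto (by fun_prop) _).mono_left nhdsWithin_le_nhds
  have h2 : φ t ≤ M + 0 * (1 + t) :=
    ge_of_tendsto h1 (eventually_nhdsWithin_of_forall fun ε hε => key ε hε)
  simpa using h2

/-- Truncation makes the vector field globally bounded, so Picard–Lindelöf reaches time `T` in one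
application. Where the unknown is at least `M` its truncation equals `M`, the largest value the
reflected term can take, so the derivative is nonpositive; symmetrically at `-M`. The bound `M` thus
persists and the truncation is never active. -/
theorem exists_classicalSol (α : C(Circ, ℝ)) (hα : ∀ x, 0 ≤ α x) {T : ℝ} (hT : 0 ≤ T)
    (f : C(Circ, ℝ)) {M : ℝ} (hf : ∀ y, |f y| ≤ M) :
    ∃ V, IsClassicalSol α T f V ∧ ∀ t ∈ Icc 0 T, ∀ y, |V t y| ≤ M := by
  have hM : 0 ≤ M := (abs_nonneg _).trans (hf 0)
  have hPL : IsPicardLindelof (clippedField α M) (⟨0, left_mem_Icc.2 hT⟩ : Icc 0 T) f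
      ((‖α‖₊ * M.toNNReal) * T.toNNReal) 0 (‖α‖₊ * M.toNNReal) ‖α‖₊ := by
    refine ⟨fun t _ => ?_, fun u _ => (continuous_clippedField α M u).continuousOn,
      fun t _ u _ => ?_, ?_⟩
    · refine (LipschitzWith.of_dist_le_mul fun u v => ?_).lipschitzOnWith
      rw [dist_eq_norm, dist_eq_norm]
      exact norm_clippedField_sub_le α M t u v
    · have := norm_clippedField_le α hM t u
      simpa [hM] using this
    · simp [hT]
  obtain ⟨U, hU0, hU⟩ := hPL.exists_eq_forall_mem_Icc_hasDerivWithinAt₀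
  simp only at hU0
  have hpt : ∀ t ∈ Icc 0 T, ∀ y, HasDerivWithinAt (fun s => U s y)
      (clippedField α M t (U t) y) (Icc 0 T) t := fun t ht y =>
    (ContinuousLinearMap.hasFDerivAt (ContinuousMap.evalCLM ℝ y : C(Circ, ℝ) →L[ℝ] ℝ)).comp_hasDerivWithinAt
      t (hU t ht)
  have hb : ∀ t ∈ Icc 0 T, ∀ y, |U t y| ≤ M := by
    intro t ht y
    rw [abs_le]
    constructor
    · have := le_of_deriv_nonpos_above (φ := fun s => -U s y) (M := M)
        (fun s hs => (hpt s hs y).neg) (by rw [hU0]; linarith [(abs_le.1 (hf y)).1]) ?_ t ht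
      · linarith
      · intro s _ h
        have h1 : clip M (U s y) = -M := by
          unfold clip; rw [max_eq_left]; exact (min_le_right _ _).trans (by linarith)
        have h2 := (abs_le.1 (abs_clip_le hM (U s ((s : Circ) + s - y)))).1
        have h3 := hα (y - s)
        simp only [clippedField, ContinuousMap.coe_mk, h1]
        nlinarith
    · refine le_of_deriv_nonpos_above (φ := fun s => U s y) (M := M)
        (fun s hs => hpt s hs y) (by rw [hU0]; linarith [(abs_le.1 (hf y)).2]) ?_ t ht
      intro s _ h
      have h1 : clip M (U s y) = M := by
        unfold clip; rw [min_eq_left h, max_eq_right]; linarith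
      have h2 := (abs_le.1 (abs_clip_le hM (U s ((s : Circ) + s - y)))).2
      have h3 := hα (y - s)
      simp only [clippedField, ContinuousMap.coe_mk, h1]
      nlinarith
  have hUc : ContinuousOn U (Icc 0 T) := fun t ht => (hU t ht).continuousWithinAt
  have hproj : ∀ t ∈ Icc 0 T, ((projIcc 0 T hT t : Icc 0 T) : ℝ) = t := fun t ht => by
    rw [projIcc_of_mem hT ht]
  -- Freezing the solution outside `[0, T]` gives joint continuity on all of ℝ × circle, which lets
  -- later continuity and measurability questions ignore the time interval.
  refine ⟨fun t y => U (projIcc 0 T hT t) y, ⟨?_, ?_, ?_⟩, ?_⟩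
  · have h1 : Continuous fun t => U (projIcc 0 T hT t) :=
      (continuousOn_iff_continuous_domRestrict.1 hUc).comp continuous_projIcc
    have : Continuous fun q : ℝ × Circ => (U (projIcc 0 T hT q.1)) q.2 := by
      have h2 : Continuous fun q : ℝ × Circ => U (projIcc 0 T hT q.1) := h1.comp continuous_fst
      exact h2.eval continuous_snd
    exact this
  · intro y
    rw [hproj 0 (left_mem_Icc.2 hT), hU0]
  · intro t ht y
    rw [hproj t ht]
    have h := hpt t ht y
    have e : clippedField α M t (U t) y
        = -(α (y - t) * ((U t y - U t ((t : Circ) + t - y)) / 2)) := by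
      simp only [clippedField, ContinuousMap.coe_mk]
      rw [clip_of_abs_le (hb t ht _), clip_of_abs_le (hb t ht _)]
    rw [e] at h
    refine h.congr_of_mem (fun s hs => ?_) ht
    rw [hproj s hs]
  · intro t ht y
    beta_reduce
    rw [hproj t ht]
    exact hb t ht y

/-! ### Energy identities for classical solutions -/

theorem integrable_circ {g : Circ → ℝ} (hg : Continuous g) : Integrable g :=
  hg.integrable_of_hasCompactSupport (HasCompactSupport.of_compactSpace g)

theorem continuous_integral_circ {X : Type*} [TopologicalSpace X] [FirstCountableTopology X]
    [LocallyCompactSpace X] {G : X → Circ → ℝ} (hG : Continuous (Function.uncurry G)) :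
    Continuous fun x => ∫ y, G x y := by
  have := continuous_parametric_integral_of_continuous (μ := (volume : Measure Circ)) hG
    (isCompact_univ (X := Circ))
  simpa using this

theorem intervalIntegral_circ_swap {G : ℝ → Circ → ℝ} (hG : Continuous (Function.uncurry G))
    (a b : ℝ) : ∫ y, ∫ s in a..b, G s y = ∫ s in a..b, ∫ y, G s y := by
  wlog hab : a ≤ b generalizing a b with H
  · have := H b a (le_of_not_ge hab)
    simp_rw [intervalIntegral.integral_symm b a, integral_neg, this]
  simp_rw [intervalIntegral.integral_of_le hab]
  rw [integral_integral_swap]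
  have h : IntegrableOn (Function.uncurry G) (Icc a b ×ˢ univ)
      ((volume : Measure ℝ).prod (volume : Measure Circ)) :=
    hG.continuousOn.integrableOn_compact (isCompact_Icc.prod isCompact_univ)
  have h2 : Integrable (Function.uncurry G)
      ((volume.restrict (Ioc a b)).prod (volume : Measure Circ)) := by
    have h3 := h.mono_set (Set.prod_mono_left (t := (univ : Set Circ)) Ioc_subset_Icc_self)
    rw [IntegrableOn, ← Measure.prod_restrict, Measure.restrict_univ] at h3
    exact h3
  exact h2.swap

/-- Cauchy–Schwarz against the constant 1, read off from nonnegativity of the variance of `g`. -/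
theorem sq_intervalIntegral_le {g : ℝ → ℝ} (hg : Continuous g) {a b : ℝ} (hab : a ≤ b) :
    (∫ s in a..b, g s) ^ 2 ≤ (b - a) * ∫ s in a..b, g s ^ 2 := by
  rcases hab.eq_or_lt with rfl | h
  · simp
  set I := ∫ s in a..b, g s with hI
  have hba : 0 < b - a := sub_pos.2 h
  have h0 : 0 ≤ ∫ s in a..b, (g s - I / (b - a)) ^ 2 :=
    intervalIntegral.integral_nonneg hab fun _ _ => sq_nonneg _
  have e : ∫ s in a..b, (g s - I / (b - a)) ^ 2
      = (∫ s in a..b, g s ^ 2) - I ^ 2 / (b - a) := by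
    have e1 : ∀ s, (g s - I / (b - a)) ^ 2
        = g s ^ 2 - (2 * (I / (b - a))) * g s + (I / (b - a)) ^ 2 := fun s => by ring
    simp_rw [e1]
    rw [intervalIntegral.integral_add, intervalIntegral.integral_sub,
      intervalIntegral.integral_const_mul, intervalIntegral.integral_const, ← hI]
    · simp only [smul_eq_mul]; field_simp; ring
    all_goals exact Continuous.intervalIntegrable (by fun_prop) _ _
  rw [e, sub_nonneg, div_le_iff₀ hba] at h0
  linarith

theorem continuous_uncurry_comp {V : ℝ → Circ → ℝ} (hV : Continuous (Function.uncurry V))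
    {X : Type*} [TopologicalSpace X] {a : X → ℝ} {b : X → Circ} (ha : Continuous a)
    (hb : Continuous b) : Continuous fun x => V (a x) (b x) :=
  hV.comp (ha.prodMk hb)

section

variable {α f : C(Circ, ℝ)} {T : ℝ} {V : ℝ → Circ → ℝ}

theorem IsClassicalSol.integral_eq (hV : IsClassicalSol α T f V) {Φ Φ' : ℝ → ℝ}
    (hΦ : ∀ x, HasDerivAt Φ (Φ' x) x) (hΦ' : Continuous Φ') {r t : ℝ} (hr : 0 ≤ r) (hrt : r ≤ t)
    (ht : t ≤ T) (y : Circ) :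
    Φ (V t y) - Φ (V r y) = ∫ s in r..t,
      -(Φ' (V s y) * (α (y - s) * ((V s y - V s ((s : Circ) + s - y)) / 2))) := by
  have hc := hV.cont
  have h2 := continuous_coe_circ
  rw [← intervalIntegral.integral_eq_sub_of_hasDerivAt_of_le hrt (f := fun s => Φ (V s y))]
  · have hΦc : Continuous Φ := continuous_iff_continuousAt.2 fun x => (hΦ x).continuousAt
    exact (hΦc.comp (continuous_uncurry_comp hc continuous_id continuous_const)).continuousOn
  · intro s hs
    have hs' : s ∈ Ioo 0 T := ⟨hr.trans_lt hs.1, hs.2.trans_le ht⟩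
    have h := (hV.deriv s (Ioo_subset_Icc_self hs') y).hasDerivAt (Icc_mem_nhds hs'.1 hs'.2)
    have := (hΦ (V s y)).comp s h
    exact this.congr_deriv (by ring)
  · apply Continuous.intervalIntegrable
    have e1 : Continuous fun s => V s y := continuous_uncurry_comp hc continuous_id continuous_const
    have e2 : Continuous fun s => V s ((s : Circ) + s - y) :=
      continuous_uncurry_comp hc continuous_id (by fun_prop)
    fun_prop

/-- The energy identity for the functional `∫ Φ(ρ)`. -/
theorem IsClassicalSol.energy_eq (hV : IsClassicalSol α T f V) (hα : ∀ x, α (-x) = α x)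
    {Φ Φ' : ℝ → ℝ} (hΦ : ∀ x, HasDerivAt Φ (Φ' x) x) (hΦ' : Continuous Φ') {r t : ℝ} (hr : 0 ≤ r)
    (hrt : r ≤ t) (ht : t ≤ T) :
    (∫ y, Φ (V t y)) - ∫ y, Φ (V r y) = -(1 / 4) * ∫ s in r..t, ∫ y, α (y - s) *
      ((Φ' (V s y) - Φ' (V s ((s : Circ) + s - y))) * (V s y - V s ((s : Circ) + s - y))) := by
  have hc := hV.cont
  have h2 := continuous_coe_circ
  have hΦc : Continuous Φ := continuous_iff_continuousAt.2 fun x => (hΦ x).continuousAt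
  have hVc : ∀ s, Continuous (V s) := fun s =>
    continuous_uncurry_comp hc continuous_const continuous_id
  have i0 : ∀ s, Integrable fun y => Φ (V s y) := fun s => integrable_circ (hΦc.comp (hVc s))
  rw [← integral_sub (i0 t) (i0 r)]
  simp_rw [hV.integral_eq hΦ hΦ' hr hrt ht]
  rw [intervalIntegral_circ_swap (G := fun s y =>
    -(Φ' (V s y) * (α (y - s) * ((V s y - V s ((s : Circ) + s - y)) / 2))))]
  · rw [← intervalIntegral.integral_const_mul]
    refine intervalIntegral.integral_congr fun s _ => ?_
    have hVr : Continuous fun y => V s ((s : Circ) + s - y) := (hVc s).comp (by fun_prop)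
    have i1 : Integrable fun y : Circ =>
        -(Φ' (V s y) * (α (y - s) * ((V s y - V s ((s : Circ) + s - y)) / 2))) :=
      integrable_circ (by fun_prop)
    have i2 : Integrable fun y : Circ => -(Φ' (V s ((s : Circ) + s - y)) *
        (α (y - s) * ((V s ((s : Circ) + s - y) - V s y) / 2))) :=
      integrable_circ (by fun_prop)
    have e : ∫ y, -(Φ' (V s y) * (α (y - s) * ((V s y - V s ((s : Circ) + s - y)) / 2)))
        = ∫ y, -(Φ' (V s ((s : Circ) + s - y)) *
          (α (y - s) * ((V s ((s : Circ) + s - y) - V s y) / 2))) := by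
      -- The reflection y ↦ 2s - y preserves the measure, exchanges the two values of `V s`, and
      -- fixes the damping because `α` is even. Averaging the integral with its reflection produces
      -- the product of differences.
      rw [← integral_sub_left_eq_self _ volume ((s : Circ) + s)]
      refine integral_congr_ae (Eventually.of_forall fun y => ?_)
      simp only [sub_sub_cancel]
      rw [← hα, show -((s : Circ) + s - y - s) = y - s by abel]
    have e2 := integral_add i1 i2
    rw [← e] at e2
    have e3 : ∫ y, -(Φ' (V s y) * (α (y - s) * ((V s y - V s ((s : Circ) + s - y)) / 2)))
        = (1 / 2) * ∫ y, (-(Φ' (V s y) * (α (y - s) * ((V s y - V s ((s : Circ) + s - y)) / 2)))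
          + -(Φ' (V s ((s : Circ) + s - y)) *
          (α (y - s) * ((V s ((s : Circ) + s - y) - V s y) / 2)))) := by
      linarith
    rw [e3, ← integral_const_mul, ← integral_const_mul]
    refine integral_congr_ae (Eventually.of_forall fun y => ?_)
    simp only
    ring
  · have e1 : Continuous fun q : ℝ × Circ => V q.1 q.2 := hc
    have e0 : Continuous fun q : ℝ × Circ => (q.1 : Circ) := h2.comp continuous_fst
    have e2 : Continuous fun q : ℝ × Circ => V q.1 ((q.1 : Circ) + q.1 - q.2) :=
      continuous_uncurry_comp hc continuous_fst (by fun_prop)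
    change Continuous fun q : ℝ × Circ => -(Φ' (V q.1 q.2) * (α (q.2 - q.1) *
      ((V q.1 q.2 - V q.1 ((q.1 : Circ) + q.1 - q.2)) / 2)))
    fun_prop

/-- Convex functionals do not increase along classical solutions. -/
theorem IsClassicalSol.convex_le (hV : IsClassicalSol α T f V) (hα : ∀ x, α (-x) = α x)
    (hα0 : ∀ x, 0 ≤ α x) {Φ Φ' : ℝ → ℝ} (hΦ : ∀ x, HasDerivAt Φ (Φ' x) x) (hΦ' : Continuous Φ')
    (hmono : Monotone Φ') {r t : ℝ} (hr : 0 ≤ r) (hrt : r ≤ t) (ht : t ≤ T) :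
    ∫ y, Φ (V t y) ≤ ∫ y, Φ (V r y) := by
  have h := hV.energy_eq hα hΦ hΦ' hr hrt ht
  have h0 : 0 ≤ ∫ s in r..t, ∫ y, α (y - s) *
      ((Φ' (V s y) - Φ' (V s ((s : Circ) + s - y))) * (V s y - V s ((s : Circ) + s - y))) := by
    refine intervalIntegral.integral_nonneg hrt fun s _ => integral_nonneg fun y => ?_
    refine mul_nonneg (hα0 _) ?_
    rcases le_total (V s y) (V s ((s : Circ) + s - y)) with h | h
    · exact mul_nonneg_of_nonpos_of_nonpos (sub_nonpos.2 (hmono h)) (sub_nonpos.2 h)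
    · exact mul_nonneg (sub_nonneg.2 (hmono h)) (sub_nonneg.2 h)
  linarith

/-- A linear Φ has constant derivative, so its dissipation vanishes. -/
theorem IsClassicalSol.integral_const (hV : IsClassicalSol α T f V) (hα : ∀ x, α (-x) = α x)
    {t : ℝ} (ht0 : 0 ≤ t) (ht : t ≤ T) : ∫ y, V t y = ∫ y, f y := by
  have h := hV.energy_eq hα (Φ := id) (Φ' := fun _ => 1) (fun x => hasDerivAt_id x)
    continuous_const le_rfl ht0 ht
  simp only [id_eq, sub_self, zero_mul, mul_zero, integral_zero,
    intervalIntegral.integral_zero, sub_eq_zero, hV.init] at h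
  exact h

theorem IsClassicalSol.sq_energy (hV : IsClassicalSol α T f V) (hα : ∀ x, α (-x) = α x)
    {r t : ℝ} (hr : 0 ≤ r) (hrt : r ≤ t) (ht : t ≤ T) :
    (∫ y, V r y ^ 2) - ∫ y, V t y ^ 2 = (1 / 2) * ∫ s in r..t, ∫ y, α (y - s) *
      (V s y - V s ((s : Circ) + s - y)) ^ 2 := by
  have h := hV.energy_eq hα (Φ := fun x => x ^ 2) (Φ' := fun x => 2 * x)
    (fun x => by simpa using hasDerivAt_pow 2 x) (by fun_prop) hr hrt ht
  have e : ∀ s : ℝ, ∀ y : Circ, α (y - s) * ((2 * V s y - 2 * V s ((s : Circ) + s - y)) *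
      (V s y - V s ((s : Circ) + s - y)))
      = 2 * (α (y - s) * (V s y - V s ((s : Circ) + s - y)) ^ 2) := fun s y => by ring
  simp_rw [e, integral_const_mul, intervalIntegral.integral_const_mul] at h
  linarith

end

/-! ### Translation moduli and observability -/

/-- The squared `L²` modulus of continuity of `f` under translation by `h`. -/
noncomputable def transSq (f : C(Circ, ℝ)) (h : Circ) : ℝ := ∫ x, (f (x + h) - f x) ^ 2

theorem continuous_transSq (f : C(Circ, ℝ)) : Continuous (transSq f) := by
  unfold transSq
  exact continuous_integral_circ (G := fun h x => (f (x + h) - f x) ^ 2) (by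
    change Continuous fun q : Circ × Circ => (f (q.2 + q.1) - f q.2) ^ 2
    fun_prop)

theorem transSq_nonneg (f : C(Circ, ℝ)) (h : Circ) : 0 ≤ transSq f h :=
  integral_nonneg fun _ => sq_nonneg _

/-- Translation invariance of the measure. This lets damping near the endpoint 1 be treated like
damping near 0. -/
theorem transSq_neg (f : C(Circ, ℝ)) (h : Circ) : transSq f (-h) = transSq f h := by
  unfold transSq
  rw [← integral_add_right_eq_self _ h]
  refine integral_congr_ae (Eventually.of_forall fun y => ?_)
  simp only [add_neg_cancel_right]
  ring

/-- A translation by `n • h` telescopes into `n` translations by `h`, all of the same L² size;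
Cauchy–Schwarz on the sum costs the factor n². -/
theorem transSq_nsmul_le (f : C(Circ, ℝ)) (n : ℕ) (h : Circ) :
    transSq f (n • h) ≤ n ^ 2 * transSq f h := by
  have e : ∀ x, f (x + n • h) - f x
      = ∑ j ∈ Finset.range n, (f (x + (j + 1) • h) - f (x + j • h)) := fun x => by
    rw [Finset.sum_range_sub (fun j => f (x + j • h))]; simp
  have hint : ∀ j : ℕ, Integrable fun x : Circ => (f (x + (j + 1) • h) - f (x + j • h)) ^ 2 :=
    fun j => integrable_circ (by fun_prop)
  calc transSq f (n • h)
      ≤ ∫ x, (n : ℝ) * ∑ j ∈ Finset.range n, (f (x + (j + 1) • h) - f (x + j • h)) ^ 2 := by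
        refine integral_mono (integrable_circ (by fun_prop)) (integrable_circ (by fun_prop)) ?_
        intro x
        simp only [e]
        simpa using sq_sum_le_card_mul_sum_sq (s := Finset.range n)
          (f := fun j => f (x + (j + 1) • h) - f (x + j • h))
    _ = n * ∑ j ∈ Finset.range n, transSq f h := by
        rw [integral_const_mul, integral_finsetSum _ fun j _ => hint j]
        congr 1
        refine Finset.sum_congr rfl fun j _ => ?_
        unfold transSq
        rw [← integral_add_right_eq_self (fun x => (f (x + h) - f x) ^ 2) (j • h)]
        refine integral_congr_ae (Eventually.of_forall fun y => ?_)
        simp only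
        rw [show y + (j + 1) • h = y + j • h + h by rw [add_smul, one_smul]; abel]
    _ = n ^ 2 * transSq f h := by simp; ring

/-- Expanding the square, the cross term integrates to a multiple of the product of two means and
vanishes; each of the two square terms picks up the length 2 of the circle. -/
theorem integral_transSq (f : C(Circ, ℝ)) (hf : ∫ x, f x = 0) :
    ∫ h, transSq f h = 4 * ∫ x, f x ^ 2 := by
  unfold transSq
  rw [integral_integral_swap (f := fun h x : Circ => (f (x + h) - f x) ^ 2)]
  · have e : ∀ x : Circ, ∫ h : Circ, (f (x + h) - f x) ^ 2 = (∫ h, f h ^ 2) + 2 * f x ^ 2 := by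
      intro x
      have e1 : ∀ h, (f (x + h) - f x) ^ 2 = f (x + h) ^ 2 - (2 * f x) * f (x + h) + f x ^ 2 :=
        fun h => by ring
      simp_rw [e1]
      rw [integral_add, integral_sub, integral_const_mul,
        integral_add_left_eq_self (fun h => f h ^ 2), integral_add_left_eq_self (fun h => f h), hf]
      · simp [measureReal_def]
      all_goals exact integrable_circ (by fun_prop)
    simp_rw [e]
    rw [integral_add (integrable_circ (by fun_prop)) (integrable_circ (by fun_prop)),
      integral_const_mul]
    simp [measureReal_def]
    ring
  · refine Continuous.integrable_of_hasCompactSupport ?_ (HasCompactSupport.of_compactSpace _)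
    change Continuous fun q : Circ × Circ => (f (q.2 + q.1) - f q.2) ^ 2
    fun_prop

theorem integral_transSq_double (f : C(Circ, ℝ)) (hf : ∫ x, f x = 0) :
    ∫ h in (0 : ℝ)..1, transSq f ((2 * h : ℝ) : Circ) = 2 * ∫ x, f x ^ 2 := by
  have := intervalIntegral.integral_comp_mul_left (fun h : ℝ => transSq f (h : Circ))
    (two_ne_zero) (a := 0) (b := 1)
  rw [this]
  have h2 := AddCircle.intervalIntegral_preimage 2 0 (transSq f)
  rw [zero_add] at h2
  rw [mul_zero, mul_one, h2, integral_transSq f hf, smul_eq_mul]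
  ring

/-- Small translations control all of them: rescaling h to h/n costs n² by `transSq_nsmul_le` and
one more n from the change of variables. -/
theorem integral_transSq_le (f : C(Circ, ℝ)) (hf : ∫ x, f x = 0) {ε : ℝ} {n : ℕ} (hn : 0 < n)
    (hnε : 1 / (n : ℝ) ≤ ε) :
    2 * ∫ x, f x ^ 2 ≤ n ^ 3 * ∫ h in (0 : ℝ)..ε, transSq f ((2 * h : ℝ) : Circ) := by
  have hn' : (0 : ℝ) < n := by exact_mod_cast hn
  have hc : Continuous fun h : ℝ => transSq f ((2 * h : ℝ) : Circ) :=
    (continuous_transSq f).comp (continuous_coe_circ.comp (by fun_prop))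
  rw [← integral_transSq_double f hf]
  calc ∫ h in (0 : ℝ)..1, transSq f ((2 * h : ℝ) : Circ)
      ≤ ∫ h in (0 : ℝ)..1, (n : ℝ) ^ 2 * transSq f ((2 * (h / n) : ℝ) : Circ) := by
        refine intervalIntegral.integral_mono_on zero_le_one (hc.intervalIntegrable _ _)
          (Continuous.intervalIntegrable ?_ _ _) fun h _ => ?_
        · exact continuous_const.mul (hc.comp (by fun_prop))
        · have e : ((2 * h : ℝ) : Circ) = n • ((2 * (h / n) : ℝ) : Circ) := by
            rw [← AddCircle.coe_nsmul]
            congr 1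
            simp only [nsmul_eq_mul]
            field_simp
          rw [e]
          exact transSq_nsmul_le f n _
    _ = n ^ 3 * ∫ h in (0 : ℝ)..(1 / n), transSq f ((2 * h : ℝ) : Circ) := by
        rw [intervalIntegral.integral_const_mul,
          intervalIntegral.integral_comp_div (fun h : ℝ => transSq f ((2 * h : ℝ) : Circ)) hn'.ne',
          zero_div, smul_eq_mul]
        ring
    _ ≤ _ := by
        refine mul_le_mul_of_nonneg_left ?_ (by positivity)
        exact intervalIntegral.integral_mono_interval le_rfl (by positivity) hnε
          (Eventually.of_forall fun _ => transSq_nonneg _ _) (hc.intervalIntegrable _ _)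

/-- The observability inequality for the undamped transport equation. -/
theorem exists_observability (α : C(Circ, ℝ)) (hα0 : ∀ x, 0 ≤ α x) {a₀ c d : ℝ} (ha₀ : 0 < a₀)
    (hcd : c < d) (hsub : Icc c d ⊆ Icc 0 1) (hend : c = 0 ∨ d = 1)
    (hα : ∀ x ∈ Icc c d, a₀ ≤ α (x : Circ)) :
    ∃ κ : ℝ, 0 < κ ∧ ∀ f : C(Circ, ℝ), ∫ x, f x = 0 →
      κ * ∫ x, f x ^ 2 ≤ ∫ y, α y * transSq f (y + y) := by
  obtain ⟨n, hn⟩ := exists_nat_gt (1 / (d - c))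
  have hdc : 0 < d - c := sub_pos.2 hcd
  have hn' : (0 : ℝ) < n := lt_of_le_of_lt (by positivity) hn
  have hnε : 1 / (n : ℝ) ≤ d - c := by
    rw [div_lt_iff₀ hdc] at hn
    rw [div_le_iff₀ hn']; linarith
  have hc0 := (hsub (left_mem_Icc.2 hcd.le)).1
  have hd1 := (hsub (right_mem_Icc.2 hcd.le)).2
  refine ⟨a₀ * 2 / n ^ 3, by positivity, fun f hf => ?_⟩
  have h1 := integral_transSq_le f hf (by exact_mod_cast hn') hnε
  have hc : Continuous fun h : ℝ => transSq f ((2 * h : ℝ) : Circ) :=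
    (continuous_transSq f).comp (continuous_coe_circ.comp (by fun_prop))
  -- Here it matters that the damped interval touches an endpoint. If `c = 0` the translations 2h
  -- are small; if `d = 1` then 2(1 - h) ≡ -2h modulo 2, and `transSq` is even.
  have h2 : ∫ h in (0 : ℝ)..(d - c), transSq f ((2 * h : ℝ) : Circ)
      = ∫ h in c..d, transSq f ((2 * h : ℝ) : Circ) := by
    rcases hend with rfl | rfl
    · simp
    · have := intervalIntegral.integral_comp_sub_left
        (fun h : ℝ => transSq f ((2 * h : ℝ) : Circ)) (1 : ℝ) (a := 0) (b := 1 - c)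
      simp only [sub_zero, sub_sub_cancel] at this
      rw [← this]
      refine intervalIntegral.integral_congr fun h _ => ?_
      rw [← transSq_neg]
      congr 1
      rw [← AddCircle.coe_neg, show 2 * (1 - h) = -(2 * h) + 2 by ring, AddCircle.coe_add_period]
  have hcα : Continuous fun y : ℝ => α (y : Circ) * transSq f ((y : Circ) + y) := by
    have := continuous_coe_circ
    exact (α.continuous.comp this).mul ((continuous_transSq f).comp (by fun_prop))
  have h3 : a₀ * ∫ h in c..d, transSq f ((2 * h : ℝ) : Circ)
      ≤ ∫ y in c..d, α (y : Circ) * transSq f ((y : Circ) + y) := by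
    rw [← intervalIntegral.integral_const_mul]
    refine intervalIntegral.integral_mono_on hcd.le
      ((continuous_const.mul hc).intervalIntegrable _ _) (hcα.intervalIntegrable _ _)
      fun h hh => ?_
    rw [two_mul, AddCircle.coe_add]
    exact mul_le_mul_of_nonneg_right (hα h hh) (transSq_nonneg _ _)
  have h4 : ∫ y in c..d, α (y : Circ) * transSq f ((y : Circ) + y)
      ≤ ∫ y, α y * transSq f (y + y) := by
    rw [← AddCircle.intervalIntegral_preimage 2 0 (fun y => α y * transSq f (y + y))]
    exact intervalIntegral.integral_mono_interval hc0 hcd.le (by linarith)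
      (Eventually.of_forall fun _ => mul_nonneg (hα0 _) (transSq_nonneg _ _))
      (hcα.intervalIntegrable _ _)
  refine le_trans ?_ (h3.trans h4)
  rw [h2] at h1
  rw [div_mul_eq_mul_div, div_le_iff₀ (by positivity)]
  nlinarith

/-- Along the free evolution over one period, the damping observes `transSq`. -/
theorem integral_free_evolution (α u : C(Circ, ℝ)) (r : ℝ) :
    ∫ s in r..r + 2, ∫ y, α (y - s) * (u y - u ((s : Circ) + s - y)) ^ 2
      = ∫ y, α y * transSq u (y + y) := by
  have h2 := continuous_coe_circ
  have e1 : ∀ s : ℝ, ∫ y, α (y - s) * (u y - u ((s : Circ) + s - y)) ^ 2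
      = ∫ y, α y * (u (y + s) - u (s - y)) ^ 2 := fun s => by
    rw [← integral_add_right_eq_self _ (s : Circ)]
    refine integral_congr_ae (Eventually.of_forall fun y => ?_)
    simp only [add_sub_cancel_right]
    rw [show (s : Circ) + s - (y + s) = s - y by abel]
  simp_rw [e1]
  rw [← intervalIntegral_circ_swap (G := fun s y => α y * (u (y + s) - u (s - y)) ^ 2)]
  · refine integral_congr_ae (Eventually.of_forall fun y => ?_)
    simp only
    rw [intervalIntegral.integral_const_mul]
    rw [AddCircle.intervalIntegral_preimage 2 r (fun s => (u (y + s) - u (s - y)) ^ 2)]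
    congr 1
    unfold transSq
    rw [← integral_add_right_eq_self _ y]
    refine integral_congr_ae (Eventually.of_forall fun x => ?_)
    simp only [add_sub_cancel_right]
    rw [show y + (x + y) = x + (y + y) by abel]
  · have e0 : Continuous fun q : ℝ × Circ => (q.1 : Circ) := h2.comp continuous_fst
    change Continuous fun q : ℝ × Circ => α q.2 * (u (q.2 + q.1) - u (q.1 - q.2)) ^ 2
    fun_prop

/-! ### Exponential decay in L² -/

section

variable {α f : C(Circ, ℝ)} {T K : ℝ} {V : ℝ → Circ → ℝ}

/-- The variation along a characteristic is the time integral of the damping term. Cauchy–Schwarz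
over a time at most 2, together with α² ≤ Kα, bounds it by the dissipation on that characteristic.
-/
theorem IsClassicalSol.sq_sub_le (hV : IsClassicalSol α T f V) (hα0 : ∀ x, 0 ≤ α x)
    (hK : ∀ x, α x ≤ K) {r s : ℝ} (hr : 0 ≤ r) (hrT : r + 2 ≤ T) (hs : s ∈ Icc r (r + 2))
    (y : Circ) : (V s y - V r y) ^ 2 ≤
      K / 2 * ∫ σ in r..r + 2, α (y - σ) * (V σ y - V σ ((σ : Circ) + σ - y)) ^ 2 := by
  have h2 := continuous_coe_circ
  have h := hV.integral_eq (Φ := id) (Φ' := fun _ => 1) (fun x => hasDerivAt_id x)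
    continuous_const hr hs.1 (hs.2.trans hrT) y
  simp only [id_eq, one_mul] at h
  have c1 : Continuous fun s => V s y := continuous_uncurry_comp hV.cont continuous_id
    continuous_const
  have c2 : Continuous fun s => V s ((s : Circ) + s - y) :=
    continuous_uncurry_comp hV.cont continuous_id (by fun_prop)
  have hc := hV.cont
  have hK0 : 0 ≤ K := (hα0 0).trans (hK 0)
  have hnn : ∀ σ : ℝ, 0 ≤ α (y - σ) * (V σ y - V σ ((σ : Circ) + σ - y)) ^ 2 := fun σ =>
    mul_nonneg (hα0 _) (sq_nonneg _)
  rw [h]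
  refine (sq_intervalIntegral_le (by fun_prop) hs.1).trans ?_
  have hle : ∫ σ in r..s, (-(α (y - σ) * ((V σ y - V σ ((σ : Circ) + σ - y)) / 2))) ^ 2
      ≤ K / 4 * ∫ σ in r..r + 2, α (y - σ) * (V σ y - V σ ((σ : Circ) + σ - y)) ^ 2 := by
    have ci : Continuous fun σ : ℝ => K / 4 *
        (α (y - σ) * (V σ y - V σ ((σ : Circ) + σ - y)) ^ 2) := by fun_prop
    calc _ ≤ ∫ σ in r..s, K / 4 * (α (y - σ) * (V σ y - V σ ((σ : Circ) + σ - y)) ^ 2) := by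
          refine intervalIntegral.integral_mono_on hs.1
            (Continuous.intervalIntegrable (by fun_prop) _ _) (ci.intervalIntegrable _ _)
            fun σ _ => ?_
          have := mul_le_mul_of_nonneg_right (hK (y - σ)) (hnn σ)
          nlinarith
      _ ≤ ∫ σ in r..r + 2, K / 4 * (α (y - σ) * (V σ y - V σ ((σ : Circ) + σ - y)) ^ 2) := by
          exact intervalIntegral.integral_mono_interval le_rfl hs.1 hs.2
            (Eventually.of_forall fun σ => mul_nonneg (by positivity) (hnn σ))
            (ci.intervalIntegrable _ _)
      _ = _ := intervalIntegral.integral_const_mul _ _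
  have h0 : 0 ≤ ∫ σ in r..r + 2, α (y - σ) * (V σ y - V σ ((σ : Circ) + σ - y)) ^ 2 :=
    intervalIntegral.integral_nonneg (by linarith) fun σ _ => hnn σ
  calc _ ≤ (s - r) * (K / 4 * ∫ σ in r..r + 2, α (y - σ) *
        (V σ y - V σ ((σ : Circ) + σ - y)) ^ 2) :=
        mul_le_mul_of_nonneg_left hle (by linarith [hs.1])
    _ ≤ 2 * (K / 4 * ∫ σ in r..r + 2, α (y - σ) * (V σ y - V σ ((σ : Circ) + σ - y)) ^ 2) :=
        mul_le_mul_of_nonneg_right (by linarith [hs.2]) (by positivity)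
    _ = _ := by ring

/-- Observability of the undamped flow issued from time `r` survives the damping, because the
difference of the two flows is itself controlled by the dissipation in the window. -/
theorem IsClassicalSol.sq_window (hV : IsClassicalSol α T f V) (hα : ∀ x, α (-x) = α x)
    (hα0 : ∀ x, 0 ≤ α x) (hK : ∀ x, α x ≤ K) {κ : ℝ}
    (hκ : ∀ f : C(Circ, ℝ), ∫ x, f x = 0 → κ * ∫ x, f x ^ 2 ≤ ∫ y, α y * transSq f (y + y))
    (hf : ∫ x, f x = 0) {r : ℝ} (hr : 0 ≤ r) (hrT : r + 2 ≤ T) :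
    κ * ∫ y, V r y ^ 2
      ≤ (6 + 12 * K ^ 2) * ((∫ y, V r y ^ 2) - ∫ y, V (r + 2) y ^ 2) := by
  have h2 := continuous_coe_circ
  have hc := hV.cont
  have hK0 : 0 ≤ K := (hα0 0).trans (hK 0)
  have e0 : Continuous fun q : ℝ × Circ => (q.1 : Circ) := h2.comp continuous_fst
  have cV : Continuous fun q : ℝ × Circ => V q.1 q.2 := hc
  have cV' : Continuous fun q : ℝ × Circ => V q.1 ((q.1 : Circ) + q.1 - q.2) :=
    continuous_uncurry_comp hc continuous_fst (by fun_prop)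
  -- Along characteristics the undamped flow is stationary, so the single function `u` represents it
  -- throughout the window.
  let u : C(Circ, ℝ) := ⟨V r, continuous_uncurry_comp hc continuous_const continuous_id⟩
  have hu : ∀ y, u y = V r y := fun _ => rfl
  let g : ℝ → Circ → ℝ := fun s y => α (y - s) * (V s y - V s ((s : Circ) + s - y)) ^ 2
  have hg : Continuous (Function.uncurry g) := by
    change Continuous fun q : ℝ × Circ => α (q.2 - q.1) *
      (V q.1 q.2 - V q.1 ((q.1 : Circ) + q.1 - q.2)) ^ 2
    fun_prop
  let D : Circ → ℝ := fun y => ∫ σ in r..r + 2, g σ y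
  have hD : Continuous D := by
    apply intervalIntegral.continuous_parametric_intervalIntegral_of_continuous'
    exact hg.comp (continuous_snd.prodMk continuous_fst)
  have hDnn : ∀ y, 0 ≤ D y := fun y => intervalIntegral.integral_nonneg (by linarith)
    fun σ _ => mul_nonneg (hα0 _) (sq_nonneg _)
  have hen := hV.sq_energy hα hr (by linarith : r ≤ r + 2) hrT
  have hDint : ∫ y, D y = ∫ s in r..r + 2, ∫ y, g s y := intervalIntegral_circ_swap hg _ _
  have hobs := hκ u (by simp_rw [hu]; rw [hV.integral_const hα hr (by linarith), hf])
  rw [← integral_free_evolution α u r] at hobs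
  have hpt : ∀ s ∈ Icc r (r + 2), ∫ y, α (y - s) * (u y - u ((s : Circ) + s - y)) ^ 2
      ≤ 3 * (∫ y, g s y) + 3 * K ^ 2 * ∫ y, D y := by
    intro s hs
    have hrefl : ∫ y, D ((s : Circ) + s - y) = ∫ y, D y :=
      integral_sub_left_eq_self _ volume _
    have cs : Continuous (g s) := hg.comp (continuous_const.prodMk continuous_id)
    have cD' : Continuous fun y => D ((s : Circ) + s - y) := hD.comp (by fun_prop)
    have : 3 * (∫ y, g s y) + 3 * K ^ 2 * ∫ y, D y
        = ∫ y, (3 * g s y + 3 * K ^ 2 / 2 * (D y + D ((s : Circ) + s - y))) := by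
      rw [integral_add, integral_const_mul, integral_const_mul, integral_add, hrefl]
      · ring
      all_goals exact integrable_circ (by fun_prop)
    rw [this]
    refine integral_mono (integrable_circ (by fun_prop)) (integrable_circ (by fun_prop)) ?_
    intro y
    simp only [hu]
    have a1 := hV.sq_sub_le hα0 hK hr hrT hs y
    have a2 := hV.sq_sub_le hα0 hK hr hrT hs ((s : Circ) + s - y)
    change _ ≤ K / 2 * D y at a1
    change _ ≤ K / 2 * D ((s : Circ) + s - y) at a2
    have b0 := hα0 (y - s)
    have b1 := hK (y - s)
    -- `X` is the damped difference; `A` and `B` are the drifts of the damped flow from the free one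
    -- at a point and at its reflection. The latter two are bounded by `sq_sub_le`, the reflected
    -- one through `D` at the reflected point.
    set X := V s y - V s ((s : Circ) + s - y) with hX
    set A := V s y - V r y with hA
    set B := V s ((s : Circ) + s - y) - V r ((s : Circ) + s - y) with hB
    have e : V r y - V r ((s : Circ) + s - y) = X - A + B := by rw [hX, hA, hB]; ring
    have hsq : (X - A + B) ^ 2 ≤ 3 * X ^ 2 + 3 * A ^ 2 + 3 * B ^ 2 := by
      nlinarith [sq_nonneg (X + A), sq_nonneg (X - B), sq_nonneg (A + B)]
    rw [e]
    have hS : 0 ≤ D y + D ((s : Circ) + s - y) := add_nonneg (hDnn _) (hDnn _)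
    calc α (y - s) * (X - A + B) ^ 2
        ≤ α (y - s) * (3 * X ^ 2 + 3 * (K / 2) * (D y + D ((s : Circ) + s - y))) :=
          mul_le_mul_of_nonneg_left (by linarith) b0
      _ = 3 * g s y + α (y - s) * (3 * (K / 2) * (D y + D ((s : Circ) + s - y))) := by
          simp only [g, ← hX]; ring
      _ ≤ 3 * g s y + K * (3 * (K / 2) * (D y + D ((s : Circ) + s - y))) := by
          gcongr
      _ = _ := by ring
  have hint : ∫ s in r..r + 2, ∫ y, α (y - s) * (u y - u ((s : Circ) + s - y)) ^ 2
      ≤ ∫ s in r..r + 2, (3 * (∫ y, g s y) + 3 * K ^ 2 * ∫ y, D y) := by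
    have cG : Continuous fun s => ∫ y, g s y := continuous_integral_circ hg
    refine intervalIntegral.integral_mono_on (by linarith) (Continuous.intervalIntegrable ?_ _ _)
      (Continuous.intervalIntegrable (by fun_prop) _ _) hpt
    refine continuous_integral_circ
      (G := fun (s : ℝ) y => α (y - s) * (u y - u ((s : Circ) + s - y)) ^ 2) ?_
    change Continuous fun q : ℝ × Circ => α (q.2 - q.1) *
      (u q.2 - u ((q.1 : Circ) + q.1 - q.2)) ^ 2
    fun_prop
  have cG : Continuous fun s => ∫ y, g s y := continuous_integral_circ hg
  -- Integration over a window of length 2 gives (3 + 6K²)∫D, and the energy identity makes ∫D twice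
  -- the energy drop; this is the constant 6 + 12K².
  rw [intervalIntegral.integral_add (Continuous.intervalIntegrable (by fun_prop) _ _)
    (Continuous.intervalIntegrable (by fun_prop) _ _), intervalIntegral.integral_const_mul,
    intervalIntegral.integral_const, ← hDint, smul_eq_mul] at hint
  change _ = 1 / 2 * ∫ s in r..r + 2, ∫ y, g s y at hen
  rw [← hDint] at hen
  rw [hen]
  have hfin := hobs.trans hint
  change κ * ∫ y, V r y ^ 2 ≤ _ at hfin
  nlinarith

end

/-- Exponential decay of classical solutions in `L²`, with a rate independent of the time of
existence. -/
theorem exists_sq_decay (α : C(Circ, ℝ)) (hα : ∀ x, α (-x) = α x) (hα0 : ∀ x, 0 ≤ α x)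
    {a₀ c d : ℝ} (ha₀ : 0 < a₀) (hcd : c < d) (hsub : Icc c d ⊆ Icc 0 1) (hend : c = 0 ∨ d = 1)
    (hloc : ∀ x ∈ Icc c d, a₀ ≤ α (x : Circ)) :
    ∃ q : ℝ, 0 ≤ q ∧ q < 1 ∧ ∀ (f : C(Circ, ℝ)) (T : ℝ) (V : ℝ → Circ → ℝ),
      IsClassicalSol α T f V → ∫ x, f x = 0 → ∀ (n : ℕ) (t : ℝ), 2 * n ≤ t → t ≤ T →
        ∫ y, V t y ^ 2 ≤ q ^ n * ∫ y, f y ^ 2 := by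
  obtain ⟨κ, hκ0, hκ⟩ := exists_observability α hα0 ha₀ hcd hsub hend hloc
  have hK : ∀ x, α x ≤ ‖α‖ := fun x => (le_abs_self _).trans (α.norm_coe_le_norm x)
  set C := 6 + 12 * ‖α‖ ^ 2 with hC
  have hC0 : 0 < C := by positivity
  -- The maximum with 0 keeps the ratio nonnegative without having to compare `κ` with `C`.
  refine ⟨max 0 (1 - κ / C), le_max_left _ _, max_lt one_pos (by
    have : 0 < κ / C := by positivity
    linarith), fun f T V hV hf n => ?_⟩
  have step : ∀ n : ℕ, 2 * (n : ℝ) ≤ T →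
      ∫ y, V (2 * n) y ^ 2 ≤ max 0 (1 - κ / C) ^ n * ∫ y, f y ^ 2 := by
    intro n
    induction n with
    | zero => intro _; simp [hV.init]
    | succ n ih =>
      intro hn
      push_cast at hn ⊢
      have h1 := ih (by linarith)
      have h2 := hV.sq_window hα hα0 hK hκ hf (r := 2 * (n : ℝ)) (by positivity) (by linarith)
      rw [show 2 * ((n : ℝ) + 1) = 2 * n + 2 by ring]
      set E := ∫ y, V (2 * n) y ^ 2
      have hE : 0 ≤ E := integral_nonneg fun _ => sq_nonneg _
      have h3 : ∫ y, V (2 * n + 2) y ^ 2 ≤ (1 - κ / C) * E := by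
        have : κ / C * E ≤ E - ∫ y, V (2 * n + 2) y ^ 2 := by
          rw [div_mul_eq_mul_div, div_le_iff₀ hC0]; linarith
        linarith
      calc _ ≤ (1 - κ / C) * E := h3
        _ ≤ max 0 (1 - κ / C) * E := mul_le_mul_of_nonneg_right (le_max_right _ _) hE
        _ ≤ max 0 (1 - κ / C) * (max 0 (1 - κ / C) ^ n * ∫ y, f y ^ 2) :=
            mul_le_mul_of_nonneg_left h1 (le_max_left _ _)
        _ = _ := by rw [pow_succ]; ring
  intro t h1 h2
  refine le_trans ?_ (step n (h1.trans h2))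
  -- Between even times the energy does not increase.
  exact hV.convex_le hα hα0 (Φ := fun x => x ^ 2) (Φ' := fun x => 2 * x)
    (fun x => by simpa using hasDerivAt_pow 2 x) (by fun_prop)
    (fun a b h => by simpa using h) (by positivity) h1 h2

/-! ### Contraction and decay in L^p for classical solutions -/

/-- This is the derivative of √(x² + ε), the smooth convex substitute for |x| needed when p = 1. -/
theorem monotone_div_sqrt {ε : ℝ} (hε : 0 < ε) : Monotone fun x : ℝ => x / √(x ^ 2 + ε) := by
  have hpos : ∀ x : ℝ, 0 < √(x ^ 2 + ε) := fun x => Real.sqrt_pos.2 (by positivity)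
  refine monotone_of_hasDerivAt_nonneg
    (f' := fun x => (√(x ^ 2 + ε) - x * (2 * x / (2 * √(x ^ 2 + ε)))) / √(x ^ 2 + ε) ^ 2)
    (fun x => ?_) (fun x => ?_)
  · have h1 : HasDerivAt (fun x : ℝ => √(x ^ 2 + ε)) (2 * x / (2 * √(x ^ 2 + ε))) x := by
      have := ((hasDerivAt_pow 2 x).add_const ε).sqrt (by positivity)
      simpa using this
    exact ((hasDerivAt_id x).div h1 (hpos x).ne').congr_deriv (by simp)
  · have h := hpos x
    have h2 : √(x ^ 2 + ε) ^ 2 = x ^ 2 + ε := Real.sq_sqrt (by positivity)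
    refine div_nonneg ?_ (by positivity)
    rw [sub_nonneg, mul_div_assoc', div_le_iff₀ (by positivity)]
    nlinarith

theorem monotone_abs_rpow_mul {p : ℝ} (hp : 1 < p) :
    Monotone fun x : ℝ => p * |x| ^ (p - 2) * x := by
  have hnn : ∀ x : ℝ, 0 ≤ x → p * |x| ^ (p - 2) * x = p * x ^ (p - 1) := by
    intro x hx
    rcases hx.eq_or_lt with rfl | hx
    · rw [Real.zero_rpow (by linarith)]; simp
    · rw [abs_of_pos hx, mul_assoc, ← Real.rpow_add_one hx.ne']; congr 2; ring
  have hodd : ∀ x : ℝ, p * |-x| ^ (p - 2) * -x = -(p * |x| ^ (p - 2) * x) := fun x => by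
    rw [abs_neg]; ring
  have hmono : ∀ x y : ℝ, 0 ≤ x → x ≤ y → p * |x| ^ (p - 2) * x ≤ p * |y| ^ (p - 2) * y := by
    intro x y hx hxy
    rw [hnn x hx, hnn y (hx.trans hxy)]
    gcongr
  have hsign : ∀ x : ℝ, 0 ≤ x → 0 ≤ p * |x| ^ (p - 2) * x := fun x hx => by positivity
  intro x y hxy
  rcases le_total 0 x with hx | hx
  · exact hmono x y hx hxy
  rcases le_total 0 y with hy | hy
  · have := hsign (-x) (by linarith)
    rw [hodd] at this
    exact (by linarith : p * |x| ^ (p - 2) * x ≤ 0).trans (hsign y hy)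
  · have := hmono (-y) (-x) (by linarith) (by linarith)
    rw [hodd, hodd] at this
    simp only
    linarith

section

variable {α f : C(Circ, ℝ)} {T : ℝ} {V : ℝ → Circ → ℝ}

theorem IsClassicalSol.continuous_slice (hV : IsClassicalSol α T f V) (t : ℝ) :
    Continuous (V t) :=
  continuous_uncurry_comp hV.cont continuous_const continuous_id

/-- Monotonicity of the convex functional with Φ = |x|^p. For p = 1 it is not differentiable, so
√(x² + ε²) replaces it; this lies between |x| and |x| + ε. -/
theorem IsClassicalSol.integral_abs_rpow_le (hV : IsClassicalSol α T f V)
    (hα : ∀ x, α (-x) = α x) (hα0 : ∀ x, 0 ≤ α x) {p : ℝ} (hp : 1 ≤ p) {t : ℝ} (ht0 : 0 ≤ t)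
    (ht : t ≤ T) : ∫ y, |V t y| ^ p ≤ ∫ y, |f y| ^ p := by
  rcases hp.eq_or_lt with rfl | hp
  · simp only [Real.rpow_one]
    have key : ∀ ε : ℝ, 0 < ε → ∫ y, |V t y| ≤ (∫ y, |f y|) + 2 * ε := by
      intro ε hε
      have hε2 : 0 < ε ^ 2 := by positivity
      have h := hV.convex_le hα hα0 (Φ := fun x => √(x ^ 2 + ε ^ 2))
        (Φ' := fun x => x / √(x ^ 2 + ε ^ 2)) (fun x => by
          have := ((hasDerivAt_pow 2 x).add_const (ε ^ 2)).sqrt (by positivity)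
          refine this.congr_deriv ?_
          have : 0 < √(x ^ 2 + ε ^ 2) := Real.sqrt_pos.2 (by positivity)
          simp only [Nat.cast_ofNat, Nat.add_one_sub_one, pow_one]
          field_simp)
        (Continuous.div continuous_id (by fun_prop) fun x =>
          (Real.sqrt_pos.2 (by positivity)).ne')
        (monotone_div_sqrt hε2) le_rfl ht0 ht
      have c1 := hV.continuous_slice t
      have c0 := hV.continuous_slice 0
      have h1 : ∫ y, |V t y| ≤ ∫ y, √(V t y ^ 2 + ε ^ 2) := by
        refine integral_mono (integrable_circ (by fun_prop)) (integrable_circ (by fun_prop)) ?_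
        intro y
        exact Real.abs_le_sqrt (by simp; positivity)
      have h2 : ∫ y, √(V 0 y ^ 2 + ε ^ 2) ≤ ∫ y, (|f y| + ε) := by
        refine integral_mono (integrable_circ (by fun_prop)) (integrable_circ (by fun_prop)) ?_
        intro y
        simp only [hV.init]
        refine Real.sqrt_le_iff.2 ⟨by positivity, ?_⟩
        have := abs_nonneg (f y)
        rw [← sq_abs (f y)]
        nlinarith
      rw [integral_add (integrable_circ (by fun_prop)) (integrable_circ (by fun_prop))] at h2
      have h3 : ∫ _ : Circ, ε = 2 * ε := by simp [measureReal_def]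
      linarith
    refine le_of_forall_pos_le_add fun δ hδ => ?_
    have := key (δ / 2) (by positivity)
    linarith
  · have h := hV.convex_le hα hα0 (Φ := fun x => |x| ^ p)
      (Φ' := fun x => p * |x| ^ (p - 2) * x) (fun x => hasDerivAt_abs_rpow x hp) ?_
      (monotone_abs_rpow_mul hp) le_rfl ht0 ht
    · simpa only [hV.init] using h
    -- The explicit derivative contains |x|^(p-2), which is singular at 0 when p < 2; its continuity
    -- is taken from the regularity of |x|^p instead.
    · have h1 := (contDiff_norm_rpow (E := ℝ) hp).continuous_deriv le_rfl
      have h2 : _root_.deriv (fun x : ℝ => ‖x‖ ^ p) = fun x => p * |x| ^ (p - 2) * x := by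
        funext x
        exact (hasDerivAt_abs_rpow x hp).deriv
      rwa [h2] at h1

theorem eLpNorm_circ_eq {p : ℝ} (hp : 1 ≤ p) {g : Circ → ℝ} (hg : Continuous g) :
    eLpNorm g (ENNReal.ofReal p) volume = ENNReal.ofReal ((∫ y, |g y| ^ p) ^ p⁻¹) := by
  have hp0 : 0 < p := by linarith
  have hm : MemLp g (ENNReal.ofReal p) volume :=
    hg.memLp_of_hasCompactSupport (HasCompactSupport.of_compactSpace g)
  rw [hm.eLpNorm_eq_integral_rpow_norm (by simpa using hp0) ENNReal.ofReal_ne_top,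
    ENNReal.toReal_ofReal hp0.le]
  rfl

theorem IsClassicalSol.eLpNorm_le (hV : IsClassicalSol α T f V)
    (hα : ∀ x, α (-x) = α x) (hα0 : ∀ x, 0 ≤ α x) {p : ℝ} (hp : 1 ≤ p) {t : ℝ} (ht0 : 0 ≤ t)
    (ht : t ≤ T) :
    eLpNorm (V t) (ENNReal.ofReal p) volume ≤ eLpNorm f (ENNReal.ofReal p) volume := by
  rw [eLpNorm_circ_eq hp (hV.continuous_slice t), eLpNorm_circ_eq hp f.continuous]
  refine ENNReal.ofReal_le_ofReal (Real.rpow_le_rpow ?_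
    (hV.integral_abs_rpow_le hα hα0 hp ht0 ht) (by positivity))
  exact integral_nonneg fun y => by positivity

theorem IsClassicalSol.sub (hV : IsClassicalSol α T f V) {g : C(Circ, ℝ)} {W : ℝ → Circ → ℝ}
    (hW : IsClassicalSol α T g W) : IsClassicalSol α T (f - g) (fun t y => V t y - W t y) where
  cont := hV.cont.sub hW.cont
  init y := by simp [hV.init, hW.init]
  deriv t ht y := ((hV.deriv t ht y).sub (hW.deriv t ht y)).congr_deriv (by ring)

end

/-- Uniform in time decay in `L^p` of classical solutions with mean-zero data. -/
theorem exists_eLpNorm_decay (α : C(Circ, ℝ)) (hα : ∀ x, α (-x) = α x) (hα0 : ∀ x, 0 ≤ α x)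
    {a₀ c d : ℝ} (ha₀ : 0 < a₀) (hcd : c < d) (hsub : Icc c d ⊆ Icc 0 1) (hend : c = 0 ∨ d = 1)
    (hloc : ∀ x ∈ Icc c d, a₀ ≤ α (x : Circ)) {p : ℝ} (hp : 1 ≤ p) (f : C(Circ, ℝ))
    (hf : ∫ x, f x = 0) {M : ℝ} (hM : 0 < M) {ε : ℝ} (hε : 0 < ε) :
    ∃ t₀ : ℝ, ∀ (T : ℝ) (V : ℝ → Circ → ℝ), IsClassicalSol α T f V →
      (∀ t ∈ Icc 0 T, ∀ y, |V t y| ≤ M) → ∀ t, 0 ≤ t → t₀ ≤ t → t ≤ T →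
        eLpNorm (V t) (ENNReal.ofReal p) volume ≤ ENNReal.ofReal ε := by
  obtain ⟨q, hq0, hq1, hq⟩ := exists_sq_decay α hα hα0 ha₀ hcd hsub hend hloc
  have hp0 : 0 < p := by linarith
  -- On a circle of length 2 the level δ contributes 2δ^p = ε^p/2, leaving the other half for the L²
  -- term.
  set δ := (ε ^ p / 4) ^ p⁻¹ with hδ
  have hδ0 : 0 < δ := by positivity
  have hδp : δ ^ p = ε ^ p / 4 := by
    rw [hδ, ← Real.rpow_mul (by positivity), inv_mul_cancel₀ hp0.ne', Real.rpow_one]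
  have htend : Tendsto (fun n : ℕ => M ^ p / δ ^ 2 * (q ^ n * ∫ y, f y ^ 2)) atTop (𝓝 0) := by
    have := ((tendsto_pow_atTop_nhds_zero_of_lt_one hq0 hq1).mul_const
      (∫ y, f y ^ 2)).const_mul (M ^ p / δ ^ 2)
    simpa using this
  obtain ⟨n, hn⟩ := (htend.eventually (gt_mem_nhds (show 0 < ε ^ p / 2 by positivity))).exists
  refine ⟨2 * n, fun T V hV hb t ht0 htn htT => ?_⟩
  rw [eLpNorm_circ_eq hp (hV.continuous_slice t)]
  refine ENNReal.ofReal_le_ofReal ?_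
  rw [Real.rpow_inv_le_iff_of_pos (integral_nonneg fun y => by positivity) hε.le hp0]
  have hc := hV.continuous_slice t
  -- Splitting at the level δ treats p below and above 2 at once: below δ the first term suffices,
  -- above it the bound `M` and Chebyshev's factor V²/δ² do.
  have hpt : ∀ y, |V t y| ^ p ≤ δ ^ p + M ^ p / δ ^ 2 * V t y ^ 2 := by
    intro y
    rcases le_total |V t y| δ with h | h
    · have := Real.rpow_le_rpow (abs_nonneg _) h hp0.le
      have h2 : 0 ≤ M ^ p / δ ^ 2 * V t y ^ 2 := by positivity
      linarith
    · have h1 := Real.rpow_le_rpow (abs_nonneg _) (hb t ⟨ht0, htT⟩ y) hp0.le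
      have h3 : δ ^ 2 ≤ V t y ^ 2 := by
        rw [← sq_abs (V t y)]; gcongr
      have h4 : M ^ p ≤ M ^ p / δ ^ 2 * V t y ^ 2 := by
        rw [div_mul_eq_mul_div, le_div_iff₀ (by positivity)]
        gcongr
      have : 0 < δ ^ p := by positivity
      linarith
  have hcp : Continuous fun y => |V t y| ^ p := by
    refine Continuous.rpow_const (by fun_prop) fun _ => Or.inr hp0.le
  calc ∫ y, |V t y| ^ p ≤ ∫ y, (δ ^ p + M ^ p / δ ^ 2 * V t y ^ 2) :=
        integral_mono (integrable_circ hcp) (integrable_circ (by fun_prop)) hpt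
    _ = 2 * δ ^ p + M ^ p / δ ^ 2 * ∫ y, V t y ^ 2 := by
        rw [integral_add (integrable_circ (by fun_prop)) (integrable_circ (by fun_prop)),
          integral_const_mul]
        simp [measureReal_def]
    _ ≤ 2 * (ε ^ p / 4) + M ^ p / δ ^ 2 * (q ^ n * ∫ y, f y ^ 2) := by
        rw [hδp]
        gcongr
        exact hq f T V hV hf n t htn htT
    _ ≤ ε ^ p := by linarith

/-! ### W^{1,p}_0(0,1) as primitives of mean-zero functions -/

instance isProbabilityMeasure_μ01 : IsProbabilityMeasure μ01 :=
  ⟨by simp [μ01]⟩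

theorem one_le_ofReal {p : ℝ} (hp : 1 ≤ p) : 1 ≤ ENNReal.ofReal p := by
  simpa using ENNReal.ofReal_le_ofReal hp

theorem MemLp01.integrable {p : ℝ} (hp : 1 ≤ p) {g : ℝ → ℝ} (hg : MemLp01 p g) :
    Integrable g μ01 := MemLp.integrable (one_le_ofReal hp) hg

theorem lintegral_enorm_le_lpNorm01 {p : ℝ} (hp : 1 ≤ p) {g : ℝ → ℝ}
    (hg : AEStronglyMeasurable g μ01) : ∫⁻ x, ‖g x‖ₑ ∂μ01 ≤ lpNorm01 p g := by
  rw [← eLpNorm_one_eq_lintegral_enorm]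
  exact eLpNorm_le_eLpNorm_of_exponent_le (one_le_ofReal hp) hg

theorem intervalIntegrable_of_integrable_μ01 {g : ℝ → ℝ} (hg : Integrable g μ01) {x y : ℝ}
    (hx : x ∈ Icc (0 : ℝ) 1) (hy : y ∈ Icc (0 : ℝ) 1) : IntervalIntegrable g volume x y := by
  have h : IntegrableOn g (Icc 0 1) volume := by
    rw [integrableOn_Icc_iff_integrableOn_Ioo]; exact hg
  exact (h.mono_set (uIcc_subset_Icc hx hy)).intervalIntegrable

theorem enorm_intervalIntegral_le_μ01 (g : ℝ → ℝ) {x : ℝ} (hx : x ∈ Icc (0 : ℝ) 1) :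
    ‖∫ y in (0 : ℝ)..x, g y‖ₑ ≤ ∫⁻ y, ‖g y‖ₑ ∂μ01 := by
  rw [intervalIntegral.integral_of_le hx.1]
  refine (enorm_integral_le_lintegral_enorm _).trans ?_
  rw [← restrict_Ioo_eq_restrict_Ioc]
  exact lintegral_mono' (Measure.restrict_mono (Ioo_subset_Ioo_right hx.2) le_rfl) le_rfl

theorem integral_μ01 (g : ℝ → ℝ) : ∫ x, g x ∂μ01 = ∫ x in (0 : ℝ)..1, g x := by
  rw [intervalIntegral.integral_of_le zero_le_one, integral_Ioc_eq_integral_Ioo]; rfl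

theorem ae_μ01_mem : ∀ᵐ x ∂μ01, x ∈ Ioo (0 : ℝ) 1 := ae_restrict_mem measurableSet_Ioo

namespace IsTestFunction

variable {U : Set ℝ} {φ : ℝ → ℝ}

theorem apply_eq_zero (h : IsTestFunction U φ) {x : ℝ} (hx : x ∉ U) : φ x = 0 :=
  image_eq_zero_of_notMem_tsupport fun hx' => hx (h.support_subset hx')

theorem continuous_deriv (h : IsTestFunction U φ) : Continuous (deriv φ) :=
  h.smooth.continuous_deriv (by simp)

theorem hasDerivAt (h : IsTestFunction U φ) (x : ℝ) : HasDerivAt φ (deriv φ x) x :=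
  (h.smooth.differentiable (by simp) x).hasDerivAt

theorem eq_integral (h : IsTestFunction (Ioo 0 1) φ) (x : ℝ) :
    φ x = ∫ y in (0 : ℝ)..x, deriv φ y := by
  rw [intervalIntegral.integral_eq_sub_of_hasDerivAt (fun y _ => h.hasDerivAt y)
    (h.continuous_deriv.intervalIntegrable _ _), h.apply_eq_zero (x := 0) (by simp), sub_zero]

end IsTestFunction

/-- An element of `W^{1,p}_0(0,1)` is the primitive of its weak derivative, which has mean zero. -/
theorem HasDerivW0.eq_primitive {p : ℝ} (hp : 1 ≤ p) {u g : ℝ → ℝ} (h : HasDerivW0 p u g) :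
    (∀ᵐ x ∂μ01, u x = ∫ y in (0 : ℝ)..x, g y) ∧ ∫ y in (0 : ℝ)..1, g y = 0 := by
  obtain ⟨φ, hφ, h1, h2⟩ := h.approx
  have hgi := h.memLp_deriv.integrable hp
  have hφc : ∀ n, Continuous (φ n) := fun n => (hφ n).smooth.continuous
  have hm1 : ∀ n, AEStronglyMeasurable (fun x => φ n x - u x) μ01 := fun n =>
    (hφc n).aestronglyMeasurable.sub h.memLp.1
  have hm2 : ∀ n, AEStronglyMeasurable (fun x => deriv (φ n) x - g x) μ01 := fun n =>
    (hφ n).continuous_deriv.aestronglyMeasurable.sub h.memLp_deriv.1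
  have l1 : Tendsto (fun n => ∫⁻ x, ‖φ n x - u x‖ₑ ∂μ01) atTop (𝓝 0) :=
    tendsto_of_tendsto_of_tendsto_of_le_of_le tendsto_const_nhds h1 (fun _ => zero_le)
      fun n => lintegral_enorm_le_lpNorm01 hp (hm1 n)
  have l2 : Tendsto (fun n => ∫⁻ x, ‖deriv (φ n) x - g x‖ₑ ∂μ01) atTop (𝓝 0) :=
    tendsto_of_tendsto_of_tendsto_of_le_of_le tendsto_const_nhds h2 (fun _ => zero_le)
      fun n => lintegral_enorm_le_lpNorm01 hp (hm2 n)
  -- The estimate is uniform in `x` and holds up to x = 1, where the test functions vanish; this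
  -- gives the formula for `u` and the zero mean of `g` together.
  have key : ∀ n, ∀ x ∈ Icc (0 : ℝ) 1, ‖φ n x - ∫ y in (0 : ℝ)..x, g y‖ₑ
      ≤ ∫⁻ x, ‖deriv (φ n) x - g x‖ₑ ∂μ01 := by
    intro n x hx
    rw [(hφ n).eq_integral x, ← intervalIntegral.integral_sub
      ((hφ n).continuous_deriv.intervalIntegrable _ _)
      (intervalIntegrable_of_integrable_μ01 hgi (by simp) hx)]
    exact enorm_intervalIntegral_le_μ01 _ hx
  constructor
  · have hz : ∫⁻ x, ‖u x - ∫ y in (0 : ℝ)..x, g y‖ₑ ∂μ01 = 0 := by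
      refine le_antisymm (ge_of_tendsto' (by simpa using l1.add l2) fun n => ?_) zero_le
      calc ∫⁻ x, ‖u x - ∫ y in (0 : ℝ)..x, g y‖ₑ ∂μ01
          ≤ ∫⁻ x, (‖φ n x - u x‖ₑ + ∫⁻ x, ‖deriv (φ n) x - g x‖ₑ ∂μ01) ∂μ01 := by
            refine lintegral_mono_ae (ae_μ01_mem.mono fun x hx => ?_)
            have e : u x - ∫ y in (0 : ℝ)..x, g y
                = -(φ n x - u x) + (φ n x - ∫ y in (0 : ℝ)..x, g y) := by ring
            rw [e]
            refine (enorm_add_le _ _).trans ?_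
            rw [enorm_neg]
            gcongr
            exact key n x (Ioo_subset_Icc_self hx)
        _ = _ := by
            rw [lintegral_add_right _ measurable_const, lintegral_const, measure_univ, mul_one]
    rw [lintegral_eq_zero_iff' ?_] at hz
    · filter_upwards [hz] with x hx
      simpa [sub_eq_zero] using hx
    · refine (h.memLp.1.sub ?_).enorm
      have : ContinuousOn (fun x => ∫ y in (0 : ℝ)..x, g y) (uIcc 0 1) :=
        intervalIntegral.continuousOn_primitive_interval (by
          rw [uIcc_of_le zero_le_one, integrableOn_Icc_iff_integrableOn_Ioo]; exact hgi)
      rw [uIcc_of_le zero_le_one] at this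
      exact (this.mono Ioo_subset_Icc_self).aestronglyMeasurable measurableSet_Ioo
  · have h1' : ∀ n, ‖∫ y in (0 : ℝ)..1, g y‖ₑ ≤ ∫⁻ x, ‖deriv (φ n) x - g x‖ₑ ∂μ01 := by
      intro n
      have := key n 1 (by simp)
      rwa [(hφ n).apply_eq_zero (by simp), zero_sub, enorm_neg] at this
    have := ge_of_tendsto' l2 h1'
    simpa using this

theorem exists_bump {δ : ℝ} (hδ : 0 < δ) (hδ1 : δ < 1 / 4) :
    ∃ χ : ℝ → ℝ, IsTestFunction (Ioo 0 1) χ ∧ (∀ x, 0 ≤ χ x) ∧ (∀ x, χ x ≤ 1) ∧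
      ∀ x ∈ Icc (2 * δ) (1 - 2 * δ), χ x = 1 := by
  let b : ContDiffBump (1 / 2 : ℝ) := ⟨1 / 2 - 2 * δ, 1 / 2 - δ, by linarith, by linarith⟩
  refine ⟨b, ⟨b.contDiff, b.hasCompactSupport, ?_⟩, fun x => b.nonneg, fun x => b.le_one, ?_⟩
  · rw [b.tsupport_eq, Real.closedBall_eq_Icc]
    intro x hx
    simp only [b, mem_Icc] at hx
    constructor <;> linarith [hx.1, hx.2]
  · intro x hx
    apply b.one_of_mem_closedBall
    rw [Real.closedBall_eq_Icc]
    simp only [b, mem_Icc]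
    constructor <;> linarith [hx.1, hx.2]

/-- Test functions are dense in `L^p(0,1)`. -/
theorem exists_testFunction_sub_le {p : ℝ} (hp : 1 ≤ p) {g : ℝ → ℝ} (hg : MemLp01 p g) {ε : ℝ}
    (hε : 0 < ε) : ∃ ψ, IsTestFunction (Ioo 0 1) ψ ∧
      lpNorm01 p (fun x => ψ x - g x) ≤ ENNReal.ofReal ε := by
  have hg' : MemLp ((Ioo (0 : ℝ) 1).indicator g) (ENNReal.ofReal p) volume :=
    (memLp_indicator_iff_restrict measurableSet_Ioo).2 hg
  obtain ⟨k, hk1, hk2, hk3⟩ := hg'.exist_eLpNorm_sub_le ENNReal.ofReal_ne_top (one_le_ofReal hp)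
    (half_pos hε)
  have hkm : MemLp k (ENNReal.ofReal p) μ01 :=
    (hk2.continuous.memLp_of_hasCompactSupport hk1).restrict _
  -- Absolute continuity of the L^p norm makes the mass of `k` in a thin boundary layer negligible.
  -- The cutoff alters `k` only there, in a set of measure at most 4δ ≤ η.
  obtain ⟨η, hη, hη2⟩ := hkm.eLpNorm_indicator_le (one_le_ofReal hp) ENNReal.ofReal_ne_top
    (half_pos hε)
  set δ := min (η / 4) (1 / 8) with hδ
  have hδ0 : 0 < δ := by positivity
  have hδ1 : δ ≤ 1 / 8 := min_le_right _ _
  have hδ2 : δ ≤ η / 4 := min_le_left _ _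
  obtain ⟨χ, hχ, hχ0, hχ1, hχ2⟩ := exists_bump hδ0 (by linarith)
  refine ⟨fun x => k x * χ x, ⟨hk2.mul hχ.smooth, hk1.mul_right, ?_⟩, ?_⟩
  · exact (tsupport_mul_subset_right).trans hχ.support_subset
  set A := (Icc (2 * δ) (1 - 2 * δ))ᶜ with hA
  have hAm : μ01 A ≤ ENNReal.ofReal η := by
    have : A ∩ Ioo 0 1 ⊆ Ioo 0 (2 * δ) ∪ Ioo (1 - 2 * δ) 1 := by
      rintro x ⟨h1, h2⟩
      simp only [hA, mem_compl_iff, mem_Icc, not_and_or, not_le] at h1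
      rcases h1 with h1 | h1
      · exact Or.inl ⟨h2.1, h1⟩
      · exact Or.inr ⟨h1, h2.2⟩
    rw [μ01, Measure.restrict_apply measurableSet_Icc.compl]
    refine (measure_mono this).trans ((measure_union_le _ _).trans ?_)
    rw [Real.volume_Ioo, Real.volume_Ioo, ← ENNReal.ofReal_add (by linarith) (by linarith)]
    exact ENNReal.ofReal_le_ofReal (by linarith)
  have h1 : eLpNorm (fun x => k x * χ x - k x) (ENNReal.ofReal p) μ01 ≤ ENNReal.ofReal (ε / 2) := by
    refine le_trans (eLpNorm_mono fun x => ?_) (hη2 A measurableSet_Icc.compl hAm)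
    by_cases hx : x ∈ A
    · rw [indicator_of_mem hx, show k x * χ x - k x = k x * (χ x - 1) by ring, norm_mul]
      refine mul_le_of_le_one_right (norm_nonneg _) ?_
      rw [Real.norm_eq_abs, abs_le]
      constructor <;> linarith [hχ0 x, hχ1 x]
    · rw [hχ2 x (by simpa [hA] using hx)]
      simp
  have h2 : eLpNorm (fun x => k x - g x) (ENNReal.ofReal p) μ01 ≤ ENNReal.ofReal (ε / 2) := by
    have e : eLpNorm (fun x => k x - g x) (ENNReal.ofReal p) μ01
        = eLpNorm ((Ioo (0 : ℝ) 1).indicator g - k) (ENNReal.ofReal p) μ01 := by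
      rw [eLpNorm_sub_comm]
      refine eLpNorm_congr_ae (ae_μ01_mem.mono fun x hx => ?_)
      simp [indicator_of_mem hx]
    rw [e]
    exact (eLpNorm_mono_measure _ Measure.restrict_le_self).trans hk3
  have e : (fun x => k x * χ x - g x) = (fun x => k x * χ x - k x) + fun x => k x - g x := by
    funext x; simp
  have mk : AEStronglyMeasurable k μ01 := hkm.1
  rw [lpNorm01, e]
  refine (eLpNorm_add_le ((mk.mul hχ.smooth.continuous.aestronglyMeasurable).sub mk)
    (mk.sub hg.1) (one_le_ofReal hp)).trans ?_
  refine (add_le_add h1 h2).trans ?_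
  rw [← ENNReal.ofReal_add (by positivity) (by positivity), add_halves]

theorem exists_testFunction_integral_one :
    ∃ b : ℝ → ℝ, IsTestFunction (Ioo 0 1) b ∧ ∫ x in (0 : ℝ)..1, b x = 1 := by
  obtain ⟨χ, hχ, hχ0, -, hχ2⟩ := exists_bump (δ := 1 / 8) (by norm_num) (by norm_num)
  have hpos : 0 < ∫ x in (0 : ℝ)..1, χ x := by
    refine intervalIntegral.integral_pos zero_lt_one hχ.smooth.continuous.continuousOn
      (fun x _ => hχ0 x) ⟨1 / 2, by norm_num, ?_⟩
    rw [hχ2 _ (by norm_num)]; exact one_pos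
  refine ⟨fun x => (∫ x in (0 : ℝ)..1, χ x)⁻¹ * χ x,
    ⟨contDiff_const.mul hχ.smooth, hχ.compact_support.mul_left,
      (tsupport_mul_subset_right).trans hχ.support_subset⟩, ?_⟩
  rw [intervalIntegral.integral_const_mul, inv_mul_cancel₀ hpos.ne']

/-- A primitive from 0 vanishes to the left of the support of `ψ`; zero mean makes it vanish to the
right as well. -/
theorem IsTestFunction.primitive {ψ : ℝ → ℝ} (hψ : IsTestFunction (Ioo 0 1) ψ)
    (h0 : ∫ x in (0 : ℝ)..1, ψ x = 0) :
    IsTestFunction (Ioo 0 1) (fun x => ∫ y in (0 : ℝ)..x, ψ y) ∧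
      deriv (fun x => ∫ y in (0 : ℝ)..x, ψ y) = ψ := by
  have hc := hψ.smooth.continuous
  have hd : ∀ x, HasDerivAt (fun x => ∫ y in (0 : ℝ)..x, ψ y) (ψ x) x := fun x =>
    intervalIntegral.integral_hasDerivAt_right (hc.intervalIntegrable _ _)
      (hc.stronglyMeasurableAtFilter _ _) hc.continuousAt
  have hderiv : deriv (fun x => ∫ y in (0 : ℝ)..x, ψ y) = ψ := funext fun x => (hd x).deriv
  obtain ⟨a, b, ha, hb, hab⟩ : ∃ a b, 0 < a ∧ b < 1 ∧ tsupport ψ ⊆ Icc a b := by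
    rcases (tsupport ψ).eq_empty_or_nonempty with he | hne
    · exact ⟨1 / 2, 1 / 2, by norm_num, by norm_num, by rw [he]; exact empty_subset _⟩
    · have hK : IsCompact (tsupport ψ) := hψ.compact_support
      exact ⟨_, _, (hψ.support_subset (hK.sInf_mem hne)).1, (hψ.support_subset (hK.sSup_mem hne)).2,
        fun x hx => ⟨csInf_le hK.bddBelow hx, le_csSup hK.bddAbove hx⟩⟩
  have hz : ∀ x, x ∉ Icc a b → ψ x = 0 := fun x hx =>
    image_eq_zero_of_notMem_tsupport fun h => hx (hab h)
  have hsupp : tsupport (fun x => ∫ y in (0 : ℝ)..x, ψ y) ⊆ Icc a b := by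
    refine closure_minimal (fun x hx => ?_) isClosed_Icc
    by_contra hx'
    apply hx
    simp only [mem_Icc, not_and_or, not_le] at hx'
    change ∫ y in (0 : ℝ)..x, ψ y = 0
    rcases hx' with hx' | hx'
    · rw [intervalIntegral.integral_zero_ae]
      refine Eventually.of_forall fun y hy => hz y fun hy' => ?_
      rcases le_total 0 x with h | h
      · rw [uIoc_of_le h] at hy; linarith [hy.2, hy'.1]
      · rw [uIoc_of_ge h] at hy; linarith [hy.2, hy'.1]
    · rw [← intervalIntegral.integral_add_adjacent_intervals (hc.intervalIntegrable 0 1)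
        (hc.intervalIntegrable 1 x), h0, zero_add, intervalIntegral.integral_zero_ae]
      refine Eventually.of_forall fun y hy => hz y fun hy' => ?_
      rcases le_total 1 x with h | h
      · rw [uIoc_of_le h] at hy; linarith [hy.1, hy'.2]
      · rw [uIoc_of_ge h] at hy; linarith [hy.1, hy'.2]
  refine ⟨⟨?_, HasCompactSupport.of_support_subset_isCompact isCompact_Icc
    ((subset_tsupport _).trans hsupp), hsupp.trans fun x hx => ⟨ha.trans_le hx.1,
      hx.2.trans_lt hb⟩⟩, hderiv⟩
  rw [contDiff_infty_iff_deriv, hderiv]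
  exact ⟨fun x => (hd x).differentiableAt, hψ.smooth⟩

/-- Classical integration by parts passes to the limit: L¹ convergence is enough against a bounded
test function. -/
theorem isWeakDeriv_of_approx {u g : ℝ → ℝ} (hu : Integrable u μ01) (hg : Integrable g μ01)
    {φ : ℕ → ℝ → ℝ} (hφ : ∀ n, IsTestFunction (Ioo 0 1) (φ n))
    (h1 : Tendsto (fun n => ∫⁻ x, ‖φ n x - u x‖ₑ ∂μ01) atTop (𝓝 0))
    (h2 : Tendsto (fun n => ∫⁻ x, ‖deriv (φ n) x - g x‖ₑ ∂μ01) atTop (𝓝 0)) :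
    IsWeakDeriv u g := by
  intro χ hχ
  have hbd : ∀ {k : ℝ → ℝ}, Continuous k → HasCompactSupport k → ∃ C : ℝ≥0, ∀ x, ‖k x‖ₑ ≤ C := by
    intro k hk hk2
    obtain ⟨C, hC⟩ := hk2.exists_bound_of_continuous hk
    refine ⟨C.toNNReal, fun x => ?_⟩
    rw [← ofReal_norm]
    exact ENNReal.ofReal_le_ofReal (hC x)
  have hlim : ∀ {v : ℝ → ℝ} {w : ℕ → ℝ → ℝ} {k : ℝ → ℝ}, Integrable v μ01 →
      (∀ n, Continuous (w n)) → (∀ n, Integrable (w n) μ01) → Continuous k → HasCompactSupport k →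
      Tendsto (fun n => ∫⁻ x, ‖w n x - v x‖ₑ ∂μ01) atTop (𝓝 0) →
      Tendsto (fun n => ∫ x, w n x * k x ∂μ01) atTop (𝓝 (∫ x, v x * k x ∂μ01)) := by
    intro v w k hv hwc hw hk hk2 ht
    obtain ⟨C, hC⟩ := hbd hk hk2
    have hCr : ∀ x, ‖k x‖ ≤ C := fun x => by
      have := hC x
      rw [← ofReal_norm, ← ENNReal.ofReal_coe_nnreal] at this
      exact (ENNReal.ofReal_le_ofReal_iff C.2).1 this
    refine tendsto_integral_of_L1 (fun x => v x * k x)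
      (hv.mul_bdd hk.aestronglyMeasurable (Eventually.of_forall hCr)).aestronglyMeasurable
      (Eventually.of_forall fun n => (hw n).mul_bdd hk.aestronglyMeasurable
        (Eventually.of_forall hCr)) ?_
    have ht' : Tendsto (fun n => (∫⁻ x, ‖w n x - v x‖ₑ ∂μ01) * C) atTop (𝓝 0) := by
      simpa using ENNReal.Tendsto.mul_const ht (Or.inr (ENNReal.coe_ne_top (r := C)))
    refine tendsto_of_tendsto_of_tendsto_of_le_of_le tendsto_const_nhds ht'
      (fun _ => zero_le) fun n => ?_
    simp only
    rw [← lintegral_mul_const' _ _ ENNReal.coe_ne_top]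
    refine lintegral_mono fun x => ?_
    rw [← sub_mul, enorm_mul]
    gcongr
    exact hC x
  have hφi : ∀ n, Integrable (φ n) μ01 := fun n =>
    ((hφ n).smooth.continuous.integrable_of_hasCompactSupport (hφ n).compact_support).restrict
  have hφi' : ∀ n, Integrable (deriv (φ n)) μ01 := fun n =>
    ((hφ n).continuous_deriv.integrable_of_hasCompactSupport (hφ n).compact_support.deriv).restrict
  have t1 := hlim hu (fun n => (hφ n).smooth.continuous) hφi hχ.continuous_deriv
    hχ.compact_support.deriv h1
  have t2 := (hlim hg (fun n => (hφ n).continuous_deriv) hφi' hχ.smooth.continuous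
    hχ.compact_support h2).neg
  refine tendsto_nhds_unique t1 (t2.congr fun n => ?_)
  rw [integral_μ01, integral_μ01, intervalIntegral.integral_mul_deriv_eq_deriv_mul
    (fun x _ => (hφ n).hasDerivAt x) (fun x _ => hχ.hasDerivAt x)
    ((hφ n).continuous_deriv.intervalIntegrable _ _) (hχ.continuous_deriv.intervalIntegrable _ _),
    (hφ n).apply_eq_zero (x := 1) (by simp), (hφ n).apply_eq_zero (x := 0) (by simp)]
  simp

/-- A primitive of a mean-zero function of `L^p(0,1)` belongs to `W^{1,p}_0(0,1)`. -/
theorem HasDerivW0.of_primitive {p : ℝ} (hp : 1 ≤ p) {u g : ℝ → ℝ} (hg : MemLp01 p g)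
    (h0 : ∫ y in (0 : ℝ)..1, g y = 0) (hu : ∀ᵐ x ∂μ01, u x = ∫ y in (0 : ℝ)..x, g y) :
    HasDerivW0 p u g := by
  have hgi := hg.integrable hp
  obtain ⟨b, hb, hb1⟩ := exists_testFunction_integral_one
  have hum : AEStronglyMeasurable u μ01 := by
    have : ContinuousOn (fun x => ∫ y in (0 : ℝ)..x, g y) (uIcc 0 1) :=
      intervalIntegral.continuousOn_primitive_interval (by
        rw [uIcc_of_le zero_le_one, integrableOn_Icc_iff_integrableOn_Ioo]; exact hgi)
    rw [uIcc_of_le zero_le_one] at this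
    exact ((this.mono Ioo_subset_Icc_self).aestronglyMeasurable measurableSet_Ioo).congr
      (hu.mono fun x hx => hx.symm)
  choose ψ hψ hψε using fun n : ℕ => exists_testFunction_sub_le hp hg
    (show (0 : ℝ) < 1 / ((n : ℝ) + 1) by positivity)
  let m : ℕ → ℝ := fun n => ∫ y in (0 : ℝ)..1, ψ n y
  -- Subtracting a multiple of a fixed bump of integral one restores zero mean, so that primitives
  -- become test functions. The correction tends to zero because `g` itself has zero mean.
  let ψ' : ℕ → ℝ → ℝ := fun n x => ψ n x - m n * b x
  have hψ' : ∀ n, IsTestFunction (Ioo 0 1) (ψ' n) := fun n =>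
    ⟨(hψ n).smooth.sub (contDiff_const.mul hb.smooth),
      (hψ n).compact_support.sub hb.compact_support.mul_left,
      (tsupport_sub _ _).trans (union_subset (hψ n).support_subset
        ((tsupport_mul_subset_right).trans hb.support_subset))⟩
  have hψ0 : ∀ n, ∫ x in (0 : ℝ)..1, ψ' n x = 0 := fun n => by
    change ∫ x in (0 : ℝ)..1, (ψ n x - m n * b x) = 0
    rw [intervalIntegral.integral_sub ((hψ n).smooth.continuous.intervalIntegrable _ _)
      (Continuous.intervalIntegrable (u := fun x => m n * b x)
        (continuous_const.mul hb.smooth.continuous) _ _),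
      intervalIntegral.integral_const_mul, hb1, mul_one, sub_self]
  let φ : ℕ → ℝ → ℝ := fun n x => ∫ y in (0 : ℝ)..x, ψ' n y
  have hφ : ∀ n, IsTestFunction (Ioo 0 1) (φ n) := fun n => ((hψ' n).primitive (hψ0 n)).1
  have hφd : ∀ n, deriv (φ n) = ψ' n := fun n => ((hψ' n).primitive (hψ0 n)).2
  have hlim0 : Tendsto (fun n : ℕ => ENNReal.ofReal (1 / ((n : ℝ) + 1))) atTop (𝓝 0) := by
    have := ENNReal.tendsto_ofReal (tendsto_one_div_add_atTop_nhds_zero_nat (𝕜 := ℝ))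
    simpa using this
  have hψlim : Tendsto (fun n => lpNorm01 p (fun x => ψ n x - g x)) atTop (𝓝 0) :=
    tendsto_of_tendsto_of_tendsto_of_le_of_le tendsto_const_nhds hlim0 (fun _ => zero_le) hψε
  have hψm : ∀ n, AEStronglyMeasurable (fun x => ψ n x - g x) μ01 := fun n =>
    (hψ n).smooth.continuous.aestronglyMeasurable.sub hg.1
  have hmle : ∀ n, ‖m n‖ₑ ≤ lpNorm01 p (fun x => ψ n x - g x) := fun n => by
    refine le_trans ?_ (lintegral_enorm_le_lpNorm01 hp (hψm n))
    have := enorm_intervalIntegral_le_μ01 (fun x => ψ n x - g x) (x := 1) (by simp)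
    rwa [intervalIntegral.integral_sub ((hψ n).smooth.continuous.intervalIntegrable _ _)
      (intervalIntegrable_of_integrable_μ01 hgi (by simp) (by simp)), h0, sub_zero] at this
  have hbm : MemLp01 p b :=
    (hb.smooth.continuous.memLp_of_hasCompactSupport hb.compact_support).restrict _
  have hψ'le : ∀ n, lpNorm01 p (fun x => ψ' n x - g x)
      ≤ lpNorm01 p (fun x => ψ n x - g x) * (1 + lpNorm01 p b) := fun n => by
    have e : (fun x => ψ' n x - g x) = (fun x => ψ n x - g x) - fun x => m n * b x := by
      funext x; simp only [ψ', Pi.sub_apply]; ring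
    rw [mul_add, mul_one, lpNorm01, e]
    refine (eLpNorm_sub_le (hψm n) (hbm.1.const_mul _) (one_le_ofReal hp)).trans ?_
    gcongr
    · exact le_rfl
    · have := eLpNorm_const_smul (m n) b (ENNReal.ofReal p) μ01
      change eLpNorm (m n • b) _ _ ≤ _
      rw [this]
      gcongr
      · exact hmle n
      · exact le_rfl
  have hψ'lim : Tendsto (fun n => lpNorm01 p (fun x => ψ' n x - g x)) atTop (𝓝 0) := by
    have h : Tendsto (fun n => lpNorm01 p (fun x => ψ n x - g x) * (1 + lpNorm01 p b)) atTop
        (𝓝 0) := by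
      have h := ENNReal.Tendsto.mul_const (b := 1 + lpNorm01 p b) hψlim
        (Or.inr (ENNReal.add_ne_top.2 ⟨ENNReal.one_ne_top, hbm.2.ne⟩))
      rwa [zero_mul] at h
    exact tendsto_of_tendsto_of_tendsto_of_le_of_le tendsto_const_nhds h (fun _ => zero_le) hψ'le
  have hψ'm : ∀ n, AEStronglyMeasurable (fun x => ψ' n x - g x) μ01 := fun n =>
    (hψ' n).smooth.continuous.aestronglyMeasurable.sub hg.1
  -- Primitives are bounded pointwise by the L¹ norm of the integrand, and `μ01` is a probability
  -- measure, so no constant appears.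
  have hφle : ∀ n, lpNorm01 p (fun x => φ n x - u x) ≤ lpNorm01 p (fun x => ψ' n x - g x) := by
    intro n
    have := eLpNorm_le_of_ae_enorm_bound (p := ENNReal.ofReal p) (μ := μ01)
      (f := fun x => φ n x - u x) (C := lpNorm01 p (fun x => ψ' n x - g x)) ?_
    · simpa [lpNorm01] using this
    · filter_upwards [hu, ae_μ01_mem] with x hx hx1
      refine le_trans ?_ (lintegral_enorm_le_lpNorm01 hp (hψ'm n))
      rw [hx]
      have := enorm_intervalIntegral_le_μ01 (fun x => ψ' n x - g x) (Ioo_subset_Icc_self hx1)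
      rwa [intervalIntegral.integral_sub ((hψ' n).smooth.continuous.intervalIntegrable _ _)
        (intervalIntegrable_of_integrable_μ01 hgi (by simp) (Ioo_subset_Icc_self hx1))] at this
  have hφlim : Tendsto (fun n => lpNorm01 p (fun x => φ n x - u x)) atTop (𝓝 0) :=
    tendsto_of_tendsto_of_tendsto_of_le_of_le tendsto_const_nhds hψ'lim (fun _ => zero_le) hφle
  have hφm : ∀ n, AEStronglyMeasurable (fun x => φ n x - u x) μ01 := fun n =>
    (hφ n).smooth.continuous.aestronglyMeasurable.sub hum
  have huL : MemLp01 p u := by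
    obtain ⟨n, hn⟩ := (hφlim.eventually (gt_mem_nhds ENNReal.zero_lt_top)).exists
    have h1 : MemLp01 p (φ n) :=
      ((hφ n).smooth.continuous.memLp_of_hasCompactSupport (hφ n).compact_support).restrict _
    have h2 : MemLp (fun x => φ n x - u x) (ENNReal.ofReal p) μ01 := ⟨hφm n, hn⟩
    have := h1.sub h2
    refine this.ae_eq (Eventually.of_forall fun x => ?_)
    simp
  have hdlim : Tendsto (fun n => lpNorm01 p (fun x => deriv (φ n) x - g x)) atTop (𝓝 0) := by
    simp_rw [hφd]; exact hψ'lim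
  refine ⟨huL, hg, ?_, φ, hφ, hφlim, hdlim⟩
  refine isWeakDeriv_of_approx (huL.integrable hp) hgi hφ ?_ ?_
  · exact tendsto_of_tendsto_of_tendsto_of_le_of_le tendsto_const_nhds hφlim (fun _ => zero_le)
      fun n => lintegral_enorm_le_lpNorm01 hp (hφm n)
  · refine tendsto_of_tendsto_of_tendsto_of_le_of_le tendsto_const_nhds hdlim
      (fun _ => zero_le) fun n => lintegral_enorm_le_lpNorm01 hp ?_
    rw [hφd]; exact hψ'm n

/-! ### Odd and even extensions, and measure theory on the circle -/

/-- The odd extension of `u : [0,1] → ℝ` to the circle. -/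
noncomputable def oddC (u : ℝ → ℝ) : Circ → ℝ :=
  AddCircle.liftIco 2 (-1) fun x => if x < 0 then - u (-x) else u x

/-- The even extension of `u : [0,1] → ℝ` to the circle. -/
noncomputable def evenC (u : ℝ → ℝ) : Circ → ℝ := AddCircle.liftIco 2 (-1) fun x => u |x|

theorem oddExt_eq (u : ℝ → ℝ) (x : ℝ) : oddExt u x = oddC u (x : Circ) := rfl

theorem evenExt_eq (u : ℝ → ℝ) (x : ℝ) : evenExt u x = evenC u (x : Circ) := rfl

theorem oddC_coe {u : ℝ → ℝ} {x : ℝ} (hx : x ∈ Ioo (0 : ℝ) 1) : oddC u (x : Circ) = u x := by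
  rw [oddC, AddCircle.liftIco_coe_apply ⟨by linarith [hx.1], by linarith [hx.2]⟩,
    if_neg (not_lt.2 hx.1.le)]

theorem oddC_coe_neg {u : ℝ → ℝ} {x : ℝ} (hx : x ∈ Ioo (0 : ℝ) 1) :
    oddC u ((-x : ℝ) : Circ) = - u x := by
  rw [oddC, AddCircle.liftIco_coe_apply ⟨by linarith [hx.2], by linarith [hx.1]⟩,
    if_pos (by linarith [hx.1]), neg_neg]

theorem evenC_coe {u : ℝ → ℝ} {x : ℝ} (hx : x ∈ Ioo (0 : ℝ) 1) : evenC u (x : Circ) = u x := by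
  rw [evenC, AddCircle.liftIco_coe_apply ⟨by linarith [hx.1], by linarith [hx.2]⟩,
    abs_of_pos hx.1]

theorem evenC_coe_neg {u : ℝ → ℝ} {x : ℝ} (hx : x ∈ Ioo (0 : ℝ) 1) :
    evenC u ((-x : ℝ) : Circ) = u x := by
  rw [evenC, AddCircle.liftIco_coe_apply ⟨by linarith [hx.2], by linarith [hx.1]⟩, abs_neg,
    abs_of_pos hx.1]

theorem exists_Ico_coe_eq (y : Circ) : ∃ x ∈ Ico (-1 : ℝ) 1, (x : Circ) = y := by
  have h := AddCircle.coe_image_Ico_eq (2 : ℝ) (-1)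
  have : y ∈ ((↑) : ℝ → Circ) '' Ico (-1) (-1 + 2) := h ▸ mem_univ y
  obtain ⟨x, hx, rfl⟩ := this
  exact ⟨x, ⟨hx.1, by linarith [hx.2]⟩, rfl⟩

theorem evenC_neg (u : ℝ → ℝ) (y : Circ) : evenC u (-y) = evenC u y := by
  obtain ⟨x, hx, rfl⟩ := exists_Ico_coe_eq y
  have hx' : x ∈ Ico (-1 : ℝ) (-1 + 2) := ⟨hx.1, by linarith [hx.2]⟩
  rcases hx.1.eq_or_lt with rfl | h
  · have : -(((-1 : ℝ)) : Circ) = ((-1 : ℝ) : Circ) := by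
      rw [← AddCircle.coe_neg, ← AddCircle.coe_add_period (2 : ℝ) (-1)]; norm_num
    rw [this]
  · rw [← AddCircle.coe_neg, evenC, AddCircle.liftIco_coe_apply hx', AddCircle.liftIco_coe_apply
      ⟨by linarith [hx.2], by linarith⟩, abs_neg]

theorem continuous_evenC {a : ℝ → ℝ} (ha : ContinuousOn a (Icc 0 1)) : Continuous (evenC a) := by
  refine AddCircle.liftIco_continuous (by norm_num) ?_
  refine ha.comp continuous_abs.continuousOn fun x hx => ⟨abs_nonneg _, abs_le.2 ⟨hx.1, ?_⟩⟩
  linarith [hx.2]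

theorem evenC_nonneg {a : ℝ → ℝ} (ha : ∀ x ∈ Icc (0 : ℝ) 1, 0 ≤ a x) (y : Circ) :
    0 ≤ evenC a y := by
  obtain ⟨x, hx, rfl⟩ := exists_Ico_coe_eq y
  rw [evenC, AddCircle.liftIco_coe_apply ⟨hx.1, by linarith [hx.2]⟩]
  exact ha _ ⟨abs_nonneg _, abs_le.2 ⟨hx.1, hx.2.le⟩⟩

theorem evenC_coe_Icc {a : ℝ → ℝ} {x : ℝ} (hx : x ∈ Icc (0 : ℝ) 1) : evenC a (x : Circ) = a x := by
  rcases hx.2.eq_or_lt with rfl | h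
  · have : ((1 : ℝ) : Circ) = ((-1 : ℝ) : Circ) := by
      rw [← AddCircle.coe_add_period (2 : ℝ) (-1)]; norm_num
    rw [this, evenC, AddCircle.liftIco_coe_apply ⟨by linarith, by linarith⟩]
    norm_num
  · rw [evenC, AddCircle.liftIco_coe_apply ⟨by linarith [hx.1], by linarith⟩, abs_of_nonneg hx.1]

theorem restrict_Ioc_eq :
    volume.restrict (Ioc (-1 : ℝ) 1) = μ01 + μ01.map (fun x => -x) := by
  have h1 : Ioc (-1 : ℝ) 1 = Ioc (-1) 0 ∪ Ioc 0 1 := (Ioc_union_Ioc_eq_Ioc (by simp) (by simp)).symm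
  have h2 : volume.restrict (Ioc (-1 : ℝ) 0) = μ01.map (fun x => -x) := by
    have := (Measure.measurePreserving_neg (volume : Measure ℝ)).restrict_preimage
      (measurableSet_Ioo (a := (-1 : ℝ)) (b := 0))
    rw [← restrict_Ioo_eq_restrict_Ioc, ← this.map_eq, μ01]
    congr 2
    ext x
    simp only [mem_preimage, mem_Ioo]
    constructor <;> rintro ⟨h1, h2⟩ <;> constructor <;> linarith
  rw [h1, Measure.restrict_union (Ioc_disjoint_Ioc_of_le le_rfl) measurableSet_Ioc, h2, add_comm,
    ← restrict_Ioo_eq_restrict_Ioc]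
  rfl

theorem measurePreserving_coe :
    MeasurePreserving ((↑) : ℝ → Circ) (volume.restrict (Ioc (-1) 1)) := by
  have := AddCircle.measurePreserving_mk 2 (-1)
  norm_num at this
  exact this

theorem measurable_coe_circ : Measurable ((↑) : ℝ → Circ) := continuous_coe_circ.measurable

theorem measurable_liftIco {f : ℝ → ℝ} (hf : Measurable f) :
    Measurable (AddCircle.liftIco (2 : ℝ) (-1) f) :=
  hf.comp (measurable_subtype_coe.comp (AddCircle.measurableEquivIco 2 (-1)).measurable)

/-- `P` need not be measurable: the exceptional set is enclosed in a measurable null set, which is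
pulled back along the section of the circle into (-1, 1]. -/
theorem ae_circ_of_Ioc {P : Circ → Prop}
    (h : ∀ᵐ x : ℝ ∂(volume.restrict (Ioc (-1 : ℝ) 1)), P (x : Circ)) : ∀ᵐ y : Circ, P y := by
  obtain ⟨N, hN, hNm, hN0⟩ := exists_measurable_superset_of_null h
  set e : Circ → ℝ := fun y => (AddCircle.measurableEquivIoc 2 (-1) y : ℝ) with he
  have hem : Measurable e := measurable_subtype_coe.comp
    (AddCircle.measurableEquivIoc 2 (-1)).measurable
  have hec : ∀ y : Circ, ((e y : ℝ) : Circ) = y := fun y => AddCircle.coe_equivIoc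
  have hmem : ∀ y, e y ∈ Ioc (-1 : ℝ) 1 := fun y => by
    have := (AddCircle.measurableEquivIoc 2 (-1) y).2
    exact ⟨this.1, by linarith [this.2]⟩
  have hee : ∀ x ∈ Ioc (-1 : ℝ) 1, e (x : Circ) = x := fun x hx => by
    have := AddCircle.equivIoc_coe_of_mem (p := (2 : ℝ)) (a := -1) (y := x) ⟨hx.1, by linarith [hx.2]⟩
    exact this
  have hz : volume (e ⁻¹' N) = 0 := by
    rw [← measurePreserving_coe.measure_preimage (hem hNm).nullMeasurableSet,
      Measure.restrict_apply (measurable_coe_circ (hem hNm))]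
    rw [Measure.restrict_apply hNm] at hN0
    refine measure_mono_null (fun x hx => ?_) hN0
    refine ⟨?_, hx.2⟩
    have := hx.1
    simp only [mem_preimage, hee x hx.2] at this
    exact this
  refine measure_mono_null (fun y hy => ?_) hz
  refine hN ?_
  simpa [hec] using hy

/-- The circle is, up to a null set, two reflected copies of (0,1). Every statement about extensions
is checked on each copy, so the values of the extensions at the endpoints never matter. -/
theorem ae_circ_iff {P : Circ → Prop} : (∀ᵐ y : Circ, P y) ↔
    (∀ᵐ x : ℝ ∂μ01, P (x : Circ)) ∧ ∀ᵐ x : ℝ ∂μ01, P ((-x : ℝ) : Circ) := by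
  have e : (∀ᵐ x : ℝ ∂(volume.restrict (Ioc (-1 : ℝ) 1)), P (x : Circ)) ↔
      (∀ᵐ x : ℝ ∂μ01, P (x : Circ)) ∧ ∀ᵐ x : ℝ ∂μ01, P ((-x : ℝ) : Circ) := by
    rw [restrict_Ioc_eq, ae_add_measure_iff]
    refine and_congr Iff.rfl ?_
    exact (MeasurableEquiv.neg ℝ).measurableEmbedding.ae_map_iff
  rw [← e]
  exact ⟨fun h => measurePreserving_coe.quasiMeasurePreserving.ae h, ae_circ_of_Ioc⟩

theorem lintegral_circ (h : Circ → ℝ≥0∞) :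
    ∫⁻ y, h y = ∫⁻ x, h (x : Circ) ∂μ01 + ∫⁻ x, h ((-x : ℝ) : Circ) ∂μ01 := by
  have := AddCircle.lintegral_preimage 2 (-1) h
  rw [← this, show (-1 : ℝ) + 2 = 1 by norm_num, restrict_Ioc_eq, lintegral_add_measure]
  congr 1
  exact (MeasurableEquiv.neg ℝ).measurableEmbedding.lintegral_map _

theorem integral_circ {h : Circ → ℝ} (hh : Integrable h) :
    ∫ y, h y = ∫ x, h (x : Circ) ∂μ01 + ∫ x, h ((-x : ℝ) : Circ) ∂μ01 := by
  have h1 : Integrable (fun x : ℝ => h x) (volume.restrict (Ioc (-1 : ℝ) 1)) :=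
    measurePreserving_coe.integrable_comp_of_integrable hh
  have := AddCircle.integral_preimage 2 (-1) h
  rw [show (-1 : ℝ) + 2 = 1 by norm_num] at this
  rw [restrict_Ioc_eq] at h1 this
  rw [← this, integral_add_measure (integrable_add_measure.1 h1).1 (integrable_add_measure.1 h1).2]
  congr 1
  exact (MeasurableEquiv.neg ℝ).measurableEmbedding.integral_map _

theorem aestronglyMeasurable_circ {h : Circ → ℝ}
    (h1 : AEStronglyMeasurable (fun x : ℝ => h (x : Circ)) μ01)
    (h2 : AEStronglyMeasurable (fun x : ℝ => h ((-x : ℝ) : Circ)) μ01) :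
    AEStronglyMeasurable h volume := by
  obtain ⟨k1, hk1, e1⟩ := h1
  obtain ⟨k2, hk2, e2⟩ := h2
  refine ⟨AddCircle.liftIco 2 (-1) fun x => if x < 0 then k2 (-x) else k1 x,
    (measurable_liftIco (Measurable.ite measurableSet_Iio (hk2.measurable.comp measurable_neg)
      hk1.measurable)).stronglyMeasurable, ?_⟩
  refine ae_circ_iff.2 ⟨?_, ?_⟩
  · filter_upwards [e1, ae_μ01_mem] with x hx hx1
    rw [hx, AddCircle.liftIco_coe_apply ⟨by linarith [hx1.1], by linarith [hx1.2]⟩,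
      if_neg (not_lt.2 hx1.1.le)]
  · filter_upwards [e2, ae_μ01_mem] with x hx hx1
    rw [hx, AddCircle.liftIco_coe_apply ⟨by linarith [hx1.2], by linarith [hx1.1]⟩,
      if_pos (by linarith [hx1.1]), neg_neg]

theorem eLpNorm_circ_rpow {p : ℝ} (hp : 1 ≤ p) (h : Circ → ℝ) :
    eLpNorm h (ENNReal.ofReal p) volume ^ p = lpNorm01 p (fun x => h (x : Circ)) ^ p +
      lpNorm01 p (fun x => h ((-x : ℝ) : Circ)) ^ p := by
  have hp0 : 0 < p := by linarith
  have e : ∀ {X : Type} [MeasurableSpace X] (μ : Measure X) (k : X → ℝ),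
      eLpNorm k (ENNReal.ofReal p) μ ^ p = ∫⁻ x, ‖k x‖ₑ ^ p ∂μ := by
    intro X _ μ k
    rw [eLpNorm_eq_lintegral_rpow_enorm_toReal (by simpa using hp0) ENNReal.ofReal_ne_top,
      ENNReal.toReal_ofReal hp0.le, ← ENNReal.rpow_mul, one_div, inv_mul_cancel₀ hp0.ne',
      ENNReal.rpow_one]
  rw [lpNorm01, lpNorm01, e, e, e, lintegral_circ]

theorem lpNorm01_coe_le {p : ℝ} (hp : 1 ≤ p) (h : Circ → ℝ) :
    lpNorm01 p (fun x => h (x : Circ)) ≤ eLpNorm h (ENNReal.ofReal p) volume := by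
  have hp0 : 0 < p := by linarith
  rw [← ENNReal.rpow_le_rpow_iff hp0, eLpNorm_circ_rpow hp]
  exact le_self_add

theorem lpNorm01_coe_neg_le {p : ℝ} (hp : 1 ≤ p) (h : Circ → ℝ) :
    lpNorm01 p (fun x => h ((-x : ℝ) : Circ)) ≤ eLpNorm h (ENNReal.ofReal p) volume := by
  have hp0 : 0 < p := by linarith
  rw [← ENNReal.rpow_le_rpow_iff hp0, eLpNorm_circ_rpow hp]
  exact le_add_self

theorem memLp_circ {p : ℝ} (hp : 1 ≤ p) {h : Circ → ℝ} (h1 : MemLp01 p fun x => h (x : Circ))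
    (h2 : MemLp01 p fun x => h ((-x : ℝ) : Circ)) : MemLp h (ENNReal.ofReal p) volume := by
  have hp0 : 0 < p := by linarith
  refine ⟨aestronglyMeasurable_circ h1.1 h2.1, ?_⟩
  have : eLpNorm h (ENNReal.ofReal p) volume ^ p < ⊤ := by
    rw [eLpNorm_circ_rpow hp]
    exact ENNReal.add_lt_top.2 ⟨ENNReal.rpow_lt_top_of_nonneg hp0.le h1.2.ne,
      ENNReal.rpow_lt_top_of_nonneg hp0.le h2.2.ne⟩
  exact (ENNReal.rpow_lt_top_iff_of_pos hp0).1 this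

theorem memLp_oddC {p : ℝ} (hp : 1 ≤ p) {u : ℝ → ℝ} (hu : MemLp01 p u) :
    MemLp (oddC u) (ENNReal.ofReal p) volume :=
  memLp_circ hp (hu.ae_eq (ae_μ01_mem.mono fun _ hx => (oddC_coe hx).symm))
    (hu.neg.ae_eq (ae_μ01_mem.mono fun _ hx => (oddC_coe_neg hx).symm))

theorem memLp_evenC {p : ℝ} (hp : 1 ≤ p) {u : ℝ → ℝ} (hu : MemLp01 p u) :
    MemLp (evenC u) (ENNReal.ofReal p) volume :=
  memLp_circ hp (hu.ae_eq (ae_μ01_mem.mono fun _ hx => (evenC_coe hx).symm))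
    (hu.ae_eq (ae_μ01_mem.mono fun _ hx => (evenC_coe_neg hx).symm))

/-- Oddness can fail at the two fixed points 0 and 1 of the reflection, where no boundary value is
imposed on `u`. -/
theorem oddC_neg_ae (u : ℝ → ℝ) : ∀ᵐ y : Circ, oddC u (-y) = -oddC u y := by
  refine ae_circ_iff.2 ⟨ae_μ01_mem.mono fun x hx => ?_, ae_μ01_mem.mono fun x hx => ?_⟩
  · rw [← AddCircle.coe_neg, oddC_coe hx, oddC_coe_neg hx]
  · rw [← AddCircle.coe_neg, neg_neg, oddC_coe hx, oddC_coe_neg hx, neg_neg]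

/-- A property of real numbers invariant under translation by `2` that holds almost everywhere on
a period holds almost everywhere. -/
theorem ae_of_periodic {P : ℝ → Prop} (hP : ∀ x, P (x + 2) ↔ P x)
    (h : ∀ᵐ x : ℝ ∂(volume.restrict (Ioc (-1 : ℝ) 1)), P x) : ∀ᵐ x : ℝ, P x := by
  have hz : ∀ (n : ℤ) (x : ℝ), P (x + n * 2) ↔ P x := by
    intro n
    induction n using Int.induction_on with
    | zero => simp
    | succ n ih =>
      intro x
      rw [← ih x, ← hP (x + (n : ℤ) * 2)]
      push_cast
      ring_nf
    | pred n ih =>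
      intro x
      rw [← ih x, ← hP (x + ((-(n : ℤ) - 1 : ℤ) : ℝ) * 2)]
      push_cast
      ring_nf
  rw [ae_restrict_iff' measurableSet_Ioc] at h
  have h2 : ∀ n : ℤ, ∀ᵐ x : ℝ, x - n * 2 ∈ Ioc (-1 : ℝ) 1 → P (x - n * 2) := fun n =>
    (measurePreserving_sub_right (volume : Measure ℝ) ((n : ℝ) * 2)).quasiMeasurePreserving.ae h
  filter_upwards [ae_all_iff.2 h2] with x hx
  obtain ⟨n, hn, -⟩ := existsUnique_add_zsmul_mem_Ioc (two_pos : (0 : ℝ) < 2) x (-1)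
  have h1 : x - ((-n : ℤ) : ℝ) * 2 = x + n * 2 := by push_cast; ring
  have h3 := hx (-n) (by
    simp only [zsmul_eq_mul] at hn
    push_cast
    constructor <;> linarith [hn.1, hn.2])
  rw [h1] at h3
  exact (hz n x).1 h3

theorem ae_coe_of_ae_circ {P : Circ → Prop} (h : ∀ᵐ y : Circ, P y) : ∀ᵐ x : ℝ, P (x : Circ) :=
  ae_of_periodic (fun x => by rw [AddCircle.coe_add_period])
    (measurePreserving_coe.quasiMeasurePreserving.ae h)

theorem periodic_coe (h : Circ → ℝ) : Function.Periodic (fun x : ℝ => h (x : Circ)) 2 := fun x => by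
  simp only [AddCircle.coe_add_period]

theorem intervalIntegrable_coe {h : Circ → ℝ} (hh : Integrable h) (a b : ℝ) :
    IntervalIntegrable (fun x : ℝ => h (x : Circ)) volume a b := by
  refine (periodic_coe h).intervalIntegrable (t := -1) two_ne_zero ?_ a b
  rw [intervalIntegrable_iff_integrableOn_Ioc_of_le (by norm_num),
    show (-1 : ℝ) + 2 = 1 by norm_num]
  exact measurePreserving_coe.integrable_comp_of_integrable hh

theorem lintegral_Ioc_le (h : Circ → ℝ≥0∞) (a : ℝ) (n : ℕ) :
    ∫⁻ x in Ioc a (a + 2 * n), h (x : Circ) ≤ n * ∫⁻ y, h y := by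
  induction n with
  | zero => simp
  | succ n ih =>
    have e : Ioc a (a + 2 * (n + 1 : ℕ)) = Ioc a (a + 2 * n) ∪ Ioc (a + 2 * n) (a + 2 * n + 2) := by
      rw [Ioc_union_Ioc_eq_Ioc (by simp) (by simp)]
      push_cast; ring_nf
    rw [e]
    refine (lintegral_union_le _ _ _).trans ?_
    rw [AddCircle.lintegral_preimage 2 (a + 2 * n) h]
    push_cast
    rw [add_mul, one_mul]
    gcongr

/-! ### Riemann invariants with an integrable source -/

/-- A measurable source on the circle, bounded in `L¹` uniformly in time. -/
structure IsSource (g : ℝ → Circ → ℝ) (C : ℝ≥0) : Prop where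
  measurable : Measurable (Function.uncurry g)
  bound : ∀ s, ∫⁻ y, ‖g s y‖ₑ ≤ C

/-- The Riemann invariant `z_x + z_t` along the characteristics, for the transport equation with
data `f` and source `g`: `riemann f g t y` is its value at time `t` and position `y - t`. -/
noncomputable def riemann (f : Circ → ℝ) (g : ℝ → Circ → ℝ) (t : ℝ) (y : Circ) : ℝ :=
  f y + ∫ s in (0 : ℝ)..t, g s (y - s)

theorem measurable_intervalIntegral_param {X : Type*} [MeasurableSpace X] {k : ℝ → X → ℝ}
    (hk : Measurable (Function.uncurry k)) :
    Measurable fun q : ℝ × X => ∫ s in (0 : ℝ)..q.1, k s q.2 := by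
  have hk' : Measurable fun r : (ℝ × X) × ℝ => k r.2 r.1.2 :=
    hk.comp (measurable_snd.prodMk (measurable_snd.comp measurable_fst))
  have key : ∀ (S : Set ((ℝ × X) × ℝ)), MeasurableSet S →
      Measurable fun q : ℝ × X => ∫ s, S.indicator (fun r : (ℝ × X) × ℝ => k r.2 r.1.2) (q, s) := by
    intro S hS
    exact ((hk'.indicator hS).stronglyMeasurable.integral_prod_right' (ν := volume)).measurable
  -- The oriented integral is a difference of two integrals over domains depending on the parameter;
  -- indicators move that dependence into the integrand.
  have h1 := key {r | 0 < r.2 ∧ r.2 ≤ r.1.1} ((measurableSet_lt measurable_const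
    measurable_snd).inter (measurableSet_le measurable_snd (measurable_fst.comp measurable_fst)))
  have h2 := key {r | r.1.1 < r.2 ∧ r.2 ≤ 0} ((measurableSet_lt
    (measurable_fst.comp measurable_fst) measurable_snd).inter
    (measurableSet_le measurable_snd measurable_const))
  convert! h1.sub h2 using 1
  funext q
  rw [Pi.sub_apply]
  rw [intervalIntegral, ← integral_indicator measurableSet_Ioc,
    ← integral_indicator measurableSet_Ioc]
  rfl

namespace IsSource

variable {g : ℝ → Circ → ℝ} {C : ℝ≥0}

theorem measurable_slice (hg : IsSource g C) (s : ℝ) : Measurable (g s) :=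
  hg.measurable.comp (measurable_const.prodMk measurable_id)

theorem integrable (hg : IsSource g C) (s : ℝ) : Integrable (g s) :=
  ⟨(hg.measurable_slice s).aestronglyMeasurable,
    (hg.bound s).trans_lt ENNReal.coe_lt_top⟩

theorem integrable_shift (hg : IsSource g C) {θ : ℝ → ℝ} (hθ : Measurable θ) (t a b : ℝ) :
    Integrable (fun q : ℝ × ℝ => g q.1 ((q.2 + θ q.1 : ℝ) : Circ))
      ((volume.restrict (Ioc 0 t)).prod (volume.restrict (Ioc a b))) := by
  have hm : Measurable fun q : ℝ × ℝ => g q.1 ((q.2 + θ q.1 : ℝ) : Circ) :=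
    hg.measurable.comp (measurable_fst.prodMk
      (measurable_coe_circ.comp (measurable_snd.add (hθ.comp measurable_fst))))
  refine ⟨hm.aestronglyMeasurable, ?_⟩
  obtain ⟨n, hn⟩ := exists_nat_ge (b - a)
  rw [HasFiniteIntegral, lintegral_prod _ hm.enorm.aemeasurable]
  calc ∫⁻ s in Ioc 0 t, ∫⁻ y in Ioc a b, ‖g s ((y + θ s : ℝ) : Circ)‖ₑ
      ≤ ∫⁻ _ in Ioc 0 t, (n : ℝ≥0∞) * C := by
        refine lintegral_mono fun s => ?_
        calc ∫⁻ y in Ioc a b, ‖g s ((y + θ s : ℝ) : Circ)‖ₑ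
            ≤ ∫⁻ y in Ioc a (a + 2 * n), ‖g s ((y : Circ) + (θ s : ℝ))‖ₑ := by
              simp only [AddCircle.coe_add]
              refine lintegral_mono' (Measure.restrict_mono (Ioc_subset_Ioc_right ?_) le_rfl) le_rfl
              have : (0 : ℝ) ≤ n := n.cast_nonneg
              linarith
          _ ≤ n * ∫⁻ y : Circ, ‖g s (y + (θ s : ℝ))‖ₑ :=
              lintegral_Ioc_le (fun y => ‖g s (y + (θ s : ℝ))‖ₑ) a n
          _ ≤ n * C := by
              rw [lintegral_add_right_eq_self (fun y => ‖g s y‖ₑ)]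
              gcongr
              exact hg.bound s
    _ < ⊤ := by
        rw [setLIntegral_const]
        exact ENNReal.mul_lt_top (ENNReal.mul_lt_top (by simp) (by simp)) (by simp)

/-- The spatial primitive of the Riemann invariant. -/
theorem integral_riemann_space (hg : IsSource g C) {f : Circ → ℝ} (hf : Integrable f) {t : ℝ}
    (ht : 0 ≤ t) {a b : ℝ} (hab : a ≤ b) :
    ∫ y in a..b, riemann f g t ((y + t : ℝ) : Circ) = (∫ y in (a + t)..(b + t), f (y : Circ)) +
      ∫ s in (0 : ℝ)..t, ∫ τ in (a + (t - s))..(b + (t - s)), g s (τ : Circ) := by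
  have hi := hg.integrable_shift (θ := fun s => t - s) (by fun_prop) t a b
  have e : ∀ y : ℝ, riemann f g t ((y + t : ℝ) : Circ)
      = f ((y + t : ℝ) : Circ) + ∫ s in Ioc 0 t, g s ((y + (t - s) : ℝ) : Circ) := by
    intro y
    rw [riemann, intervalIntegral.integral_of_le ht]
    simp only [← AddCircle.coe_sub, add_sub_assoc]
  simp_rw [e]
  rw [intervalIntegral.integral_add]
  · congr 1
    · exact intervalIntegral.integral_comp_add_right (fun y : ℝ => f (y : Circ)) t
    · rw [intervalIntegral.integral_of_le hab, intervalIntegral.integral_of_le ht]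
      rw [← integral_integral_swap (f := fun s y : ℝ => g s ((y + (t - s) : ℝ) : Circ)) hi]
      refine integral_congr_ae (Eventually.of_forall fun s => ?_)
      simp only
      rw [← intervalIntegral.integral_of_le hab]
      exact intervalIntegral.integral_comp_add_right (fun y : ℝ => g s (y : Circ)) (t - s)
  · have := intervalIntegrable_coe hf (a + t) (b + t)
    simpa using this.comp_add_right t
  · rw [intervalIntegrable_iff_integrableOn_Ioc_of_le hab]
    exact hi.integral_prod_right

/-- The indicator of s ≤ σ turns the iterated integral over a triangle into one over a square, where
Fubini applies. -/
theorem integrable_triangle (hg : IsSource g C) (t x : ℝ) :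
    Integrable (fun q : ℝ × ℝ => {q : ℝ × ℝ | q.1 ≤ q.2}.indicator
      (fun q : ℝ × ℝ => g q.1 ((q.2 + (x - q.1) : ℝ) : Circ)) q)
      ((volume.restrict (Ioc 0 t)).prod (volume.restrict (Ioc 0 t))) :=
  (hg.integrable_shift (θ := fun s => x - s) (by fun_prop) t 0 t).indicator
    (measurableSet_le measurable_fst measurable_snd)

theorem integral_triangle_slice {s t : ℝ} (hs : s ∈ Ioc 0 t) (x : ℝ) :
    ∫ σ in Ioc 0 t, {q : ℝ × ℝ | q.1 ≤ q.2}.indicator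
      (fun q : ℝ × ℝ => g q.1 ((q.2 + (x - q.1) : ℝ) : Circ)) (s, σ)
      = ∫ τ in x..(x + (t - s)), g s (τ : Circ) := by
  have e : ∀ σ, {q : ℝ × ℝ | q.1 ≤ q.2}.indicator
      (fun q : ℝ × ℝ => g q.1 ((q.2 + (x - q.1) : ℝ) : Circ)) (s, σ)
      = (Ici s).indicator (fun σ => g s ((σ + (x - s) : ℝ) : Circ)) σ := fun σ => rfl
  simp_rw [e]
  rw [setIntegral_indicator measurableSet_Ici]
  have h2 : Ioc 0 t ∩ Ici s = Icc s t := by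
    ext σ
    simp only [mem_inter_iff, mem_Ioc, mem_Ici, mem_Icc]
    constructor
    · rintro ⟨⟨-, h⟩, h'⟩; exact ⟨h', h⟩
    · rintro ⟨h', h⟩; exact ⟨⟨hs.1.trans_le h', h⟩, h'⟩
  rw [h2, integral_Icc_eq_integral_Ioc, ← intervalIntegral.integral_of_le hs.2]
  have := intervalIntegral.integral_comp_add_right (fun y : ℝ => g s (y : Circ)) (x - s)
    (a := s) (b := t)
  rw [this]
  congr 1 <;> ring

theorem riemann_eq_indicator {f : Circ → ℝ} {σ t : ℝ} (hσ : σ ∈ Ioc 0 t) (x : ℝ) :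
    riemann f g σ ((x + σ : ℝ) : Circ) = f ((x + σ : ℝ) : Circ) +
      ∫ s in Ioc 0 t, {q : ℝ × ℝ | q.1 ≤ q.2}.indicator
      (fun q : ℝ × ℝ => g q.1 ((q.2 + (x - q.1) : ℝ) : Circ)) (s, σ) := by
  rw [riemann, intervalIntegral.integral_of_le hσ.1.le]
  congr 1
  have e : ∀ s, {q : ℝ × ℝ | q.1 ≤ q.2}.indicator
      (fun q : ℝ × ℝ => g q.1 ((q.2 + (x - q.1) : ℝ) : Circ)) (s, σ)
      = (Iic σ).indicator (fun s => g s ((σ + (x - s) : ℝ) : Circ)) s := fun s => rfl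
  simp_rw [e]
  rw [setIntegral_indicator measurableSet_Iic]
  have : Ioc 0 t ∩ Iic σ = Ioc 0 σ := by
    rw [Ioc_inter_Iic, min_eq_right hσ.2]
  rw [this]
  refine integral_congr_ae (Eventually.of_forall fun s => ?_)
  simp only [← AddCircle.coe_sub]
  rw [show x + σ - s = σ + (x - s) by ring]

theorem intervalIntegrable_riemann (hg : IsSource g C) {f : Circ → ℝ} (hf : Integrable f)
    {t : ℝ} (ht : 0 ≤ t) (x : ℝ) :
    IntervalIntegrable (fun σ : ℝ => riemann f g σ ((x + σ : ℝ) : Circ)) volume 0 t := by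
  have h1 : IntervalIntegrable (fun σ : ℝ => f ((x + σ : ℝ) : Circ)) volume 0 t := by
    have := (intervalIntegrable_coe hf (x + 0) (x + t)).comp_add_left x
    simpa using this
  rw [intervalIntegrable_iff_integrableOn_Ioc_of_le ht] at h1 ⊢
  refine (h1.add (hg.integrable_triangle t x).integral_prod_right).congr ?_
  exact (ae_restrict_mem measurableSet_Ioc).mono fun σ hσ => (riemann_eq_indicator hσ x).symm

/-- The primitive in time of the Riemann invariant at a fixed position. -/
theorem integral_riemann_time (hg : IsSource g C) {f : Circ → ℝ} (hf : Integrable f)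
    {t : ℝ} (ht : 0 ≤ t) (x : ℝ) :
    ∫ σ in (0 : ℝ)..t, riemann f g σ ((x + σ : ℝ) : Circ) = (∫ y in x..(x + t), f (y : Circ)) +
      ∫ s in (0 : ℝ)..t, ∫ τ in x..(x + (t - s)), g s (τ : Circ) := by
  have h1 : IntervalIntegrable (fun σ : ℝ => f ((x + σ : ℝ) : Circ)) volume 0 t := by
    have := (intervalIntegrable_coe hf (x + 0) (x + t)).comp_add_left x
    simpa using this
  have h1' := h1
  rw [intervalIntegrable_iff_integrableOn_Ioc_of_le ht] at h1'
  have hi := hg.integrable_triangle t x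
  rw [intervalIntegral.integral_of_le ht, setIntegral_congr_fun measurableSet_Ioc
    (fun σ hσ => riemann_eq_indicator (f := f) (g := g) hσ x),
    integral_add h1' hi.integral_prod_right, ← intervalIntegral.integral_of_le ht]
  congr 1
  · have := intervalIntegral.integral_comp_add_left (fun y : ℝ => f (y : Circ)) x (a := 0) (b := t)
    simpa using this
  · rw [← integral_integral_swap (f := fun s σ : ℝ => {q : ℝ × ℝ | q.1 ≤ q.2}.indicator
      (fun q : ℝ × ℝ => g q.1 ((q.2 + (x - q.1) : ℝ) : Circ)) (s, σ)) hi,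
      intervalIntegral.integral_of_le ht]
    refine setIntegral_congr_fun measurableSet_Ioc fun s hs => ?_
    exact integral_triangle_slice hs x

end IsSource

/-- The integral over a symmetric interval of an odd function on the circle vanishes. -/
theorem integral_symm_eq_zero_of_odd {h : Circ → ℝ} (hodd : ∀ᵐ y : Circ, h (-y) = -h y) (r : ℝ) :
    ∫ y in (-r)..r, h (y : Circ) = 0 := by
  have h1 := intervalIntegral.integral_comp_neg (fun y : ℝ => h (y : Circ)) (a := -r) (b := r)
  rw [neg_neg] at h1
  have h2 : ∫ y in (-r)..r, h ((-y : ℝ) : Circ) = ∫ y in (-r)..r, -h (y : Circ) := by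
    refine intervalIntegral.integral_congr_ae ?_
    filter_upwards [ae_coe_of_ae_circ hodd] with y hy _
    rw [AddCircle.coe_neg, hy]
  rw [intervalIntegral.integral_neg] at h2
  linarith

/-- The fundamental relation between the two primitives of the Riemann invariant. -/
theorem IsSource.integral_riemann_sub {g : ℝ → Circ → ℝ} {C : ℝ≥0} (hg : IsSource g C)
    (hodd : ∀ s, ∀ᵐ y : Circ, g s (-y) = -g s y) {f : Circ → ℝ} (hf : Integrable f) {t : ℝ}
    (ht : 0 ≤ t) {x : ℝ} (hx : 0 ≤ x) :
    ∫ y in (-x)..x, riemann f g t ((y + t : ℝ) : Circ) = (∫ y in (-x)..x, f (y : Circ)) +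
      ∫ σ in (0 : ℝ)..t, (riemann f g σ ((x + σ : ℝ) : Circ)
        - riemann f g σ ((-x + σ : ℝ) : Circ)) := by
  rw [intervalIntegral.integral_sub (hg.intervalIntegrable_riemann hf ht x)
    (hg.intervalIntegrable_riemann hf ht (-x)), hg.integral_riemann_time hf ht,
    hg.integral_riemann_time hf ht, hg.integral_riemann_space hf ht (by linarith)]
  have hfi := intervalIntegrable_coe hf
  have hgi := fun s => intervalIntegrable_coe (hg.integrable s)
  have e1 : (∫ y in (-x + t)..(x + t), f (y : Circ)) = (∫ y in (-x)..x, f (y : Circ))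
      + (∫ y in x..(x + t), f (y : Circ)) - ∫ y in (-x)..(-x + t), f (y : Circ) := by
    rw [intervalIntegral.integral_add_adjacent_intervals (hfi _ _) (hfi _ _),
      intervalIntegral.integral_interval_sub_left (hfi _ _) (hfi _ _)]
  have e2 : ∀ s, (∫ τ in (-x + (t - s))..(x + (t - s)), g s (τ : Circ))
      = (∫ τ in x..(x + (t - s)), g s (τ : Circ)) -
        ∫ τ in (-x)..(-x + (t - s)), g s (τ : Circ) := by
    intro s
    -- Oddness of the source removes its contribution over [-x, x], so only fluxes through the two
    -- ends remain.
    have h0 := integral_symm_eq_zero_of_odd (hodd s) x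
    rw [← zero_add (∫ τ in x..(x + (t - s)), g s (τ : Circ)), ← h0,
      intervalIntegral.integral_add_adjacent_intervals (hgi _ _ _) (hgi _ _ _),
      intervalIntegral.integral_interval_sub_left (hgi _ _ _) (hgi _ _ _)]
  have hcont : ∀ a : ℝ, IntervalIntegrable
      (fun s => ∫ τ in a..(a + (t - s)), g s (τ : Circ)) volume 0 t := by
    intro a
    have hi := (hg.integrable_triangle t a).integral_prod_left
    rw [intervalIntegrable_iff_integrableOn_Ioc_of_le ht]
    refine hi.congr ((ae_restrict_mem measurableSet_Ioc).mono fun s hs => ?_)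
    exact integral_triangle_slice hs a
  simp_rw [e2]
  rw [intervalIntegral.integral_sub (hcont x) (hcont (-x)), e1]
  ring

/-! ### D'Alembert's formula through the Riemann invariant -/

/-- A jointly measurable version is set to zero at the times where the L¹ bound fails. Those times
form a null set, and the bound then holds at every time, as `IsSource` requires. -/
theorem exists_measurable_rep {p : ℝ} (hp : 1 ≤ p) {w : ℝ → ℝ → ℝ} (hw : MemLinftyLp p w) :
    ∃ (w' : ℝ → ℝ → ℝ) (C : ℝ≥0), Measurable (Function.uncurry w') ∧
      (∀ s, ∫⁻ x, ‖w' s x‖ₑ ∂μ01 ≤ C) ∧ ∀ᵐ s ∂μTime, w s =ᵐ[μ01] w' s := by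
  obtain ⟨hm, C, hC⟩ := hw
  set w₀ : ℝ × ℝ → ℝ := hm.mk _ with hw₀
  have hw₀m : Measurable w₀ := hm.stronglyMeasurable_mk.measurable
  set S : Set ℝ := {s | ∫⁻ x, ‖w₀ (s, x)‖ₑ ∂μ01 ≤ C} with hS
  have hSm : MeasurableSet S :=
    measurableSet_le (Measurable.lintegral_prod_right' (f := fun q => ‖w₀ q‖ₑ) hw₀m.enorm)
      measurable_const
  have hae : ∀ᵐ s ∂μTime, ∀ᵐ x ∂μ01, w s x = w₀ (s, x) := by
    have : IsProbabilityMeasure μ01 := inferInstance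
    exact Measure.ae_ae_of_ae_prod hm.ae_eq_mk
  refine ⟨fun s x => S.indicator (fun s => w₀ (s, x)) s, C, ?_, fun s => ?_, ?_⟩
  · have : (Function.uncurry fun s x => S.indicator (fun s => w₀ (s, x)) s)
        = (Prod.fst ⁻¹' S).indicator w₀ := by
      funext q
      by_cases h : q.1 ∈ S
      · simp [Function.uncurry, indicator, h]
      · simp [Function.uncurry, indicator, h]
    rw [this]
    exact hw₀m.indicator (measurable_fst hSm)
  · by_cases h : s ∈ S
    · simp only [indicator_of_mem h]; exact h
    · simp [indicator_of_notMem h]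
  · filter_upwards [hae, hC] with s h1 h2
    have hsm : AEStronglyMeasurable (w s) μ01 :=
      ⟨fun x => w₀ (s, x), (hw₀m.comp (measurable_const.prodMk measurable_id)).stronglyMeasurable,
        h1⟩
    have h : s ∈ S := by
      have e : ∫⁻ x, ‖w₀ (s, x)‖ₑ ∂μ01 = ∫⁻ x, ‖w s x‖ₑ ∂μ01 :=
        lintegral_congr_ae (h1.mono fun x hx => by simp only [hx])
      rw [hS, mem_ofPred_eq, e]
      exact (lintegral_enorm_le_lpNorm01 hp hsm).trans h2
    simp only [indicator_of_mem h]
    exact h1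

/-- The source `- a w` of the damped wave equation, on the circle. -/
noncomputable def dampingSource (a : ℝ → ℝ) (w : ℝ → ℝ → ℝ) (s : ℝ) (y : Circ) : ℝ :=
  -(evenC a y * oddC (w s) y)

theorem isSource_dampingSource {a : ℝ → ℝ} (ha : ContinuousOn a (Icc 0 1)) {w : ℝ → ℝ → ℝ}
    (hw : Measurable (Function.uncurry w)) {C : ℝ≥0} (hC : ∀ s, ∫⁻ x, ‖w s x‖ₑ ∂μ01 ≤ C) :
    ∃ C', IsSource (dampingSource a w) C' := by
  have hac := continuous_evenC ha
  have hodd : Measurable fun q : ℝ × Circ => oddC (w q.1) q.2 := by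
    have he : Measurable fun y : Circ => ((AddCircle.measurableEquivIco 2 (-1) y : _) : ℝ) :=
      measurable_subtype_coe.comp (AddCircle.measurableEquivIco 2 (-1)).measurable
    have he2 : Measurable fun q : ℝ × Circ => ((AddCircle.measurableEquivIco 2 (-1) q.2 : _) : ℝ) :=
      he.comp measurable_snd
    exact Measurable.ite (measurableSet_lt he2 measurable_const)
      (hw.comp (measurable_fst.prodMk he2.neg)).neg (hw.comp (measurable_fst.prodMk he2))
  let α : C(Circ, ℝ) := ⟨evenC a, hac⟩
  refine ⟨‖α‖₊ * (C + C), ⟨((hac.measurable.comp measurable_snd).mul hodd).neg, fun s => ?_⟩⟩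
  calc ∫⁻ y, ‖dampingSource a w s y‖ₑ ≤ ∫⁻ y, ‖α‖₊ * ‖oddC (w s) y‖ₑ := by
        refine lintegral_mono fun y => ?_
        rw [dampingSource, enorm_neg, enorm_mul]
        gcongr
        have := α.norm_coe_le_norm y
        exact ENNReal.coe_le_coe.2 this
    _ = ‖α‖₊ * ∫⁻ y, ‖oddC (w s) y‖ₑ := lintegral_const_mul' _ _ ENNReal.coe_ne_top
    _ ≤ ‖α‖₊ * (C + C) := by
        rw [lintegral_circ]
        gcongr
        · refine le_trans (le_of_eq (lintegral_congr_ae ?_)) (hC s)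
          exact ae_μ01_mem.mono fun x hx => by simp only [oddC_coe hx]
        · refine le_trans (le_of_eq (lintegral_congr_ae ?_)) (hC s)
          exact ae_μ01_mem.mono fun x hx => by simp only [oddC_coe_neg hx, enorm_neg]
    _ = _ := by push_cast; rfl

theorem dampingSource_neg_ae (a : ℝ → ℝ) (w : ℝ → ℝ → ℝ) (s : ℝ) :
    ∀ᵐ y : Circ, dampingSource a w s (-y) = -dampingSource a w s y := by
  filter_upwards [oddC_neg_ae (w s)] with y hy
  simp only [dampingSource, evenC_neg, hy]
  ring

theorem oddC_congr_ae {u v : ℝ → ℝ} (h : u =ᵐ[μ01] v) : oddC u =ᵐ[volume] oddC v := by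
  refine ae_circ_iff.2 ⟨?_, ?_⟩
  · filter_upwards [h, ae_μ01_mem] with x hx hx1
    rw [oddC_coe hx1, oddC_coe hx1, hx]
  · filter_upwards [h, ae_μ01_mem] with x hx hx1
    rw [oddC_coe_neg hx1, oddC_coe_neg hx1, hx]

theorem integral_evenC {g : ℝ → ℝ} (hg : Integrable (evenC g)) :
    ∫ y, evenC g y = 2 * ∫ x in (0 : ℝ)..1, g x := by
  rw [integral_circ hg, ← integral_μ01, two_mul]
  congr 1
  · exact integral_congr_ae (ae_μ01_mem.mono fun x hx => evenC_coe hx)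
  · exact integral_congr_ae (ae_μ01_mem.mono fun x hx => evenC_coe_neg hx)

theorem integral_evenC_coe_neg (g : ℝ → ℝ) (x : ℝ) :
    ∫ y in (0 : ℝ)..(-x), evenC g (y : Circ) = -∫ y in (0 : ℝ)..x, evenC g (y : Circ) := by
  have h := intervalIntegral.integral_comp_neg (fun y : ℝ => evenC g (y : Circ)) (a := 0) (b := x)
  simp only [AddCircle.coe_neg, evenC_neg, neg_zero] at h
  rw [h, intervalIntegral.integral_symm]

theorem integral_evenC_coe {g : ℝ → ℝ} {x : ℝ} (hx : x ∈ Icc (0 : ℝ) 1) :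
    ∫ y in (0 : ℝ)..x, evenC g (y : Circ) = ∫ y in (0 : ℝ)..x, g y := by
  refine intervalIntegral.integral_congr fun y hy => ?_
  rw [uIcc_of_le hx.1] at hy
  exact evenC_coe_Icc ⟨hy.1, hy.2.trans hx.2⟩

/-- The odd extension of a function of `W^{1,p}_0(0,1)` is the primitive of the even extension of
its derivative. -/
theorem oddExt_ae_eq_primitive {u g : ℝ → ℝ} (hg : Integrable (evenC g))
    (h0 : ∫ y in (0 : ℝ)..1, g y = 0) (hu : ∀ᵐ x ∂μ01, u x = ∫ y in (0 : ℝ)..x, g y) :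
    ∀ᵐ x : ℝ, oddExt u x = ∫ y in (0 : ℝ)..x, evenC g (y : Circ) := by
  refine ae_of_periodic (fun x => ?_) ?_
  · have e : ∫ y in (0 : ℝ)..(x + 2), evenC g (y : Circ) = ∫ y in (0 : ℝ)..x, evenC g (y : Circ) := by
      rw [← intervalIntegral.integral_add_adjacent_intervals (intervalIntegrable_coe hg 0 x)
        (intervalIntegrable_coe hg x (x + 2)), AddCircle.intervalIntegral_preimage 2 x (evenC g),
        integral_evenC hg, h0, mul_zero, add_zero]
    rw [e, oddExt_eq, oddExt_eq, AddCircle.coe_add_period]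
  · rw [restrict_Ioc_eq, ae_add_measure_iff]
    constructor
    · filter_upwards [hu, ae_μ01_mem] with x hx hx1
      rw [oddExt_eq, oddC_coe hx1, hx, integral_evenC_coe (Ioo_subset_Icc_self hx1)]
    · refine (MeasurableEquiv.neg ℝ).measurableEmbedding.ae_map_iff.2 ?_
      filter_upwards [hu, ae_μ01_mem] with x hx hx1
      change oddExt u (-x) = ∫ y in (0 : ℝ)..(-x), evenC g (y : Circ)
      rw [oddExt_eq, oddC_coe_neg hx1, hx, integral_evenC_coe_neg,
        integral_evenC_coe (Ioo_subset_Icc_self hx1)]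

/-- For odd `h`, the integral over `[x - r, x + r]` equals the integral over `[r - x, r + x]`. -/
theorem integral_reflect_of_odd {h : Circ → ℝ} (hi : Integrable h)
    (hodd : ∀ᵐ y : Circ, h (-y) = -h y) (x r : ℝ) :
    ∫ y in (x - r)..(x + r), h (y : Circ) = ∫ y in (-x + r)..(x + r), h (y : Circ) := by
  have h1 := intervalIntegral.integral_add_adjacent_intervals
    (intervalIntegrable_coe hi (x - r) (-(x - r))) (intervalIntegrable_coe hi (-(x - r)) (x + r))
  have h2 := integral_symm_eq_zero_of_odd hodd (-(x - r))
  rw [neg_neg] at h2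
  rw [← h1, h2, zero_add]
  congr 1
  ring

/-- d'Alembert's formula in terms of the Riemann invariant. -/
theorem dAlembert_ae_eq {a z₀ z₁ g₀ : ℝ → ℝ} {w w' : ℝ → ℝ → ℝ} (hg₀ : Integrable (evenC g₀))
    (hz₁ : Integrable (oddC z₁)) (h0 : ∫ y in (0 : ℝ)..1, g₀ y = 0)
    (hz₀ : ∀ᵐ x ∂μ01, z₀ x = ∫ y in (0 : ℝ)..x, g₀ y) (hww : ∀ᵐ s ∂μTime, w s =ᵐ[μ01] w' s)
    {C : ℝ≥0} (hs : IsSource (dampingSource a w') C) {f : Circ → ℝ}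
    (hf : f =ᵐ[volume] fun y => evenC g₀ y + oddC z₁ y) {t : ℝ} (ht : 0 ≤ t) :
    ∀ᵐ x ∂μ01, dAlembert z₀ z₁ (fun s τ => - (evenExt a τ * oddExt (w s) τ)) t x
      = 1 / 2 * ∫ y in (-x)..x, riemann f (dampingSource a w') t ((y + t : ℝ) : Circ) := by
  have hH := oddExt_ae_eq_primitive hg₀ h0 hz₀
  have h1 := (measurePreserving_add_right (volume : Measure ℝ) t).quasiMeasurePreserving.ae hH
  have h2 := (measurePreserving_sub_right (volume : Measure ℝ) t).quasiMeasurePreserving.ae hH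
  have hfi : Integrable f := (hg₀.add hz₁).congr hf.symm
  filter_upwards [ae_restrict_of_ae h1, ae_restrict_of_ae h2, ae_μ01_mem] with x hx1 hx2 hx
  rw [hs.integral_riemann_space hfi ht (by linarith [hx.1]), dAlembert, hx1, hx2]
  have e1 : ∫ y in (-x + t)..(x + t), f (y : Circ)
      = (∫ y in (-x + t)..(x + t), evenC g₀ (y : Circ)) +
        ∫ y in (-x + t)..(x + t), oddC z₁ (y : Circ) := by
    rw [← intervalIntegral.integral_add (intervalIntegrable_coe hg₀ _ _)
      (intervalIntegrable_coe hz₁ _ _)]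
    exact intervalIntegral.integral_congr_ae ((ae_coe_of_ae_circ hf).mono fun y hy _ => hy)
  -- The primitive of an even function is odd, which turns the sum of the two values of the extended
  -- `z₀` into an integral over [t - x, t + x]. Reflection of odd functions brings the velocity term
  -- to that interval and the source term to its shifted analogue.
  have e2 : ∫ y in (-x + t)..(x + t), evenC g₀ (y : Circ)
      = (∫ y in (0 : ℝ)..(x + t), evenC g₀ (y : Circ))
        + ∫ y in (0 : ℝ)..(x - t), evenC g₀ (y : Circ) := by
    rw [← intervalIntegral.integral_interval_sub_left (intervalIntegrable_coe hg₀ 0 (x + t))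
      (intervalIntegrable_coe hg₀ 0 (-x + t)), show -x + t = -(x - t) by ring,
      integral_evenC_coe_neg]
    ring
  have e3 : ∫ s in (x - t)..(x + t), oddExt z₁ s
      = ∫ y in (-x + t)..(x + t), oddC z₁ (y : Circ) :=
    integral_reflect_of_odd hz₁ (oddC_neg_ae z₁) x t
  have e4 : ∫ s in (0 : ℝ)..t, ∫ τ in (x - (t - s))..(x + (t - s)),
        -(evenExt a τ * oddExt (w s) τ)
      = ∫ s in (0 : ℝ)..t, ∫ τ in (-x + (t - s))..(x + (t - s)),
        dampingSource a w' s (τ : Circ) := by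
    refine intervalIntegral.integral_congr_ae ?_
    have hww' : ∀ᵐ s : ℝ, s ∈ Ioi (0 : ℝ) → w s =ᵐ[μ01] w' s :=
      (ae_restrict_iff' measurableSet_Ioi).1 hww
    filter_upwards [hww'] with s hsw hst
    rw [uIoc_of_le ht] at hst
    rw [← integral_reflect_of_odd (hs.integrable s) (dampingSource_neg_ae a w' s)]
    refine intervalIntegral.integral_congr_ae ?_
    filter_upwards [ae_coe_of_ae_circ (oddC_congr_ae (hsw hst.1))] with τ hτ _
    rw [dampingSource, evenExt_eq, oddExt_eq, hτ]
  rw [e1, e2, e3, e4]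
  ring

/-! ### Identification of the weak time derivative -/

instance : SFinite μTime := by unfold μTime; infer_instance

/-- The exceptional set in `x` may depend on `t`; joint measurability puts the equality in the
product space, where the quantifiers can be exchanged. -/
theorem ae_ae_swap {z Y : ℝ → ℝ → ℝ}
    (hz : AEStronglyMeasurable (Function.uncurry z) (μTime.prod μ01))
    (hY : Measurable (Function.uncurry Y)) (h : ∀ᵐ t ∂μTime, ∀ᵐ x ∂μ01, z t x = Y t x) :
    ∀ᵐ x ∂μ01, ∀ᵐ t ∂μTime, z t x = Y t x := by
  have h1 := Measure.ae_ae_of_ae_prod hz.ae_eq_mk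
  have hmk : Measurable (hz.mk _) := hz.stronglyMeasurable_mk.measurable
  have h2 : ∀ᵐ q ∂μTime.prod μ01, hz.mk _ q = Function.uncurry Y q := by
    rw [Measure.ae_prod_iff_ae_ae (measurableSet_eq_fun hmk hY)]
    filter_upwards [h, h1] with t h3 h4
    filter_upwards [h3, h4] with x h5 h6
    exact h6.symm.trans h5
  have h3 : ∀ᵐ q ∂μTime.prod μ01, z q.1 q.2 = Y q.1 q.2 := by
    filter_upwards [h2, hz.ae_eq_mk] with q h4 h5
    exact h5.trans h4
  have h4 : ∀ᵐ q ∂μ01.prod μTime, z q.2 q.1 = Y q.2 q.1 := by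
    have := Measure.measurePreserving_swap (μ := μ01) (ν := μTime)
    exact this.quasiMeasurePreserving.ae h3
  exact Measure.ae_ae_of_ae_prod h4

/-- Rational half-lines form a generating π-system. Its countability is what lets a condition known
for each half-line at almost every time hold for all of them simultaneously. -/
theorem ae_eq_zero_of_integral_Iic_rat {h : ℝ → ℝ} (hi : Integrable h μ01)
    (h0 : ∀ q : ℚ, ∫ x in Iic (q : ℝ), h x ∂μ01 = 0) : h =ᵐ[μ01] 0 := by
  have huniv : ∫ x, h x ∂μ01 = 0 := by
    rw [← h0 1, Measure.restrict_eq_self_of_ae_mem]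
    filter_upwards [ae_μ01_mem] with x hx
    simpa using hx.2.le
  refine hi.ae_eq_zero_of_forall_setIntegral_eq_zero fun s hs _ => ?_
  induction s, hs using MeasurableSpace.induction_on_inter
    ((BorelSpace.measurable_eq (α := ℝ)).trans Real.borel_eq_generateFrom_Iic_rat)
    Real.isPiSystem_Iic_rat with
  | empty => simp
  | basic t ht =>
    simp only [iUnion_singleton_eq_range, mem_range] at ht
    obtain ⟨q, rfl⟩ := ht
    exact h0 q
  | compl t ht ih =>
    have := integral_add_compl ht hi
    rw [ih ((measure_lt_top μ01 t)), huniv, zero_add] at this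
    exact this
  | iUnion f hd hm ih =>
    rw [integral_iUnion hm hd hi.integrableOn]
    simp [ih]

/-- Integration by parts against a test function on `(0,∞)`. -/
theorem integral_deriv_mul_primitive {ψ k : ℝ → ℝ} {T : ℝ} (hψ : IsTestFunction (Ioi 0) ψ)
    (hψT : ∀ t, T ≤ t → ψ t = 0) (hk : IntervalIntegrable k volume 0 T) (c : ℝ) :
    ∫ t in (0 : ℝ)..T, deriv ψ t * (c + ∫ σ in (0 : ℝ)..t, k σ)
      = -∫ t in (0 : ℝ)..T, ψ t * k t := by
  have hψ0 : ψ 0 = 0 := hψ.apply_eq_zero (by simp)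
  -- The integrand `k` is merely integrable, so its primitive is only absolutely continuous and the
  -- classical formula does not apply.
  have h1 : AbsolutelyContinuousOnInterval ψ 0 T :=
    ((hψ.smooth.of_le (by simp)).contDiffOn).absolutelyContinuousOnInterval
  have h2 := hk.absolutelyContinuousOnInterval_intervalIntegral (c := 0) (by simp)
  have h3 := h1.integral_mul_deriv_eq_deriv_mul h2
  rw [hψT T le_rfl, hψ0] at h3
  have h4 : ∫ t in (0 : ℝ)..T, ψ t * deriv (fun t => ∫ σ in (0 : ℝ)..t, k σ) t
      = ∫ t in (0 : ℝ)..T, ψ t * k t := by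
    refine intervalIntegral.integral_congr_ae ?_
    filter_upwards [hk.ae_hasDerivAt_integral] with t ht htm
    rw [(ht (uIoc_subset_uIcc htm) 0 (by simp)).deriv]
  have h5 : ∫ t in (0 : ℝ)..T, deriv ψ t = 0 := by
    rw [intervalIntegral.integral_eq_sub_of_hasDerivAt (fun y _ => hψ.hasDerivAt y)
      (hψ.continuous_deriv.intervalIntegrable _ _), hψT T le_rfl, hψ0, sub_zero]
  have hd := hψ.continuous_deriv.intervalIntegrable (μ := volume) 0 T
  simp_rw [mul_add]
  rw [intervalIntegral.integral_add (hd.mul_const c) (hd.mul_continuousOn h2.continuousOn),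
    intervalIntegral.integral_mul_const, h5, ← h4, h3]
  ring

theorem IsTestFunction.exists_eq_zero_of_le {ψ : ℝ → ℝ} (hψ : IsTestFunction (Ioi 0) ψ) :
    ∃ T, 0 < T ∧ ∀ t, T ≤ t → ψ t = 0 := by
  obtain ⟨R, hR⟩ := hψ.compact_support.isCompact.isBounded.subset_closedBall 0
  refine ⟨|R| + 1, by positivity, fun t ht => image_eq_zero_of_notMem_tsupport fun h => ?_⟩
  have := hR h
  rw [Real.closedBall_eq_Icc] at this
  linarith [this.2, le_abs_self R]

theorem integral_μTime_eq {F : ℝ → ℝ} {T : ℝ} (hT : 0 ≤ T) (hF : ∀ t, T < t → F t = 0) :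
    ∫ t, F t ∂μTime = ∫ t in (0 : ℝ)..T, F t := by
  rw [intervalIntegral.integral_of_le hT, μTime]
  refine setIntegral_eq_of_subset_of_forall_sdiff_eq_zero measurableSet_Ioi (fun t ht => ht.1) ?_
  intro t ht
  exact hF t (not_le.1 fun h => ht.2 ⟨ht.1, h⟩)

theorem integrable_uncurry_of_bound {k : ℝ → ℝ → ℝ} (hk : Measurable (Function.uncurry k)) {T : ℝ}
    {C : ℝ≥0} (hC : ∀ s ∈ Icc 0 T, ∫⁻ x, ‖k s x‖ₑ ∂μ01 ≤ C) :
    Integrable (Function.uncurry k) ((volume.restrict (Ioc 0 T)).prod μ01) := by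
  refine ⟨hk.aestronglyMeasurable, ?_⟩
  rw [HasFiniteIntegral, lintegral_prod _ hk.enorm.aemeasurable]
  calc ∫⁻ s in Ioc 0 T, ∫⁻ x, ‖k s x‖ₑ ∂μ01 ≤ ∫⁻ _ in Ioc 0 T, (C : ℝ≥0∞) := by
        refine setLIntegral_mono_ae measurable_const.aemeasurable (Eventually.of_forall fun s hs => ?_)
        exact hC s (Ioc_subset_Icc_self hs)
    _ < ⊤ := by
        rw [setLIntegral_const]
        exact ENNReal.mul_lt_top (by simp) (by simp)

/-- The integrand of a primitive in time is its weak time derivative. -/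
theorem ae_eq_of_isWeakTimeDeriv {z w w' k : ℝ → ℝ → ℝ} {c : ℝ → ℝ} {C : ℝ≥0}
    (hz : AEStronglyMeasurable (Function.uncurry z) (μTime.prod μ01))
    (hw : AEStronglyMeasurable (Function.uncurry w) (μTime.prod μ01))
    (hzw : IsWeakTimeDeriv z w) (hw' : Measurable (Function.uncurry w'))
    (hC : ∀ s, ∫⁻ x, ‖w' s x‖ₑ ∂μ01 ≤ C) (hww : ∀ᵐ s ∂μTime, w s =ᵐ[μ01] w' s)
    (hk : Measurable (Function.uncurry k))
    (hkb : ∀ T : ℝ, ∃ B : ℝ≥0, ∀ s ∈ Icc 0 T, ∫⁻ x, ‖k s x‖ₑ ∂μ01 ≤ B) (hc : Measurable c)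
    (hzk : ∀ t, 0 ≤ t → ∀ᵐ x ∂μ01, z t x = c x + ∫ σ in (0 : ℝ)..t, k σ x) :
    ∀ᵐ t ∂μTime, k t =ᵐ[μ01] w' t := by
  have hY : Measurable (Function.uncurry fun t x => c x + ∫ σ in (0 : ℝ)..t, k σ x) :=
    (hc.comp measurable_snd).add (measurable_intervalIntegral_param hk)
  have hzx := ae_ae_swap hz hY ((ae_restrict_iff' measurableSet_Ioi).2
    (Eventually.of_forall fun t ht => hzk t (le_of_lt ht)))
  have hwx := ae_ae_swap hw hw' hww
  have hki := fun T => (integrable_uncurry_of_bound hk (hkb T).choose_spec)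
  have hwi := fun T => integrable_uncurry_of_bound (T := T) hw' fun s _ => hC s
  have hweak : ∀ ψ, IsTestFunction (Ioi 0) ψ → ∀ T, 0 < T → (∀ t, T ≤ t → ψ t = 0) →
      ∀ᵐ x ∂μ01, ∫ t in Ioc 0 T, ψ t * (k t x - w' t x) = 0 := by
    intro ψ hψ T hT hψT
    have hd0 : ∀ t, T < t → deriv ψ t = 0 := fun t ht => by
      have : ψ =ᶠ[𝓝 t] fun _ => 0 :=
        (eventually_gt_nhds ht).mono fun s hs => hψT s hs.le
      rw [this.deriv_eq, deriv_const]
    filter_upwards [hzx, hwx, hzw ψ hψ, (hki T).prod_left_ae, (hwi T).prod_left_ae]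
      with x h1 h2 h3 h4 h5
    have hkx : IntervalIntegrable (fun t => k t x) volume 0 T :=
      (intervalIntegrable_iff_integrableOn_Ioc_of_le hT.le).2 h4
    have hwx : IntervalIntegrable (fun t => w' t x) volume 0 T :=
      (intervalIntegrable_iff_integrableOn_Ioc_of_le hT.le).2 h5
    rw [integral_congr_ae (h1.mono fun t ht => by rw [ht]),
      integral_congr_ae (f := fun t => ψ t * w t x) (g := fun t => ψ t * w' t x)
        (h2.mono fun t ht => by simp only [ht]),
      integral_μTime_eq hT.le fun t ht => by rw [hd0 t ht, zero_mul],
      integral_μTime_eq hT.le fun t ht => by rw [hψT t ht.le, zero_mul],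
      integral_deriv_mul_primitive hψ hψT hkx] at h3
    rw [← intervalIntegral.integral_of_le hT.le]
    simp_rw [mul_sub]
    have hψc := hψ.smooth.continuous.continuousOn (s := uIcc 0 T)
    rw [intervalIntegral.integral_sub (hkx.continuousOn_mul hψc) (hwx.continuousOn_mul hψc)]
    linarith
  -- In `hweak` the null set of `x` depends on the test function. Integrating over a half-line in
  -- `x` removes this dependence and leaves a scalar function of time, to which the fundamental
  -- lemma applies.
  have hrat : ∀ q : ℚ, ∀ᵐ t ∂μTime, ∫ x in Iic (q : ℝ), (k t x - w' t x) ∂μ01 = 0 := by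
    intro q
    set H : ℝ → ℝ := fun t => ∫ x in Iic (q : ℝ), (k t x - w' t x) ∂μ01 with hH
    have hint : ∀ T, Integrable (fun r : ℝ × ℝ => k r.1 r.2 - w' r.1 r.2)
        ((volume.restrict (Ioc 0 T)).prod (μ01.restrict (Iic (q : ℝ)))) := fun T =>
      ((hki T).sub (hwi T)).mono_measure (Measure.prod_mono le_rfl Measure.restrict_le_self)
    have hHi : ∀ T, IntegrableOn H (Ioc 0 T) := fun T => (hint T).integral_prod_left
    refine (ae_restrict_iff' measurableSet_Ioi).2 ?_
    refine isOpen_Ioi.ae_eq_zero_of_integral_contDiff_smul_eq_zero (fun t ht => ?_) ?_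
    · refine ⟨Ioc 0 (t + 1), mem_nhdsWithin_of_mem_nhds (Ioc_mem_nhds ht (by linarith)), hHi _⟩
    · intro ψ h1 h2 h3
      have hψ : IsTestFunction (Ioi 0) ψ := ⟨h1, h2, h3⟩
      obtain ⟨T, hT, hψT⟩ := hψ.exists_eq_zero_of_le
      have e1 : ∫ t, ψ t • H t = ∫ t in Ioc 0 T, ψ t * H t := by
        symm
        refine setIntegral_eq_integral_of_forall_compl_eq_zero fun t ht => ?_
        by_cases h : 0 < t
        · rw [hψT t (not_lt.1 fun h' => ht ⟨h, h'.le⟩), zero_mul]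
        · rw [hψ.apply_eq_zero h, zero_mul]
      rw [e1]
      have hb : ∃ B, ∀ t, ‖ψ t‖ ≤ B := h2.exists_bound_of_continuous h1.continuous
      obtain ⟨B, hB⟩ := hb
      have hint2 : Integrable (fun r : ℝ × ℝ => ψ r.1 * (k r.1 r.2 - w' r.1 r.2))
          ((volume.restrict (Ioc 0 T)).prod (μ01.restrict (Iic (q : ℝ)))) :=
        (hint T).bdd_mul (c := B) (h1.continuous.comp continuous_fst).aestronglyMeasurable
          (Eventually.of_forall fun r => hB r.1)
      calc ∫ t in Ioc 0 T, ψ t * H t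
          = ∫ t in Ioc 0 T, ∫ x in Iic (q : ℝ), ψ t * (k t x - w' t x) ∂μ01 := by
            simp only [hH, integral_const_mul]
        _ = ∫ x in Iic (q : ℝ), (∫ t in Ioc 0 T, ψ t * (k t x - w' t x)) ∂μ01 :=
            integral_integral_swap hint2
        _ = 0 := integral_eq_zero_of_ae (ae_restrict_of_ae (hweak ψ hψ T hT hψT))
  have hall := ae_all_iff.2 hrat
  have hpos : ∀ᵐ t ∂μTime, t ∈ Ioi (0 : ℝ) := ae_restrict_mem measurableSet_Ioi
  filter_upwards [hall, hpos] with t ht htp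
  have hkt : Integrable (k t) μ01 :=
    ⟨(hk.comp (measurable_const.prodMk measurable_id)).aestronglyMeasurable,
      ((hkb t).choose_spec t ⟨le_of_lt htp, le_rfl⟩).trans_lt ENNReal.coe_lt_top⟩
  have hwt : Integrable (w' t) μ01 :=
    ⟨(hw'.comp (measurable_const.prodMk measurable_id)).aestronglyMeasurable,
      (hC t).trans_lt ENNReal.coe_lt_top⟩
  filter_upwards [ae_eq_zero_of_integral_Iic_rat (hkt.sub hwt) ht] with x hx
  exact sub_eq_zero.1 hx

/-! ### Mild solutions: uniqueness, contraction and strong stability -/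

theorem measurable_shift {X : Type*} [MeasurableSpace X] {h : ℝ → Circ → ℝ}
    (hh : Measurable (Function.uncurry h)) {a : X → ℝ} (ha : Measurable a) {b : X → Circ}
    (hb : Measurable b) : Measurable fun x => h (a x) (b x) :=
  hh.comp (ha.prodMk hb)

/-- Tonelli along the characteristics. -/
theorem lintegral_lintegral_shift {h : ℝ → Circ → ℝ} (hh : Measurable (Function.uncurry h)) (t : ℝ) :
    ∫⁻ y : Circ, ∫⁻ s in Ioc 0 t, ‖h s (y - s)‖ₑ = ∫⁻ s in Ioc 0 t, ∫⁻ y, ‖h s y‖ₑ := by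
  rw [lintegral_lintegral_swap]
  · refine lintegral_congr fun s => ?_
    exact lintegral_sub_right_eq_self (fun y : Circ => ‖h s y‖ₑ) (s : Circ)
  · exact (measurable_shift hh measurable_snd
      (measurable_fst.sub (measurable_coe_circ.comp measurable_snd))).enorm.aemeasurable

theorem measurable_riemann {f : Circ → ℝ} (hf : Measurable f) {g : ℝ → Circ → ℝ}
    (hg : Measurable (Function.uncurry g)) : Measurable (Function.uncurry (riemann f g)) := by
  have h : Measurable (Function.uncurry fun (s : ℝ) (y : Circ) => g s (y - s)) :=
    measurable_shift hg measurable_fst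
      (measurable_snd.sub (measurable_coe_circ.comp measurable_fst))
  exact (hf.comp measurable_snd).add (measurable_intervalIntegral_param h)

namespace IsSource

variable {g : ℝ → Circ → ℝ} {C : ℝ≥0}

theorem lintegral_shift_le (hg : IsSource g C) (t : ℝ) :
    ∫⁻ y : Circ, ∫⁻ s in Ioc 0 t, ‖g s (y - s)‖ₑ ≤ C * ENNReal.ofReal t := by
  rw [lintegral_lintegral_shift hg.measurable]
  refine (lintegral_mono hg.bound).trans ?_
  rw [setLIntegral_const, Real.volume_Ioc, sub_zero]

/-- Where the source is not integrable along a characteristic, the integral in `riemann` takes the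
default value 0; Tonelli makes such characteristics negligible. -/
theorem ae_integrable_shift (hg : IsSource g C) (t : ℝ) :
    ∀ᵐ y : Circ, IntegrableOn (fun s : ℝ => g s (y - s)) (Ioc 0 t) := by
  have hm : Measurable fun q : Circ × ℝ => g q.2 (q.1 - q.2) := measurable_shift hg.measurable
    measurable_snd (measurable_fst.sub (measurable_coe_circ.comp measurable_snd))
  have h : ∀ᵐ y : Circ, ∫⁻ s in Ioc 0 t, ‖g s (y - s)‖ₑ < ⊤ := by
    refine ae_lt_top (Measurable.lintegral_prod_right' (f := fun q : Circ × ℝ => ‖g q.2 (q.1 - q.2)‖ₑ)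
      hm.enorm) ((hg.lintegral_shift_le t).trans_lt ?_).ne
    exact ENNReal.mul_lt_top ENNReal.coe_lt_top ENNReal.ofReal_lt_top
  filter_upwards [h] with y hy
  exact ⟨(hm.comp (measurable_const.prodMk measurable_id)).aestronglyMeasurable, hy⟩

theorem lintegral_riemann_le (hg : IsSource g C) {f : Circ → ℝ} (hf : Measurable f) {t : ℝ}
    (ht : 0 ≤ t) : ∫⁻ y, ‖riemann f g t y‖ₑ ≤ (∫⁻ y, ‖f y‖ₑ) + C * ENNReal.ofReal t := by
  calc ∫⁻ y, ‖riemann f g t y‖ₑ ≤ ∫⁻ y : Circ, (‖f y‖ₑ + ∫⁻ s in Ioc 0 t, ‖g s (y - s)‖ₑ) := by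
        refine lintegral_mono fun y => (enorm_add_le _ _).trans ?_
        gcongr
        rw [intervalIntegral.integral_of_le ht]
        exact enorm_integral_le_lintegral_enorm _
    _ ≤ _ := by
        rw [lintegral_add_left hf.enorm]
        gcongr
        exact hg.lintegral_shift_le t

/-- The mean of the Riemann invariant is conserved when the source is odd. -/
theorem integral_riemann (hg : IsSource g C) (hodd : ∀ s, ∀ᵐ y : Circ, g s (-y) = -g s y)
    {f : Circ → ℝ} (hf : Integrable f) {t : ℝ} (ht : 0 ≤ t) :
    ∫ y, riemann f g t y = ∫ y, f y := by
  have hm : Measurable fun q : Circ × ℝ => g q.2 (q.1 - q.2) := measurable_shift hg.measurable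
    measurable_snd (measurable_fst.sub (measurable_coe_circ.comp measurable_snd))
  have hi : Integrable (fun q : Circ × ℝ => g q.2 (q.1 - q.2))
      ((volume : Measure Circ).prod (volume.restrict (Ioc 0 t))) := by
    refine ⟨hm.aestronglyMeasurable, ?_⟩
    rw [HasFiniteIntegral, lintegral_prod _ hm.enorm.aemeasurable]
    refine (hg.lintegral_shift_le t).trans_lt ?_
    exact ENNReal.mul_lt_top ENNReal.coe_lt_top ENNReal.ofReal_lt_top
  have h0 : ∀ s : ℝ, ∫ y : Circ, g s (y - s) = 0 := by
    intro s
    rw [integral_sub_right_eq_self (fun y => g s y) (s : Circ)]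
    have := integral_neg_eq_self (fun y => g s y) (volume : Measure Circ)
    rw [integral_congr_ae (hodd s), integral_neg] at this
    linarith
  simp only [riemann, intervalIntegral.integral_of_le ht]
  rw [integral_add hf hi.integral_prod_left, integral_integral_swap hi]
  simp [h0]

end IsSource

/-- Grönwall's inequality in integral form, for functions with values in `[0,∞]`. -/
theorem gronwall_lintegral {E : ℝ → ℝ≥0∞} {A B : ℝ≥0∞} {K T : ℝ} (hK : 0 < K) (hB : B ≠ ⊤)
    (hEB : ∀ t ∈ Icc 0 T, E t ≤ B)
    (h : ∀ t ∈ Icc 0 T, E t ≤ A + ENNReal.ofReal K * ∫⁻ s in Ioc 0 t, E s) :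
    ∀ t ∈ Icc 0 T, E t ≤ ENNReal.ofReal (Real.exp (2 * K * t)) * (2 * A) := by
  -- In this weighted supremum the integral operator has norm at most 1/2. The resulting M ≤ A + M/2
  -- can be solved because `B` makes `M` finite.
  set M : ℝ≥0∞ := ⨆ t ∈ Icc 0 T, ENNReal.ofReal (Real.exp (-(2 * K * t))) * E t with hM
  have hexp : ∀ t : ℝ, ENNReal.ofReal (Real.exp (2 * K * t)) *
      ENNReal.ofReal (Real.exp (-(2 * K * t))) = 1 := fun t => by
    rw [← ENNReal.ofReal_mul (Real.exp_nonneg _), ← Real.exp_add, add_neg_cancel, Real.exp_zero,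
      ENNReal.ofReal_one]
  have hEM : ∀ t ∈ Icc 0 T, E t ≤ ENNReal.ofReal (Real.exp (2 * K * t)) * M := fun t ht => by
    calc E t = ENNReal.ofReal (Real.exp (2 * K * t)) *
          (ENNReal.ofReal (Real.exp (-(2 * K * t))) * E t) := by rw [← mul_assoc, hexp, one_mul]
      _ ≤ _ := by
        gcongr
        exact le_iSup₂ (f := fun t (_ : t ∈ Icc 0 T) =>
          ENNReal.ofReal (Real.exp (-(2 * K * t))) * E t) t ht
  have hMB : M ≤ B := iSup₂_le fun t ht => by
    calc _ ≤ 1 * B := by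
          gcongr
          · rw [← ENNReal.ofReal_one]
            refine ENNReal.ofReal_le_ofReal (Real.exp_le_one_iff.2 ?_)
            have := ht.1
            simp only [Left.neg_nonpos_iff]; positivity
          · exact hEB t ht
      _ = B := one_mul B
  have hMtop : M ≠ ⊤ := (hMB.trans_lt hB.lt_top).ne
  have hint : ∀ t ∈ Icc 0 T, ∫⁻ s in Ioc 0 t, ENNReal.ofReal (Real.exp (2 * K * s)) ≤
      ENNReal.ofReal (Real.exp (2 * K * t) / (2 * K)) := by
    intro t ht
    rw [← ofReal_integral_eq_lintegral_ofReal]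
    · refine ENNReal.ofReal_le_ofReal ?_
      rw [← intervalIntegral.integral_of_le ht.1,
        intervalIntegral.integral_comp_mul_left (fun x => Real.exp x) (by positivity), integral_exp]
      simp only [mul_zero, Real.exp_zero, smul_eq_mul]
      rw [div_eq_inv_mul]
      gcongr
      linarith
    · exact (Continuous.integrableOn_Icc (by fun_prop)).mono_set Ioc_subset_Icc_self
    · exact Eventually.of_forall fun s => (Real.exp_nonneg _)
  have hM2 : M ≤ A + M / 2 := iSup₂_le fun t ht => by
    calc ENNReal.ofReal (Real.exp (-(2 * K * t))) * E t
        ≤ ENNReal.ofReal (Real.exp (-(2 * K * t))) * (A + ENNReal.ofReal K *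
          (ENNReal.ofReal (Real.exp (2 * K * t) / (2 * K)) * M)) := by
          gcongr
          refine (h t ht).trans ?_
          gcongr
          calc ∫⁻ s in Ioc 0 t, E s
              ≤ ∫⁻ s in Ioc 0 t, ENNReal.ofReal (Real.exp (2 * K * s)) * M := by
                refine setLIntegral_mono (by fun_prop) fun s hs => ?_
                exact hEM s ⟨hs.1.le, hs.2.trans ht.2⟩
            _ ≤ _ := by
                rw [lintegral_mul_const _ (by fun_prop)]
                gcongr
                exact hint t ht
      _ ≤ 1 * A + ENNReal.ofReal (1 / 2) * M := by
          rw [mul_add]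
          refine add_le_add ?_ (le_of_eq ?_)
          · gcongr
            rw [← ENNReal.ofReal_one]
            refine ENNReal.ofReal_le_ofReal (Real.exp_le_one_iff.2 ?_)
            have := ht.1
            simp only [Left.neg_nonpos_iff]; positivity
          · rw [← mul_assoc, ← mul_assoc, mul_assoc _ (ENNReal.ofReal K), ← ENNReal.ofReal_mul hK.le,
              ← ENNReal.ofReal_mul (Real.exp_nonneg _)]
            congr 2
            rw [Real.exp_neg]
            have := Real.exp_ne_zero (2 * K * t)
            field_simp
      _ = A + M / 2 := by
          rw [one_mul, ENNReal.div_eq_inv_mul]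
          congr 2
          rw [one_div, ENNReal.ofReal_inv_of_pos two_pos, ENNReal.ofReal_ofNat]
  have hM3 : M ≤ 2 * A := by
    have h2 : M / 2 ≤ A := by
      rw [← ENNReal.add_le_add_iff_right (a := M / 2) (ENNReal.div_ne_top hMtop (by simp)),
        ENNReal.add_halves]
      exact hM2
    calc M = 2 * (M / 2) := (ENNReal.mul_div_cancel (by simp) (by simp)).symm
      _ ≤ 2 * A := by gcongr
  intro t ht
  exact (hEM t ht).trans (by gcongr)

/-- An integrable solution of the damped transport equation on the circle. -/
structure IsMildSol (α : C(Circ, ℝ)) (f : Circ → ℝ) (g : ℝ → Circ → ℝ) (C : ℝ≥0) : Prop where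
  measurable : Measurable f
  integrable : Integrable f
  isSource : IsSource g C
  closed : ∀ᵐ s ∂μTime, ∀ᵐ y : Circ,
    g s y = -(α y * ((riemann f g s (y + s) - riemann f g s (s - y)) / 2))

theorem IsClassicalSol.eq_riemann {α f : C(Circ, ℝ)} {T : ℝ} {V : ℝ → Circ → ℝ}
    (hV : IsClassicalSol α T f V) {t : ℝ} (ht : t ∈ Icc 0 T) (y : Circ) :
    V t y = riemann f (fun s y => -(α y * ((V s (y + s) - V s (s - y)) / 2))) t y := by
  have := hV.integral_eq (Φ := id) (Φ' := fun _ => 1) (fun x => hasDerivAt_id x) continuous_const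
    le_rfl ht.1 ht.2 y
  simp only [id, hV.init, one_mul] at this
  rw [riemann, ← sub_eq_iff_eq_add', this]
  refine intervalIntegral.integral_congr fun s _ => ?_
  simp only [sub_add_cancel, add_sub_assoc, sub_sub_eq_add_sub]

/-- Stability in `L¹`: a mild solution and a classical solution with close data are close. -/
theorem IsMildSol.lintegral_sub_le {α : C(Circ, ℝ)} {f : Circ → ℝ} {g : ℝ → Circ → ℝ} {C : ℝ≥0}
    (hg : IsMildSol α f g C) {φ : C(Circ, ℝ)} {T : ℝ} {V : ℝ → Circ → ℝ}
    (hV : IsClassicalSol α T φ V) {t : ℝ} (ht : t ∈ Icc 0 T) :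
    ∫⁻ y, ‖riemann f g t y - V t y‖ₑ ≤
      ENNReal.ofReal (Real.exp (2 * (‖α‖ + 1) * t)) * (2 * ∫⁻ y, ‖f y - φ y‖ₑ) := by
  set k : ℝ → Circ → ℝ := fun s y => -(α y * ((V s (y + s) - V s (s - y)) / 2)) with hk
  have hVm : Measurable (Function.uncurry V) := hV.cont.measurable
  have hRm := measurable_riemann hg.measurable hg.isSource.measurable
  have hkc : Continuous (Function.uncurry k) := by
    have h2 := continuous_coe_circ
    have e1 : Continuous fun q : ℝ × Circ => V q.1 (q.2 + q.1) :=
      continuous_uncurry_comp hV.cont continuous_fst (by fun_prop)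
    have e2 : Continuous fun q : ℝ × Circ => V q.1 (q.1 - q.2) :=
      continuous_uncurry_comp hV.cont continuous_fst (by fun_prop)
    exact ((α.continuous.comp continuous_snd).mul ((e1.sub e2).div_const 2)).neg
  have hgk : Measurable (Function.uncurry fun s y => g s y - k s y) :=
    hg.isSource.measurable.sub hkc.measurable
  have hfφ : Measurable fun y => f y - φ y := hg.measurable.sub φ.continuous.measurable
  obtain ⟨B, hB⟩ : ∃ B : ℝ, ∀ q ∈ Icc 0 T ×ˢ (univ : Set Circ), ‖Function.uncurry V q‖ ≤ B :=
    (isCompact_Icc.prod isCompact_univ).exists_bound_of_continuousOn hV.cont.continuousOn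
  -- The added 1 keeps the Grönwall constant positive even when `α` vanishes.
  refine gronwall_lintegral (E := fun t => ∫⁻ y, ‖riemann f g t y - V t y‖ₑ) (K := ‖α‖ + 1)
    (T := T) (B := (∫⁻ y, ‖f y‖ₑ) + C * ENNReal.ofReal T + ENNReal.ofReal B * volume (univ : Set Circ))
    (by positivity) ?_ ?_ ?_ t ht
  · have h1 : ∫⁻ y, ‖f y‖ₑ ≠ ⊤ := hg.integrable.2.ne
    have h2 : volume (univ : Set Circ) ≠ ⊤ := measure_ne_top _ _
    finiteness
  · intro s hs
    calc ∫⁻ y, ‖riemann f g s y - V s y‖ₑ ≤ ∫⁻ y, (‖riemann f g s y‖ₑ + ENNReal.ofReal B) := by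
          refine lintegral_mono fun y => enorm_sub_le.trans ?_
          gcongr
          rw [← ofReal_norm]
          exact ENNReal.ofReal_le_ofReal (hB (s, y) ⟨hs, mem_univ y⟩)
      _ ≤ _ := by
          rw [lintegral_add_right _ measurable_const, lintegral_const]
          gcongr
          refine (hg.isSource.lintegral_riemann_le hg.measurable hs.1).trans ?_
          gcongr
          exact hs.2
  · intro s hs
    have hpt : ∀ᵐ y : Circ, ‖riemann f g s y - V s y‖ₑ ≤
        ‖f y - φ y‖ₑ + ∫⁻ σ in Ioc 0 s, ‖g σ (y - σ) - k σ (y - σ)‖ₑ := by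
      filter_upwards [hg.isSource.ae_integrable_shift s] with y hy
      have hky : IntegrableOn (fun σ : ℝ => k σ (y - σ)) (Ioc 0 s) := by
        have h2 := continuous_coe_circ
        have : Continuous fun σ : ℝ => k σ (y - σ) :=
          continuous_uncurry_comp hkc continuous_id (by fun_prop)
        exact this.integrableOn_Icc.mono_set Ioc_subset_Icc_self
      rw [hV.eq_riemann hs, riemann, riemann, add_sub_add_comm,
        intervalIntegral.integral_of_le hs.1, intervalIntegral.integral_of_le hs.1,
        ← integral_sub hy hky]
      refine (enorm_add_le _ _).trans ?_
      gcongr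
      exact enorm_integral_le_lintegral_enorm _
    refine (lintegral_mono_ae hpt).trans ?_
    rw [lintegral_add_left hfφ.enorm,
      lintegral_lintegral_shift (h := fun s y => g s y - k s y) hgk]
    gcongr
    rw [← lintegral_const_mul' _ _ ENNReal.ofReal_ne_top]
    have hcl : ∀ᵐ σ ∂volume.restrict (Ioc 0 s), ∀ᵐ y : Circ,
        g σ y = -(α y * ((riemann f g σ (y + σ) - riemann f g σ (σ - y)) / 2)) :=
      ae_mono (Measure.restrict_mono (fun x hx => hx.1) le_rfl) hg.closed
    refine lintegral_mono_ae ?_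
    filter_upwards [hcl] with σ hσ
    have hD : Measurable fun y => ‖riemann f g σ y - V σ y‖ₑ :=
      ((hRm.comp (measurable_const.prodMk measurable_id)).sub
        (hVm.comp (measurable_const.prodMk measurable_id))).enorm
    calc ∫⁻ y, ‖g σ y - k σ y‖ₑ
        ≤ ∫⁻ y : Circ, ENNReal.ofReal ((‖α‖ + 1) / 2) *
          (‖riemann f g σ (y + σ) - V σ (y + σ)‖ₑ + ‖riemann f g σ (σ - y) - V σ (σ - y)‖ₑ) := by
          refine lintegral_mono_ae ?_
          filter_upwards [hσ] with y hy
          have e : g σ y - k σ y = -(α y / 2) * ((riemann f g σ (y + σ) - V σ (y + σ)) -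
              (riemann f g σ (σ - y) - V σ (σ - y))) := by
            rw [hy, hk]; ring
          rw [e, enorm_mul]
          gcongr
          · rw [← ofReal_norm]
            refine ENNReal.ofReal_le_ofReal ?_
            rw [norm_neg, norm_div, Real.norm_two]
            gcongr
            linarith [α.norm_coe_le_norm y]
          · exact enorm_sub_le
      _ = ENNReal.ofReal (‖α‖ + 1) * ∫⁻ y, ‖riemann f g σ y - V σ y‖ₑ := by
          have hs1 : Measurable fun y : Circ => ‖riemann f g σ (y + σ) - V σ (y + σ)‖ₑ :=
            hD.comp (measurable_id.add_const _)
          rw [lintegral_const_mul' _ _ ENNReal.ofReal_ne_top, lintegral_add_left hs1,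
            lintegral_add_right_eq_self (fun y : Circ => ‖riemann f g σ y - V σ y‖ₑ) (σ : Circ),
            lintegral_sub_left_eq_self (fun y : Circ => ‖riemann f g σ y - V σ y‖ₑ) (σ : Circ),
            ← two_mul, ← mul_assoc]
          congr 1
          rw [← ENNReal.ofReal_ofNat, ← ENNReal.ofReal_mul (by positivity)]
          congr 1
          ring

theorem exists_lintegral_circ_le {p : ℝ} (hp : 1 ≤ p) : ∃ D : ℝ≥0, ∀ h : Circ → ℝ,
    AEStronglyMeasurable h volume → ∫⁻ y, ‖h y‖ₑ ≤ D * eLpNorm h (ENNReal.ofReal p) volume := by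
  set D : ℝ≥0∞ := volume (univ : Set Circ) ^
    (1 / (1 : ℝ≥0∞).toReal - 1 / (ENNReal.ofReal p).toReal) with hD
  have hD' : D ≠ ⊤ := by
    refine ENNReal.rpow_ne_top_of_nonneg ?_ (measure_ne_top _ _)
    rw [ENNReal.toReal_ofReal (by linarith), ENNReal.toReal_one, div_one, sub_nonneg]
    exact (div_le_one (by linarith)).2 hp
  refine ⟨D.toNNReal, fun h hh => ?_⟩
  rw [ENNReal.coe_toNNReal hD', mul_comm, ← eLpNorm_one_eq_lintegral_enorm]
  exact eLpNorm_le_eLpNorm_mul_rpow_measure_univ (one_le_ofReal hp) hh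

theorem exists_continuousMap_eLpNorm_sub_le {p : ℝ} {f : Circ → ℝ}
    (hf : MemLp f (ENNReal.ofReal p) volume) {ε : ℝ≥0∞} (hε : ε ≠ 0) :
    ∃ φ : C(Circ, ℝ), eLpNorm (fun y => f y - φ y) (ENNReal.ofReal p) volume ≤ ε := by
  obtain ⟨φ, hφ, -⟩ := hf.exists_boundedContinuous_eLpNorm_sub_le ENNReal.ofReal_ne_top hε
  exact ⟨φ.toContinuousMap, hφ⟩

theorem exists_continuousMap_integral_eq_zero {p : ℝ} (hp : 1 ≤ p) {f : Circ → ℝ}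
    (hf : MemLp f (ENNReal.ofReal p) volume) (h0 : ∫ y, f y = 0) {ε : ℝ≥0∞} (hε : ε ≠ 0) :
    ∃ φ : C(Circ, ℝ), ∫ y, φ y = 0 ∧
      eLpNorm (fun y => f y - φ y) (ENNReal.ofReal p) volume ≤ ε := by
  obtain ⟨D, hD⟩ := exists_lintegral_circ_le hp
  set D₂ : ℝ≥0∞ := volume (univ : Set Circ) ^ (1 / (ENNReal.ofReal p).toReal) with hD₂
  have hD₂' : D₂ ≠ ⊤ := ENNReal.rpow_ne_top_of_nonneg (by positivity) (measure_ne_top _ _)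
  have hK : 1 + D * D₂ ≠ ⊤ := by finiteness
  -- Removing the mean of `φ` enlarges the error by at most the factor 1 + D·D₂, since `f` has zero
  -- mean.
  obtain ⟨φ, hφ⟩ := exists_continuousMap_eLpNorm_sub_le hf (ENNReal.div_ne_zero.2 ⟨hε, hK⟩)
  set m : ℝ := (∫ y, φ y) / 2 with hm
  have hφi : Integrable φ := integrable_circ φ.continuous
  have hvol : volume.real (univ : Set Circ) = 2 := by
    rw [Measure.real, AddCircle.measure_univ, ENNReal.toReal_ofReal two_pos.le]
  have hfi : Integrable f := hf.integrable (one_le_ofReal hp)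
  have hfm : AEStronglyMeasurable (fun y => f y - φ y) volume := (hfi.sub hφi).1
  have hmle : ‖m‖ₑ ≤ D * eLpNorm (fun y => f y - φ y) (ENNReal.ofReal p) volume := by
    have e : m = -((∫ y, (f y - φ y)) / 2) := by
      rw [integral_sub hfi hφi, h0, hm]; ring
    calc ‖m‖ₑ ≤ ‖∫ y, (f y - φ y)‖ₑ := by
          rw [e, enorm_neg, ← ofReal_norm, ← ofReal_norm]
          refine ENNReal.ofReal_le_ofReal ?_
          rw [norm_div, Real.norm_two]
          linarith [norm_nonneg (∫ y, (f y - φ y))]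
      _ ≤ ∫⁻ y, ‖f y - φ y‖ₑ := enorm_integral_le_lintegral_enorm _
      _ ≤ _ := hD _ hfm
  refine ⟨φ - ContinuousMap.const Circ m, ?_, ?_⟩
  · have : ∀ y, (φ - ContinuousMap.const Circ m) y = φ y - m := fun y => rfl
    simp only [this]
    rw [integral_sub hφi (integrable_const _), integral_const, hvol, hm, smul_eq_mul]
    ring
  · have e : (fun y => f y - (φ - ContinuousMap.const Circ m) y)
        = (fun y => f y - φ y) + fun _ => m := by
      funext y
      simp only [ContinuousMap.sub_apply, ContinuousMap.const_apply, Pi.add_apply]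
      ring
    rw [e]
    have hp0 : ENNReal.ofReal p ≠ 0 := (zero_lt_one.trans_le (one_le_ofReal hp)).ne'
    calc eLpNorm ((fun y => f y - φ y) + fun _ => m) (ENNReal.ofReal p) volume
        ≤ eLpNorm (fun y => f y - φ y) (ENNReal.ofReal p) volume
          + eLpNorm (fun _ : Circ => m) (ENNReal.ofReal p) volume :=
          eLpNorm_add_le hfm aestronglyMeasurable_const (one_le_ofReal hp)
      _ ≤ eLpNorm (fun y => f y - φ y) (ENNReal.ofReal p) volume
          + (D * eLpNorm (fun y => f y - φ y) (ENNReal.ofReal p) volume) * D₂ := by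
          rw [eLpNorm_const' m hp0 ENNReal.ofReal_ne_top]
          gcongr
      _ = eLpNorm (fun y => f y - φ y) (ENNReal.ofReal p) volume * (1 + D * D₂) := by ring
      _ ≤ ε / (1 + D * D₂) * (1 + D * D₂) := by gcongr
      _ ≤ ε := by rw [mul_comm]; exact ENNReal.mul_div_le

/-- Stability in `L^p` of mild solutions. -/
theorem IsMildSol.eLpNorm_sub_le {α : C(Circ, ℝ)} (hα : ∀ x, α (-x) = α x) (hα0 : ∀ x, 0 ≤ α x)
    {p : ℝ} (hp : 1 ≤ p) {f : Circ → ℝ} {g : ℝ → Circ → ℝ} {C : ℝ≥0} (hg : IsMildSol α f g C)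
    (hf : MemLp f (ENNReal.ofReal p) volume) {φ : C(Circ, ℝ)} {T : ℝ} {V : ℝ → Circ → ℝ}
    (hV : IsClassicalSol α T φ V) {t : ℝ} (ht : t ∈ Icc 0 T) :
    eLpNorm (fun y => riemann f g t y - V t y) (ENNReal.ofReal p) volume ≤
      eLpNorm (fun y => f y - φ y) (ENNReal.ofReal p) volume := by
  have hT : 0 ≤ T := ht.1.trans ht.2
  obtain ⟨D, hD⟩ := exists_lintegral_circ_le hp
  have hε : ∀ n : ℕ, ((n : ℝ≥0∞) + 1)⁻¹ ≠ 0 := fun n => by simp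
  choose φn hφn using fun n => exists_continuousMap_eLpNorm_sub_le hf (hε n)
  have hVn : ∀ n, ∃ V, IsClassicalSol α T (φn n) V := fun n => by
    obtain ⟨V, hV, -⟩ := exists_classicalSol α hα0 hT (φn n) (M := ‖φn n‖)
      fun y => (φn n).norm_coe_le_norm y
    exact ⟨V, hV⟩
  choose Vn hVn using hVn
  have hlim : Tendsto (fun n : ℕ => ((n : ℝ≥0∞) + 1)⁻¹) atTop (𝓝 0) := by
    have h := ENNReal.tendsto_inv_nat_nhds_zero.comp (tendsto_add_atTop_nat 1)
    refine h.congr fun n => ?_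
    simp
  have hRm : Measurable (riemann f g t) :=
    (measurable_riemann hg.measurable hg.isSource.measurable).comp
      (measurable_const.prodMk measurable_id)
  have hfm : ∀ ψ : C(Circ, ℝ), AEStronglyMeasurable (fun y => f y - ψ y) volume := fun ψ =>
    (hg.measurable.sub ψ.continuous.measurable).aestronglyMeasurable
  have hL1 : Tendsto (fun n => eLpNorm ((fun y => Vn n t y - V t y) -
      fun y => riemann f g t y - V t y) 1 volume) atTop (𝓝 0) := by
    have hb : ∀ n : ℕ, eLpNorm ((fun y => Vn n t y - V t y) -
        fun y => riemann f g t y - V t y) 1 volume ≤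
        ENNReal.ofReal (Real.exp (2 * (‖α‖ + 1) * t)) * (2 * (D * ((n : ℝ≥0∞) + 1)⁻¹)) := by
      intro n
      have e : ((fun y => Vn n t y - V t y) - fun y => riemann f g t y - V t y)
          = fun y => -(riemann f g t y - Vn n t y) := by
        funext y; simp only [Pi.sub_apply]; ring
      rw [e, eLpNorm_one_eq_lintegral_enorm]
      simp only [enorm_neg]
      refine (hg.lintegral_sub_le (hVn n) ht).trans ?_
      gcongr
      exact (hD _ (hfm _)).trans (by gcongr; exact hφn n)
    refine tendsto_of_tendsto_of_tendsto_of_le_of_le tendsto_const_nhds ?_ (fun _ => zero_le) hb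
    have h1 := ENNReal.Tendsto.const_mul (a := (D : ℝ≥0∞)) hlim (Or.inr ENNReal.coe_ne_top)
    have h2 := ENNReal.Tendsto.const_mul (a := 2) h1 (Or.inr (by simp))
    have h3 := ENNReal.Tendsto.const_mul
      (a := ENNReal.ofReal (Real.exp (2 * (‖α‖ + 1) * t))) h2 (Or.inr ENNReal.ofReal_ne_top)
    simpa using h3
  have hWm : ∀ n, AEStronglyMeasurable (fun y => Vn n t y - V t y) volume := fun n =>
    (((hVn n).continuous_slice t).sub (hV.continuous_slice t)).aestronglyMeasurable
  -- At a fixed time the exponential constant of the L¹ estimate is harmless: it yields convergence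
  -- in measure, along which the L^p norm is lower semicontinuous. The sharp contraction constant
  -- comes from the classical solutions.
  have hmeas := tendstoInMeasure_of_tendsto_eLpNorm one_ne_zero hWm
    (hRm.sub (hV.continuous_slice t).measurable).aestronglyMeasurable hL1
  refine ENNReal.le_of_forall_pos_le_add fun δ hδ _ => ?_
  refine eLpNorm_le_of_tendstoInMeasure ?_ hmeas hWm
  have hev : ∀ᶠ n : ℕ in atTop, ((n : ℝ≥0∞) + 1)⁻¹ ≤ δ :=
    hlim.eventually_le_const (by exact_mod_cast hδ)
  filter_upwards [hev] with n hn
  refine (((hVn n).sub hV).eLpNorm_le hα hα0 hp ht.1 ht.2).trans ?_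
  have e : ⇑(φn n - φ) = (fun y => f y - φ y) - fun y => f y - φn n y := by
    funext y; simp only [ContinuousMap.sub_apply, Pi.sub_apply]; ring
  rw [e]
  refine (MeasureTheory.eLpNorm_sub_le (hfm _) (hfm _) (one_le_ofReal hp)).trans ?_
  gcongr
  exact (hφn n).trans hn

section

variable {α : C(Circ, ℝ)} {p : ℝ} {f : Circ → ℝ} {g : ℝ → Circ → ℝ} {C : ℝ≥0}

/-- Approximation of mild solutions by classical ones, uniformly on compact time intervals. -/
theorem IsMildSol.exists_classicalSol_sub_le (hα : ∀ x, α (-x) = α x) (hα0 : ∀ x, 0 ≤ α x)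
    (hp : 1 ≤ p) (hg : IsMildSol α f g C) (hf : MemLp f (ENNReal.ofReal p) volume) {T : ℝ}
    (hT : 0 ≤ T) {ε : ℝ≥0∞} (hε : ε ≠ 0) : ∃ V : ℝ → Circ → ℝ, Continuous (Function.uncurry V) ∧
      ∀ t ∈ Icc 0 T, eLpNorm (fun y => riemann f g t y - V t y) (ENNReal.ofReal p) volume ≤ ε := by
  obtain ⟨φ, hφ⟩ := exists_continuousMap_eLpNorm_sub_le hf hε
  obtain ⟨V, hV, -⟩ := exists_classicalSol α hα0 hT φ (M := ‖φ‖) fun y => φ.norm_coe_le_norm y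
  exact ⟨V, hV.cont, fun t ht => (hg.eLpNorm_sub_le hα hα0 hp hf hV ht).trans hφ⟩

theorem IsMildSol.measurable_slice (hg : IsMildSol α f g C) (t : ℝ) : Measurable (riemann f g t) :=
  (measurable_riemann hg.measurable hg.isSource.measurable).comp
    (measurable_const.prodMk measurable_id)

theorem IsMildSol.memLp (hα : ∀ x, α (-x) = α x) (hα0 : ∀ x, 0 ≤ α x)
    (hp : 1 ≤ p) (hg : IsMildSol α f g C) (hf : MemLp f (ENNReal.ofReal p) volume) {t : ℝ}
    (ht : 0 ≤ t) : MemLp (riemann f g t) (ENNReal.ofReal p) volume := by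
  obtain ⟨V, hV, h⟩ := hg.exists_classicalSol_sub_le hα hα0 hp hf ht one_ne_zero
  have hVc : Continuous (V t) := continuous_uncurry_comp hV continuous_const continuous_id
  have h1 : MemLp (fun y => riemann f g t y - V t y) (ENNReal.ofReal p) volume :=
    ⟨((hg.measurable_slice t).sub hVc.measurable).aestronglyMeasurable,
      (h t ⟨ht, le_rfl⟩).trans_lt ENNReal.one_lt_top⟩
  have h2 : MemLp (V t) (ENNReal.ofReal p) volume :=
    hVc.memLp_of_hasCompactSupport (HasCompactSupport.of_compactSpace _)
  have := h1.add h2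
  refine this.ae_eq (Eventually.of_forall fun y => ?_)
  simp

/-- Strong stability for mean-zero mild solutions. -/
theorem IsMildSol.tendsto_eLpNorm (hα : ∀ x, α (-x) = α x) (hα0 : ∀ x, 0 ≤ α x)
    {a₀ c d : ℝ} (ha₀ : 0 < a₀) (hcd : c < d) (hsub : Icc c d ⊆ Icc 0 1) (hend : c = 0 ∨ d = 1)
    (hloc : ∀ x ∈ Icc c d, a₀ ≤ α (x : Circ)) (hp : 1 ≤ p) (hg : IsMildSol α f g C)
    (hf : MemLp f (ENNReal.ofReal p) volume) (h0 : ∫ y, f y = 0) :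
    Tendsto (fun t => eLpNorm (riemann f g t) (ENNReal.ofReal p) volume) atTop (𝓝 0) := by
  refine ENNReal.tendsto_nhds_zero.2 fun ε hε => ?_
  obtain ⟨δ, hδ, hδε⟩ := ENNReal.lt_iff_exists_nnreal_btwn.1 hε
  have hδ0 : (0 : ℝ) < δ / 2 := by
    have : (0 : ℝ≥0) < δ := by exact_mod_cast hδ
    positivity
  obtain ⟨φ, hφ0, hφ⟩ := exists_continuousMap_integral_eq_zero hp hf h0
    (ε := ENNReal.ofReal (δ / 2)) (by simpa using hδ0)
  -- `t₀` depends on neither the existence time nor the solution, so a new classical solution may be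
  -- built for each later `t`.
  obtain ⟨t₀, ht₀⟩ := exists_eLpNorm_decay α hα hα0 ha₀ hcd hsub hend hloc hp φ hφ0
    (M := ‖φ‖ + 1) (by positivity) hδ0
  filter_upwards [eventually_ge_atTop t₀, eventually_ge_atTop 0] with t h1 h2
  obtain ⟨V, hV, hVb⟩ := exists_classicalSol α hα0 h2 φ (M := ‖φ‖ + 1)
    fun y => (φ.norm_coe_le_norm y).trans (by linarith)
  have e : riemann f g t = (fun y => riemann f g t y - V t y) + V t := by
    funext y; simp
  rw [e]
  have hVc := hV.continuous_slice t
  refine (eLpNorm_add_le ((hg.measurable_slice t).sub hVc.measurable).aestronglyMeasurable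
    hVc.aestronglyMeasurable (one_le_ofReal hp)).trans ?_
  refine (add_le_add ((hg.eLpNorm_sub_le hα hα0 hp hf hV ⟨h2, le_rfl⟩).trans hφ)
    (ht₀ t V hV hVb t h2 h1 le_rfl)).trans ?_
  rw [← ENNReal.ofReal_add hδ0.le hδ0.le, add_halves]
  simpa using hδε.le

end

/-! ### Return from the circle to the wave equation -/

/-- The velocity on `(0,1)` at time `t` given by the Riemann invariant. -/
noncomputable def oddTrace (h : Circ → ℝ) (t x : ℝ) : ℝ :=
  (h ((x + t : ℝ) : Circ) - h ((-x + t : ℝ) : Circ)) / 2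

/-- The space derivative on `(0,1)` at time `t` given by the Riemann invariant. -/
noncomputable def evenTrace (h : Circ → ℝ) (t x : ℝ) : ℝ :=
  (h ((x + t : ℝ) : Circ) + h ((-x + t : ℝ) : Circ)) / 2

theorem eLpNorm_shift {p : ℝ} {h : Circ → ℝ} (hh : Measurable h) (t : ℝ) :
    eLpNorm (fun y : Circ => h (y + t)) (ENNReal.ofReal p) volume
      = eLpNorm h (ENNReal.ofReal p) volume :=
  eLpNorm_comp_measurePreserving hh.aestronglyMeasurable
    (measurePreserving_add_right (volume : Measure Circ) (t : Circ))

theorem lpNorm01_shift_le {p : ℝ} (hp : 1 ≤ p) {h : Circ → ℝ} (hh : Measurable h) (t : ℝ) :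
    lpNorm01 p (fun x => h ((x + t : ℝ) : Circ)) ≤ eLpNorm h (ENNReal.ofReal p) volume := by
  rw [← eLpNorm_shift hh t]
  exact lpNorm01_coe_le hp fun y : Circ => h (y + t)

theorem lpNorm01_shift_neg_le {p : ℝ} (hp : 1 ≤ p) {h : Circ → ℝ} (hh : Measurable h) (t : ℝ) :
    lpNorm01 p (fun x => h ((-x + t : ℝ) : Circ)) ≤ eLpNorm h (ENNReal.ofReal p) volume := by
  rw [← eLpNorm_shift hh t]
  exact lpNorm01_coe_neg_le hp fun y : Circ => h (y + t)

theorem measurable_shift_coe {h : Circ → ℝ} (hh : Measurable h) (t : ℝ) :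
    Measurable fun x : ℝ => h ((x + t : ℝ) : Circ) :=
  hh.comp (measurable_coe_circ.comp (measurable_id.add_const t))

theorem measurable_shift_coe_neg {h : Circ → ℝ} (hh : Measurable h) (t : ℝ) :
    Measurable fun x : ℝ => h ((-x + t : ℝ) : Circ) :=
  hh.comp (measurable_coe_circ.comp (measurable_neg.add_const t))

theorem measurable_oddTrace {h : Circ → ℝ} (hh : Measurable h) (t : ℝ) :
    Measurable (oddTrace h t) :=
  ((measurable_shift_coe hh t).sub (measurable_shift_coe_neg hh t)).div_const 2

theorem measurable_evenTrace {h : Circ → ℝ} (hh : Measurable h) (t : ℝ) :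
    Measurable (evenTrace h t) :=
  ((measurable_shift_coe hh t).add (measurable_shift_coe_neg hh t)).div_const 2

theorem lpNorm01_half_le {p : ℝ} {k : ℝ → ℝ} {N : ℝ≥0∞} (hk : lpNorm01 p k ≤ N + N) :
    lpNorm01 p (fun x => k x / 2) ≤ N := by
  have e : (fun x => k x / 2) = (1 / 2 : ℝ) • k := by
    funext x; simp only [Pi.smul_apply, smul_eq_mul]; ring
  rw [lpNorm01, e, eLpNorm_const_smul]
  calc ‖(1 / 2 : ℝ)‖ₑ * eLpNorm k (ENNReal.ofReal p) μ01 ≤ ‖(1 / 2 : ℝ)‖ₑ * (N + N) := by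
        gcongr; exact hk
    _ = N := by
        rw [← two_mul, ← mul_assoc, ← ofReal_norm, Real.norm_of_nonneg (by norm_num),
          ← ENNReal.ofReal_ofNat, ← ENNReal.ofReal_mul (by norm_num)]
        norm_num

theorem lpNorm01_oddTrace_le {p : ℝ} (hp : 1 ≤ p) {h : Circ → ℝ} (hh : Measurable h) (t : ℝ) :
    lpNorm01 p (oddTrace h t) ≤ eLpNorm h (ENNReal.ofReal p) volume :=
  lpNorm01_half_le ((eLpNorm_sub_le (measurable_shift_coe hh t).aestronglyMeasurable
    (measurable_shift_coe_neg hh t).aestronglyMeasurable (one_le_ofReal hp)).trans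
    (add_le_add (lpNorm01_shift_le hp hh t) (lpNorm01_shift_neg_le hp hh t)))

theorem lpNorm01_evenTrace_le {p : ℝ} (hp : 1 ≤ p) {h : Circ → ℝ} (hh : Measurable h) (t : ℝ) :
    lpNorm01 p (evenTrace h t) ≤ eLpNorm h (ENNReal.ofReal p) volume :=
  lpNorm01_half_le ((eLpNorm_add_le (measurable_shift_coe hh t).aestronglyMeasurable
    (measurable_shift_coe_neg hh t).aestronglyMeasurable (one_le_ofReal hp)).trans
    (add_le_add (lpNorm01_shift_le hp hh t) (lpNorm01_shift_neg_le hp hh t)))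

theorem oddTrace_sub (h k : Circ → ℝ) (t x : ℝ) :
    oddTrace (fun y => h y - k y) t x = oddTrace h t x - oddTrace k t x := by
  simp only [oddTrace]; ring

/-- Continuity in time of the velocity, by approximation. -/
theorem eventually_lpNorm01_oddTrace_sub_le {p : ℝ} (hp : 1 ≤ p) {R : ℝ → Circ → ℝ}
    (hR : ∀ t, Measurable (R t))
    (happrox : ∀ T : ℝ, 0 ≤ T → ∀ ε : ℝ≥0∞, ε ≠ 0 → ∃ V : ℝ → Circ → ℝ,
      Continuous (Function.uncurry V) ∧ ∀ t ∈ Icc 0 T,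
        eLpNorm (fun y => R t y - V t y) (ENNReal.ofReal p) volume ≤ ε)
    {t : ℝ} (ht : 0 ≤ t) {ε : ℝ} (hε : 0 < ε) :
    ∀ᶠ s in 𝓝 t, 0 ≤ s →
      lpNorm01 p (fun x => oddTrace (R s) s x - oddTrace (R t) t x) ≤ ENNReal.ofReal ε := by
  have hε3 : 0 < ε / 3 := by positivity
  -- The extra unit of time leaves room for times after `t`, so that a single continuous
  -- approximation serves a whole neighbourhood.
  obtain ⟨V, hV, hVR⟩ := happrox (t + 1) (by linarith) (ENNReal.ofReal (ε / 3)) (by simpa using hε3)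
  have h2 := continuous_coe_circ
  have hVc : ∀ s, Measurable (V s) := fun s =>
    (continuous_uncurry_comp hV continuous_const continuous_id).measurable
  have hW : Continuous fun q : ℝ × ℝ => oddTrace (V q.1) q.1 q.2 := by
    have e1 : Continuous fun q : ℝ × ℝ => V q.1 ((q.2 + q.1 : ℝ) : Circ) :=
      continuous_uncurry_comp hV continuous_fst (by fun_prop)
    have e2 : Continuous fun q : ℝ × ℝ => V q.1 ((-q.2 + q.1 : ℝ) : Circ) :=
      continuous_uncurry_comp hV continuous_fst (by fun_prop)
    exact (e1.sub e2).div_const 2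
  have hunif : ∀ᶠ s in 𝓝 t, ∀ x ∈ Icc (0 : ℝ) 1,
      |oddTrace (V s) s x - oddTrace (V t) t x| < ε / 3 := by
    refine isCompact_Icc.eventually_forall_of_forall_eventually fun x _ => ?_
    have : Continuous fun q : ℝ × ℝ => |oddTrace (V q.1) q.1 q.2 - oddTrace (V t) t q.2| :=
      (hW.sub (hW.comp (continuous_const.prodMk continuous_snd))).abs
    refine this.continuousAt.eventually_lt continuousAt_const ?_
    simpa using hε3
  filter_upwards [hunif, Iio_mem_nhds (show t < t + 1 by linarith)] with s hs hs1 hs0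
  have e : (fun x => oddTrace (R s) s x - oddTrace (R t) t x)
      = oddTrace (fun y => R s y - V s y) s +
        (fun x => oddTrace (V s) s x - oddTrace (V t) t x) -
        oddTrace (fun y => R t y - V t y) t := by
    funext x
    simp only [Pi.add_apply, Pi.sub_apply, oddTrace_sub]
    ring
  have m1 := (hR s).sub (hVc s)
  have m2 := (hR t).sub (hVc t)
  have m3 := (measurable_oddTrace (hVc s) s).sub (measurable_oddTrace (hVc t) t)
  rw [lpNorm01, e]
  refine (eLpNorm_sub_le ((measurable_oddTrace m1 s).add m3).aestronglyMeasurable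
    (measurable_oddTrace m2 t).aestronglyMeasurable (one_le_ofReal hp)).trans ?_
  have hmid : eLpNorm (fun x => oddTrace (V s) s x - oddTrace (V t) t x) (ENNReal.ofReal p) μ01
      ≤ ENNReal.ofReal (ε / 3) := by
    refine (eLpNorm_le_of_ae_bound (C := ε / 3) (ae_μ01_mem.mono fun x hx =>
      (hs x (Ioo_subset_Icc_self hx)).le)).trans ?_
    simp
  calc _ ≤ (ENNReal.ofReal (ε / 3) + ENNReal.ofReal (ε / 3)) + ENNReal.ofReal (ε / 3) := by
        refine add_le_add ((eLpNorm_add_le (measurable_oddTrace m1 s).aestronglyMeasurable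
          m3.aestronglyMeasurable (one_le_ofReal hp)).trans (add_le_add ?_ hmid)) ?_
        · exact (lpNorm01_oddTrace_le hp m1 s).trans (hVR s ⟨hs0, le_of_lt hs1⟩)
        · exact (lpNorm01_oddTrace_le hp m2 t).trans (hVR t ⟨ht, by linarith⟩)
    _ = ENNReal.ofReal ε := by
        rw [← ENNReal.ofReal_add hε3.le hε3.le, ← ENNReal.ofReal_add (by positivity) hε3.le]
        congr 1; ring

/-- Minkowski's inequality for averages in time. -/
theorem lpNorm01_average_le {p : ℝ} (hp : 1 ≤ p) {h : ℝ → ℝ → ℝ}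
    (hh : Measurable (Function.uncurry h)) {a b : ℝ} (hab : a ≠ b) {B : ℝ≥0∞}
    (hB : ∀ σ ∈ uIcc a b, lpNorm01 p (h σ) ≤ B) :
    lpNorm01 p (fun x => (∫ σ in a..b, h σ x) / (b - a)) ≤ B := by
  have hp0 : 0 < p := by linarith
  have e : ∀ (μ : Measure ℝ) (k : ℝ → ℝ),
      eLpNorm k (ENNReal.ofReal p) μ ^ p = ∫⁻ x, ‖k x‖ₑ ^ p ∂μ := by
    intro μ k
    rw [eLpNorm_eq_lintegral_rpow_enorm_toReal (by simpa using hp0) ENNReal.ofReal_ne_top,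
      ENNReal.toReal_ofReal hp0.le, ← ENNReal.rpow_mul, one_div, inv_mul_cancel₀ hp0.ne',
      ENNReal.rpow_one]
  have hvol : volume (uIoc a b) = ENNReal.ofReal |b - a| := Real.volume_uIoc
  have hba : 0 < |b - a| := abs_pos.2 (sub_ne_zero.2 hab.symm)
  -- The average is an expectation under the uniform law; monotonicity of L^p norms on a probability
  -- space followed by Tonelli gives the bound, for either order of `a` and `b`.
  set ν := ProbabilityTheory.cond volume (uIoc a b) with hν
  have hνp : IsProbabilityMeasure ν := ProbabilityTheory.cond_isProbabilityMeasure_of_finite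
    (by rw [hvol]; simpa using hba) (by rw [hvol]; exact ENNReal.ofReal_ne_top)
  have hνm : ∀ᵐ σ ∂ν, σ ∈ uIcc a b :=
    (Measure.ae_smul_measure (ae_restrict_mem measurableSet_uIoc) _).mono
      fun σ hσ => uIoc_subset_uIcc hσ
  have hpt : ∀ x, ‖(∫ σ in a..b, h σ x) / (b - a)‖ₑ ^ p ≤ ∫⁻ σ, ‖h σ x‖ₑ ^ p ∂ν := by
    intro x
    have hm : Measurable fun σ => h σ x := hh.comp (measurable_id.prodMk measurable_const)
    rw [← e ν fun σ => h σ x]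
    refine ENNReal.rpow_le_rpow ?_ hp0.le
    refine le_trans ?_ (eLpNorm_le_eLpNorm_of_exponent_le (one_le_ofReal hp) hm.aestronglyMeasurable)
    rw [eLpNorm_one_eq_lintegral_enorm, hν, ProbabilityTheory.cond, lintegral_smul_measure, hvol,
      smul_eq_mul, ← ENNReal.ofReal_inv_of_pos hba, ← ofReal_norm, norm_div, Real.norm_eq_abs (b - a),
      intervalIntegral.norm_integral_eq_norm_integral_uIoc, div_eq_inv_mul,
      ENNReal.ofReal_mul (by positivity), ofReal_norm]
    gcongr
    exact enorm_integral_le_lintegral_enorm _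
  rw [← ENNReal.rpow_le_rpow_iff hp0, lpNorm01, e]
  calc ∫⁻ x, ‖(∫ σ in a..b, h σ x) / (b - a)‖ₑ ^ p ∂μ01
      ≤ ∫⁻ x, ∫⁻ σ, ‖h σ x‖ₑ ^ p ∂ν ∂μ01 := lintegral_mono hpt
    _ = ∫⁻ σ, ∫⁻ x, ‖h σ x‖ₑ ^ p ∂μ01 ∂ν := by
        refine lintegral_lintegral_swap ?_
        exact ((hh.comp measurable_swap).enorm.pow_const p).aemeasurable
    _ ≤ ∫⁻ _, B ^ p ∂ν := by
        refine lintegral_mono_ae (hνm.mono fun σ hσ => ?_)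
        rw [← e]
        exact ENNReal.rpow_le_rpow (hB σ hσ) hp0.le
    _ = B ^ p := by simp

/-- A primitive in time of a function continuous with values in `L^p(0,1)` is differentiable. -/
theorem hasTimeDerivAt_of_primitive {p : ℝ} (hp : 1 ≤ p) {z k : ℝ → ℝ → ℝ} {c : ℝ → ℝ}
    (hk : Measurable (Function.uncurry k)) {t : ℝ} (hkt : MemLp01 p (k t)) (ht : 0 ≤ t)
    (hki : ∀ s, 0 ≤ s → ∀ x, IntervalIntegrable (fun σ => k σ x) volume 0 s)
    (hzk : ∀ s, 0 ≤ s → ∀ᵐ x ∂μ01, z s x = c x + ∫ σ in (0 : ℝ)..s, k σ x)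
    (hcont : ∀ ε : ℝ, 0 < ε → ∀ᶠ s in 𝓝 t, 0 ≤ s →
      lpNorm01 p (fun x => k s x - k t x) ≤ ENNReal.ofReal ε) :
    HasTimeDerivAt p z (k t) t := by
  refine ⟨hkt, ENNReal.tendsto_nhds_zero.2 fun ε hε => ?_⟩
  obtain ⟨δ, hδ, hδε⟩ := ENNReal.lt_iff_exists_nnreal_btwn.1 hε
  have hδ0 : (0 : ℝ) < δ := by exact_mod_cast hδ
  obtain ⟨r, hr, hball⟩ := Metric.eventually_nhds_iff.1 (hcont δ hδ0)
  rw [eventually_nhdsWithin_iff]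
  filter_upwards [Metric.ball_mem_nhds t hr] with s hs hsm
  have hs0 : 0 ≤ s := hsm.1
  have hst : t ≠ s := fun h => hsm.2 h.symm
  have hsub : s - t ≠ 0 := sub_ne_zero.2 hst.symm
  refine le_trans ?_ hδε.le
  have hcongr : (fun x => (z s x - z t x) / (s - t) - k t x) =ᵐ[μ01]
      fun x => (∫ σ in t..s, (k σ x - k t x)) / (s - t) := by
    filter_upwards [hzk s hs0, hzk t ht] with x h1 h2
    have hi := (hki t ht x).symm.trans (hki s hs0 x)
    rw [h1, h2, intervalIntegral.integral_sub hi intervalIntegrable_const,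
      intervalIntegral.integral_const,
      ← intervalIntegral.integral_interval_sub_left (hki s hs0 x) (hki t ht x), smul_eq_mul]
    field_simp
    ring
  rw [lpNorm01, eLpNorm_congr_ae hcongr]
  have hm : Measurable (Function.uncurry fun σ x => k σ x - k t x) :=
    hk.sub (hk.comp (measurable_const.prodMk measurable_snd))
  refine lpNorm01_average_le hp hm hst fun σ hσ => ?_
  have hσ0 : 0 ≤ σ := (le_min ht hs0).trans hσ.1
  have hσr : dist σ t < r := by
    have h1 : |σ - t| ≤ |s - t| := abs_sub_left_of_mem_uIcc hσ
    exact lt_of_le_of_lt h1 hs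
  simpa using hball hσr hσ0

theorem measurable_oddTrace_uncurry {R : ℝ → Circ → ℝ} (hR : Measurable (Function.uncurry R)) :
    Measurable (Function.uncurry fun t x => oddTrace (R t) t x) :=
  ((measurable_shift hR measurable_fst
      (measurable_coe_circ.comp (measurable_snd.add measurable_fst))).sub
    (measurable_shift hR measurable_fst
      (measurable_coe_circ.comp (measurable_snd.neg.add measurable_fst)))).div_const 2

theorem lintegral_oddTrace_le {h : Circ → ℝ} (hh : Measurable h) (t : ℝ) :
    ∫⁻ x, ‖oddTrace h t x‖ₑ ∂μ01 ≤ ∫⁻ y, ‖h y‖ₑ := by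
  have := lpNorm01_oddTrace_le le_rfl hh t
  rwa [lpNorm01, ENNReal.ofReal_one, eLpNorm_one_eq_lintegral_enorm,
    eLpNorm_one_eq_lintegral_enorm] at this

theorem integral_eq_zero_of_odd {h : Circ → ℝ} (hodd : ∀ᵐ y : Circ, h (-y) = -h y) :
    ∫ y, h y = 0 := by
  have := integral_neg_eq_self h (volume : Measure Circ)
  rw [integral_congr_ae hodd, integral_neg] at this
  linarith

/-- The primitive in time of the velocity. -/
theorem half_integral_riemann_eq {g : ℝ → Circ → ℝ} {C : ℝ≥0} (hg : IsSource g C)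
    (hodd : ∀ s, ∀ᵐ y : Circ, g s (-y) = -g s y) {f : Circ → ℝ} (hf : Integrable f) {t x : ℝ}
    (ht : 0 ≤ t) (hx : 0 ≤ x) :
    1 / 2 * ∫ y in (-x)..x, riemann f g t ((y + t : ℝ) : Circ)
      = (1 / 2 * ∫ y in (-x)..x, f (y : Circ))
        + ∫ σ in (0 : ℝ)..t, oddTrace (riemann f g σ) σ x := by
  rw [hg.integral_riemann_sub hodd hf ht hx]
  simp only [oddTrace, intervalIntegral.integral_div]
  ring

/-- A weak solution of the damped wave equation is given by a mild solution of the transport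
equation. -/
theorem IsWeakSolution.exists_isMildSol {p : ℝ} (hp : 1 ≤ p) {a : ℝ → ℝ}
    (ha : ContinuousOn a (Icc 0 1)) {z₀ z₁ : ℝ → ℝ} (hz₀ : MemW0 p z₀) (hz₁ : MemLp01 p z₁)
    {z : ℝ → ℝ → ℝ} (hz : IsWeakSolution p a z₀ z₁ z) :
    ∃ (f : Circ → ℝ) (g : ℝ → Circ → ℝ) (C : ℝ≥0),
      IsMildSol ⟨evenC a, continuous_evenC ha⟩ f g C ∧ MemLp f (ENNReal.ofReal p) volume ∧
      ∫ y, f y = 0 ∧ (∀ s, ∀ᵐ y : Circ, g s (-y) = -g s y) ∧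
      ∀ t, 0 ≤ t → ∀ᵐ x ∂μ01,
        z t x = 1 / 2 * ∫ y in (-x)..x, riemann f g t ((y + t : ℝ) : Circ) := by
  obtain ⟨g₀, hg₀⟩ := hz₀
  obtain ⟨-, w, ⟨hzm, hwm, hzw⟩, hd⟩ := hz
  obtain ⟨w', C, hw', hC, hww⟩ := exists_measurable_rep hp hwm
  obtain ⟨C', hs⟩ := isSource_dampingSource ha hw' hC
  obtain ⟨hprim, hmean⟩ := hg₀.eq_primitive hp
  have hE := memLp_evenC hp hg₀.memLp_deriv
  have hO := memLp_oddC hp hz₁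
  have hEi : Integrable (evenC g₀) := hE.integrable (one_le_ofReal hp)
  have hOi : Integrable (oddC z₁) := hO.integrable (one_le_ofReal hp)
  have hsum := hE.add hO
  set f : Circ → ℝ := hsum.1.mk _ with hfdef
  have hfae : f =ᵐ[volume] fun y => evenC g₀ y + oddC z₁ y := hsum.1.ae_eq_mk.symm
  have hfm : Measurable f := hsum.1.stronglyMeasurable_mk.measurable
  have hfp : MemLp f (ENNReal.ofReal p) volume := hsum.ae_eq hfae.symm
  have hfi : Integrable f := hfp.integrable (one_le_ofReal hp)
  set g := dampingSource a w' with hgdef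
  have hodd : ∀ s, ∀ᵐ y : Circ, g s (-y) = -g s y := dampingSource_neg_ae a w'
  have hform : ∀ t, 0 ≤ t → ∀ᵐ x ∂μ01,
      z t x = 1 / 2 * ∫ y in (-x)..x, riemann f g t ((y + t : ℝ) : Circ) := by
    intro t ht
    filter_upwards [hd t ht, dAlembert_ae_eq hEi hOi hmean hprim hww hs hfae ht] with x h1 h2
    rw [h1, h2]
  have hRm := measurable_riemann hfm hs.measurable
  have hRs : ∀ t, Measurable (riemann f g t) := fun t =>
    hRm.comp (measurable_const.prodMk measurable_id)
  have hfC : Measurable fun x : ℝ => 1 / 2 * ∫ y in (-x)..x, f (y : Circ) := by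
    have hc : Continuous fun x : ℝ => ∫ y in (0 : ℝ)..x, f (y : Circ) :=
      intervalIntegral.continuous_primitive (intervalIntegrable_coe hfi) 0
    have e : (fun x : ℝ => ∫ y in (-x)..x, f (y : Circ)) = fun x =>
        (∫ y in (0 : ℝ)..x, f (y : Circ)) - ∫ y in (0 : ℝ)..(-x), f (y : Circ) := by
      funext x
      rw [intervalIntegral.integral_interval_sub_left (intervalIntegrable_coe hfi _ _)
        (intervalIntegrable_coe hfi _ _)]
    have : Continuous fun x : ℝ => ∫ y in (-x)..x, f (y : Circ) := by
      rw [e]; exact hc.sub (hc.comp continuous_neg)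
    exact (this.measurable).const_mul _
  -- This closes the equation: the velocity recovered from the Riemann invariant agrees with the
  -- `w'` that generated the source.
  have hid := ae_eq_of_isWeakTimeDeriv (k := fun t x => oddTrace (riemann f g t) t x)
    hzm.1 hwm.1 hzw hw' hC hww (measurable_oddTrace_uncurry hRm) (fun T => ?_) hfC fun t ht => ?_
  · refine ⟨f, g, C', ⟨hfm, hfi, hs, ?_⟩, hfp, ?_, hodd, hform⟩
    · filter_upwards [hid] with s hs1
      refine ae_circ_iff.2 ⟨?_, ?_⟩
      · filter_upwards [hs1, ae_μ01_mem] with x h1 hx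
        rw [hgdef, dampingSource, oddC_coe hx, ← h1, oddTrace, ← AddCircle.coe_add,
          ← AddCircle.coe_sub, show s - x = -x + s by ring]
        rfl
      · filter_upwards [hs1, ae_μ01_mem] with x h1 hx
        rw [hgdef, dampingSource, oddC_coe_neg hx, ← h1, oddTrace, ← AddCircle.coe_add,
          ← AddCircle.coe_sub, show s - -x = x + s by ring]
        change -(evenC a _ * _) = -(evenC a _ * _)
        ring
    · rw [integral_congr_ae hfae, integral_add hEi hOi, integral_evenC hEi, hmean,
        integral_eq_zero_of_odd (oddC_neg_ae z₁)]
      ring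
  · have hB : (∫⁻ y, ‖f y‖ₑ) + C' * ENNReal.ofReal T ≠ ⊤ := by
      have : ∫⁻ y, ‖f y‖ₑ ≠ ⊤ := hfi.2.ne
      finiteness
    refine ⟨((∫⁻ y, ‖f y‖ₑ) + C' * ENNReal.ofReal T).toNNReal, fun s hsT => ?_⟩
    rw [ENNReal.coe_toNNReal hB]
    refine (lintegral_oddTrace_le (hRs s) s).trans ((hs.lintegral_riemann_le hfm hsT.1).trans ?_)
    gcongr
    exact hsT.2
  · filter_upwards [hform t ht, ae_μ01_mem] with x h1 hx
    rw [h1, half_integral_riemann_eq hs hodd hfi ht hx.1.le]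

theorem integral_evenTrace {h : Circ → ℝ} (hh : Integrable h) (t x : ℝ) :
    ∫ y in (0 : ℝ)..x, evenTrace h t y = 1 / 2 * ∫ y in (-x)..x, h ((y + t : ℝ) : Circ) := by
  have hi : ∀ b c : ℝ, IntervalIntegrable (fun y : ℝ => h ((y + t : ℝ) : Circ)) volume b c := by
    intro b c
    have := (intervalIntegrable_coe hh (b + t) (c + t)).comp_add_right t
    simpa using this
  have hi' : IntervalIntegrable (fun y : ℝ => h ((-y + t : ℝ) : Circ)) volume 0 x := by
    have := (IntervalIntegrable.iff_comp_neg).1 (hi (-0) (-x))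
    simpa using this
  simp only [evenTrace, intervalIntegral.integral_div]
  rw [intervalIntegral.integral_add (hi 0 x) hi',
    intervalIntegral.integral_comp_neg (fun y : ℝ => h ((y + t : ℝ) : Circ)), neg_zero, add_comm,
    intervalIntegral.integral_add_adjacent_intervals (hi _ _) (hi _ _)]
  ring

/-- The combinations z_x ± z_t at `x` are the invariant at ±x, shifted by `t`, so the two terms of
the norm are the two halves of one integral over the circle. -/
theorem XpNorm_evenTrace_oddTrace {p : ℝ} (hp : 1 ≤ p) {h : Circ → ℝ} (hh : Measurable h) (t : ℝ) :
    XpNorm p (evenTrace h t) (oddTrace h t)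
      = (1 / p * (eLpNorm h (ENNReal.ofReal p) volume).toReal ^ p) ^ (1 / p) := by
  have hp0 : 0 < p := by linarith
  have e1 : ∀ x, evenTrace h t x + oddTrace h t x = h ((x + t : ℝ) : Circ) := fun x => by
    simp only [evenTrace, oddTrace]; ring
  have e2 : ∀ x, evenTrace h t x - oddTrace h t x = h ((-x + t : ℝ) : Circ) := fun x => by
    simp only [evenTrace, oddTrace]; ring
  have m1 := measurable_shift_coe hh t
  have m2 := measurable_shift_coe_neg hh t
  have e3 : ∀ u : ℝ, ENNReal.ofReal (|u| ^ p) = ‖u‖ₑ ^ p := fun u => by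
    rw [← ENNReal.ofReal_rpow_of_nonneg (abs_nonneg u) hp0.le, ← Real.norm_eq_abs, ofReal_norm]
  rw [XpNorm]
  congr 2
  simp only [e1, e2]
  have m : Measurable fun x : ℝ => |h ((x + t : ℝ) : Circ)| ^ p + |h ((-x + t : ℝ) : Circ)| ^ p :=
    (m1.abs.pow_const p).add (m2.abs.pow_const p)
  rw [integral_eq_lintegral_of_nonneg_ae (Eventually.of_forall fun x => by positivity)
    m.aestronglyMeasurable, ENNReal.toReal_rpow]
  congr 1
  rw [← eLpNorm_shift hh t, eLpNorm_eq_lintegral_rpow_enorm_toReal (by simpa using hp0)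
    ENNReal.ofReal_ne_top, ENNReal.toReal_ofReal hp0.le, ← ENNReal.rpow_mul, one_div,
    inv_mul_cancel₀ hp0.ne', ENNReal.rpow_one, lintegral_circ]
  simp only [← AddCircle.coe_add]
  rw [← lintegral_add_left (m1.enorm.pow_const p)]
  refine lintegral_congr fun x => ?_
  rw [ENNReal.ofReal_add (by positivity) (by positivity), e3, e3]

end DampedWave

theorem proposition4p1 (p : ℝ) (hp : 1 ≤ p) (a : ℝ → ℝ) (ha : DampedWave.DampingHypothesis a)
    (z₀ z₁ : ℝ → ℝ) (hz₀ : DampedWave.MemW0 p z₀) (hz₁ : DampedWave.MemLp01 p z₁)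
    (z : ℝ → ℝ → ℝ) (hz : DampedWave.IsWeakSolution p a z₀ z₁ z) :
    ∃ zx zt : ℝ → ℝ → ℝ,
      (∀ t : ℝ, 0 ≤ t →
        DampedWave.HasDerivW0 p (z t) (zx t) ∧ DampedWave.HasTimeDerivAt p z (zt t) t) ∧
      Tendsto (fun t => DampedWave.XpNorm p (zx t) (zt t)) atTop (𝓝 0) := by
  open DampedWave in
  obtain ⟨f, g, C, hmild, hfp, hf0, hodd, hform⟩ := hz.exists_isMildSol hp ha.continuousOn hz₀ hz₁
  have hp0 : 0 < p := by linarith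
  have hα : ∀ x, (⟨evenC a, continuous_evenC ha.continuousOn⟩ : C(Circ, ℝ)) (-x)
      = (⟨evenC a, continuous_evenC ha.continuousOn⟩ : C(Circ, ℝ)) x := evenC_neg a
  have hα0 : ∀ x, 0 ≤ (⟨evenC a, continuous_evenC ha.continuousOn⟩ : C(Circ, ℝ)) x :=
    evenC_nonneg ha.nonneg
  have hR := hmild.measurable_slice
  have hRm := measurable_riemann hmild.measurable hmild.isSource.measurable
  have hRi : ∀ t, 0 ≤ t → Integrable (riemann f g t) := fun t ht =>
    (hmild.memLp hα hα0 hp hfp ht).integrable (one_le_ofReal hp)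
  -- These are the even and odd parts of ρ at time `t`. The zero mean of z_x below is the conserved
  -- mean of ρ, computed over the full period [t - 1, t + 1].
  refine ⟨fun t => evenTrace (riemann f g t) t, fun t => oddTrace (riemann f g t) t,
    fun t ht => ⟨?_, ?_⟩, ?_⟩
  · refine HasDerivW0.of_primitive hp ⟨(measurable_evenTrace (hR t) t).aestronglyMeasurable,
      (lpNorm01_evenTrace_le hp (hR t) t).trans_lt (hmild.memLp hα hα0 hp hfp ht).2⟩ ?_ ?_
    · rw [integral_evenTrace (hRi t ht),
        intervalIntegral.integral_comp_add_right (fun y : ℝ => riemann f g t (y : Circ)) t,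
        show (1 : ℝ) + t = (-1 + t) + 2 by ring, AddCircle.intervalIntegral_preimage,
        hmild.isSource.integral_riemann hodd hmild.integrable ht, hf0, mul_zero]
    · filter_upwards [hform t ht] with x hx
      rw [hx, integral_evenTrace (hRi t ht)]
  · refine hasTimeDerivAt_of_primitive hp (k := fun t => oddTrace (riemann f g t) t)
      (c := fun x => 1 / 2 * ∫ y in (-x)..x, f (y : Circ)) (measurable_oddTrace_uncurry hRm)
      ⟨(measurable_oddTrace (hR t) t).aestronglyMeasurable,
        (lpNorm01_oddTrace_le hp (hR t) t).trans_lt (hmild.memLp hα hα0 hp hfp ht).2⟩ ht ?_ ?_ ?_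
    · intro s hs x
      exact ((hmild.isSource.intervalIntegrable_riemann hmild.integrable hs x).sub
        (hmild.isSource.intervalIntegrable_riemann hmild.integrable hs (-x))).div_const 2
    · intro s hs
      filter_upwards [hform s hs, ae_μ01_mem] with x hx hx1
      rw [hx, half_integral_riemann_eq hmild.isSource hodd hmild.integrable hs hx1.1.le]
    · intro ε hε
      exact eventually_lpNorm01_oddTrace_sub_le hp hR
        (fun T hT ε hε => hmild.exists_classicalSol_sub_le hα hα0 hp hfp hT hε) ht hε
  · obtain ⟨a₀, c, d, ha₀, hcd, hsub, hend, hloc⟩ := ha.localized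
    have hlim := hmild.tendsto_eLpNorm hα hα0 ha₀ hcd hsub hend
      (fun x hx => by
        have : a x = evenC a (x : Circ) := (evenC_coe_Icc (hsub hx)).symm
        exact (hloc x hx).trans_eq this) hp hfp hf0
    simp only [XpNorm_evenTrace_oddTrace hp (hR _)]
    have h1 := (ENNReal.tendsto_toReal ENNReal.zero_ne_top).comp hlim
    rw [ENNReal.toReal_zero] at h1
    have h2 := ((h1.rpow_const (p := p) (Or.inr hp0.le)).const_mul (1 / p)).rpow_const
      (p := 1 / p) (Or.inr (by positivity))
    simpa [Real.zero_rpow hp0.ne', Real.zero_rpow (inv_ne_zero hp0.ne')] using h2
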